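/- Let $k\ge 1$ and $n\ge 2k+1$. The vertices of the (convex) $n$-gon are $0,1,\dots,n-1$ in cyclic order, and an edge $[u,v]$ ($0\le u<v\le n-1$) is any side or diagonal. Edges $[u,v]$ and $[u',v']$ cross if $u<u'<v<v'$ or $u'<u<v'<v$. A $k$-triangulation $T$ of the $n$-gon is an inclusion-maximal set of edges that contains no $k+1$ mutually crossing edges. An edge $[u,v]$ is $k$-relevant if $v-u>k$ and $n-(v-u)>k$. A $k$-star of $T$ is a set of vertices $s_1<\dots<s_{2k+1}$ all of whose edges $[s_a,s_b]$ with $b-a\in\{k,k+1\}$ belong to $T$. For $1\le i\le n-2k$, the $i$-th $k$-star of $T$ is the (unique) $k$-star with $s_{k+1}=k-1+i$. Place a double-faced mirror, parallel to the diagonal $x=y$, at each grid point $(u,v)$ with $[u,v]\in T$, $u<v$. It reflects a ray coming from the left into a ray going up, and a ray coming from below into a ray going right. The $i$-th beam $B_i$ ($1\le i\le n-2k$) is the light ray that starts horizontally from $(-\infty,k-1+i)$, pointing to the right; the mirrors that reflect it are the edges of the $i$-th $k$-star. The beam vector $\psi(T)\in\mathbb R^{n-2k}$ has as $i$-th coordinate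 the area of the region below $B_i$ inside the box $[0,k-1+i]\times[k-1+i,n-1]$. The beam polytope $\Omega_{n,k}$ is the convex hull of the beam vectors of all $k$-triangulations of the $n$-gon. The oriented dual multigraph $T^\#$ has node set $\{1,\dots,n-2k\}$ and one arc for each $k$-relevant edge $e\in T$ common to two $k$-stars of $T$, say the $i$-th and the $j$-th; the arc is oriented from $i$ to $j$, and written $(i,j)$, if $B_i$ lies below and $B_j$ lies above the mirror of $e$ (that is, $B_i$ is reflected there from upwards to rightwards and $B_j$ from rightwards to upwards). The incidence cone $C(G)$ of a directed multigraph $G$ is the set of nonnegative linear combinations of the vectors $e_i-e_j$ for the arcs $(i,j)$ of $G$. The cone of a polytope $P$ at a point $p\in P$ is the set of nonnegative linear combinations of the vectors $x-p$, $x\in P$. Theorem. Let $T$ be a $k$-triangulation of the $n$-gon. Then: 1. The cone of $\Omega_{n,k}$ at $\psi(T)$ equals the incidence cone $C(T^\#)$. 2. $\psi(T)$ is a vertex of $\Omega_{n,k}$ if and only if $T^\#$ is acyclic (has no oriented cycle). 3. If $T^\#$ is acyclic, it defines a partial order on its nodes (reachability by oriented paths), and the vertex $\psi(T)$ of $\Omega_{n,k}$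 is simple (that is, contained in exactly $\dim\Omega_{n,k}$ facets of $\Omega_{n,k}$) if and only if the Hasse diagram of this partial order is a tree. -/

import Mathlib

/-! ### Directed multigraphs, incidence cones, Hasse diagrams -/

/-- A directed multigraph with node set `V` whose arcs carry names in `E`:
`G.IsArc e i j` says that `e` is an arc of `G` with origin `i` and endpoint `j`. -/
structure DirectedMultigraph (V E : Type*) where
  IsArc : E → V → V → Prop

namespace DirectedMultigraph

variable {V E : Type*}

/-- There is at least one arc from `i` to `j`. -/
def Adj (G : DirectedMultigraph V E) (i j : V) : Prop := ∃ e, G.IsArc e i j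

/-- `G` has no oriented cycle. -/
def Acyclic (G : DirectedMultigraph V E) : Prop := ∀ i, ¬ Relation.TransGen G.Adj i i

/-- The incidence cone of `G`: the positive span of the vectors `e_i - e_j`, for the arcs `(i, j)`. -/
noncomputable def incidenceCone [DecidableEq V] (G : DirectedMultigraph V E) :
    PointedCone ℝ (V → ℝ) :=
  PointedCone.hull ℝ {x | ∃ i j, G.Adj i j ∧ x = Pi.single i 1 - Pi.single j 1}

/-- The partial order defined by an acyclic directed multigraph on its nodes:
`i ≤ j` if there is an oriented path (maybe of length zero) from `i` to `j`. -/
abbrev toPartialOrder (G : DirectedMultigraph V E) (h : G.Acyclic) : PartialOrder V where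
  le := Relation.ReflTransGen G.Adj
  le_refl _ := Relation.ReflTransGen.refl
  le_trans _ _ _ := Relation.ReflTransGen.trans
  le_antisymm i j hij hji := by
    rcases Relation.reflTransGen_iff_eq_or_transGen.mp hij with h1 | h1
    · exact h1.symm
    · exact absurd (h1.trans_left hji) (h i)

/-- The Hasse diagram of the partial order defined by an acyclic directed multigraph. -/
def hasseDiagram (G : DirectedMultigraph V E) (h : G.Acyclic) : SimpleGraph V :=
  @SimpleGraph.hasse V (G.toPartialOrder h).toPreorder

end DirectedMultigraph

/-! ### Polytopes -/

namespace ConvexPolytope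

variable {E : Type*} [AddCommGroup E] [Module ℝ E]

/-- The cone of `P` at the point `p`: the positive span of the vectors `x - p`, for `x ∈ P`. -/
def coneAt (P : Set E) (p : E) : PointedCone ℝ E :=
  PointedCone.hull ℝ {v | ∃ x ∈ P, v = x - p}

/-- The dimension of (the affine hull of) a nonempty set. -/
noncomputable def dim (P : Set E) : ℕ := Module.finrank ℝ (vectorSpan ℝ P)

variable [TopologicalSpace E]

/-- `F` is a facet of `P`: a nonempty face, cut out by a supporting linear functional, of
codimension one. -/
def IsFacet (P F : Set E) : Prop := F.Nonempty ∧ IsExposed ℝ P F ∧ dim F + 1 = dim P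

/-- `p` is a simple vertex of the polytope `P`: a vertex which lies in exactly `dim P` facets. -/
def IsSimpleVertex (P : Set E) (p : E) : Prop :=
  p ∈ P.extremePoints ℝ ∧ {F : Set E | IsFacet P F ∧ p ∈ F}.encard = dim P

end ConvexPolytope

/-! ### Multitriangulations

The vertices of the `n`-gon are `0, …, n - 1`, in cyclic order. An edge `[u, v]` with `u < v` is the
pair `(u, v)`. -/

namespace Multitriangulation

/-- The set of all edges of the `n`-gon (sides and diagonals). -/
def edges (n : ℕ) : Finset (ℕ × ℕ) :=
  (Finset.range n ×ˢ Finset.range n).filter fun e => e.1 < e.2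

/-- Two edges cross: their open segments intersect, and they share no vertex. -/
def Crosses (e f : ℕ × ℕ) : Prop :=
  (e.1 < f.1 ∧ f.1 < e.2 ∧ e.2 < f.2) ∨ (f.1 < e.1 ∧ e.1 < f.2 ∧ f.2 < e.2)

/-- `S` contains no `l`-crossing, i.e. no `l` mutually crossing edges. -/
def CrossingFree (l : ℕ) (S : Finset (ℕ × ℕ)) : Prop :=
  ∀ X ⊆ S, (X : Set (ℕ × ℕ)).Pairwise Crosses → X.card ≠ l

/-- A `k`-triangulation of the `n`-gon: a maximal set of edges without `(k+1)`-crossing. -/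
def IsKTriangulation (n k : ℕ) (T : Finset (ℕ × ℕ)) : Prop :=
  Maximal (fun S => S ⊆ edges n ∧ CrossingFree (k + 1) S) T

/-- The edge `e` of the `n`-gon is `k`-relevant: at least `k` vertices of the `n`-gon lie strictly
on each side of it. -/
def IsRelevant (n k : ℕ) (e : ℕ × ℕ) : Prop := k < e.2 - e.1 ∧ k < n - (e.2 - e.1)

/-- `e` is an edge of the `k`-star with vertices `s 0 < ⋯ < s (2k)`, i.e. of the star polygon joining
`s a` to `s (a + k)` for all `a` modulo `2k + 1`. For `a < b`, the vertices `s a` and `s b` are joined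
if and only if `b - a` is `k` or `k + 1`. -/
def IsStarEdge (k : ℕ) (s : Fin (2 * k + 1) → ℕ) (e : ℕ × ℕ) : Prop :=
  ∃ a b : Fin (2 * k + 1), ((b : ℕ) = a + k ∨ (b : ℕ) = a + k + 1) ∧ e = (s a, s b)

/-- The vertices `s 0 < ⋯ < s (2k)` are those of a `k`-star contained in `T`. -/
def IsStarOf (k : ℕ) (T : Finset (ℕ × ℕ)) (s : Fin (2 * k + 1) → ℕ) : Prop :=
  StrictMono s ∧ ∀ e, IsStarEdge k s e → e ∈ T

/-- `e` is an edge of the star of `T` with label `i` (the labels being `0, …, n - 2k - 1`), which is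
the `k`-star of `T` whose middle vertex `s k` is the vertex `k + i`. -/
def IsEdgeOfStar (k : ℕ) (T : Finset (ℕ × ℕ)) (i : ℕ) (e : ℕ × ℕ) : Prop :=
  ∃ s : Fin (2 * k + 1) → ℕ,
    IsStarOf k T s ∧ s ⟨k, by omega⟩ = k + i ∧ IsStarEdge k s e

/-! #### Beams

Each edge `(u, v)` of `T` is a double faced mirror at the grid point `(u, v)`, parallel to the
diagonal `x = y`: it reflects a ray coming from the left into a ray going up, and a ray coming from
below into a ray going right. -/

/-- A ray which travels to the right at height `y` and arrives at the vertical line of abscissa `x`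
leaves this line to the right at height `beamStep T x y`. If there is no mirror at `(x, y)`, it goes
straight. Otherwise it is reflected upwards, and goes up until it meets the next mirror `(x, y')`,
which reflects it to the right. If there is none, it goes up to infinity, which is encoded by `⊤`. -/
def beamStep (T : Finset (ℕ × ℕ)) (x : ℕ) : WithTop ℕ → WithTop ℕ
  | ⊤ => ⊤
  | (y : ℕ) =>
    if (x, y) ∈ T then ((T.filter fun e => e.1 = x ∧ y < e.2).image Prod.snd).min else y

/-- The height at which the beam coming from `(-∞, c)` arrives from the left at the vertical line of
abscissa `x` (so that `beamHeight T c (x + 1)` is its height between the abscissas `x` and `x + 1`).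
The value `⊤` means that the beam has gone up to infinity before. -/
def beamHeight (T : Finset (ℕ × ℕ)) (c : ℕ) : ℕ → WithTop ℕ
  | 0 => c
  | x + 1 => beamStep T x (beamHeight T c x)

/-- The beam coming from `(-∞, c)` is reflected on the upper left face of the mirror `e`
(from rightwards to upwards). -/
def LiesAbove (T : Finset (ℕ × ℕ)) (c : ℕ) (e : ℕ × ℕ) : Prop :=
  e ∈ T ∧ beamHeight T c e.1 = (e.2 : WithTop ℕ)

/-- The beam coming from `(-∞, c)` is reflected on the lower right face of the mirror `e`
(from upwards to rightwards). -/
def LiesBelow (T : Finset (ℕ × ℕ)) (c : ℕ) (e : ℕ × ℕ) : Prop :=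
  e ∈ T ∧ beamHeight T c e.1 < (e.2 : WithTop ℕ) ∧ beamHeight T c (e.1 + 1) = (e.2 : WithTop ℕ)

/-- The area of the region below the beam coming from `(-∞, c)` and inside the box
`[0, c] × [c, n - 1]`: the number of the unit squares `[x, x + 1] × [y, y + 1]` of this box that lie
below the beam. -/
def beamArea (n : ℕ) (T : Finset (ℕ × ℕ)) (c : ℕ) : ℕ :=
  ((Finset.range c ×ˢ Finset.Ico c (n - 1)).filter
    fun q => ((q.2 + 1 : ℕ) : WithTop ℕ) ≤ beamHeight T c (q.1 + 1)).card

/-- The beam vector `ψ(T)`: its coordinate of label `i` is the area for the beam of label `i`, which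
comes from `(-∞, k + i)` (the labels being `0, …, n - 2k - 1`). -/
def beamVector (n k : ℕ) (T : Finset (ℕ × ℕ)) : Fin (n - 2 * k) → ℝ :=
  fun i => (beamArea n T (k + i) : ℝ)

/-- The beam polytope: the convex hull of the beam vectors of all `k`-triangulations. -/
def beamPolytope (n k : ℕ) : Set (Fin (n - 2 * k) → ℝ) :=
  convexHull ℝ {x | ∃ T, IsKTriangulation n k T ∧ x = beamVector n k T}

/-- The oriented dual multigraph of `T`: its nodes are the (labels of the) `k`-stars of `T`, and it
has one arc for each `k`-relevant edge common to two stars `i` and `j`. This arc is oriented from `i`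
to `j` if, at the mirror `e` separating them, beam `i` lies below and beam `j` lies above. -/
def dualMultigraph (n k : ℕ) (T : Finset (ℕ × ℕ)) :
    DirectedMultigraph (Fin (n - 2 * k)) (ℕ × ℕ) where
  IsArc e i j := IsRelevant n k e ∧ IsEdgeOfStar k T i e ∧ IsEdgeOfStar k T j e ∧
    LiesBelow T (k + i) e ∧ LiesAbove T (k + j) e

end Multitriangulation

/-!
A `k`-triangulation `T` is read as a pseudoline arrangement. The grid points `(x, y)` with
`x < y < n` are the commutators of a sorting network (`polygonNetwork`), on which `n` light rays, one
from each height `0, …, n - 1`, are reflected at the edges of `T` and cross each other at all other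
points. The sets of edges which are the contacts of a pseudoline arrangement, with the `k` first and
the `k` last beams fixed and the order of all others reversed, are exactly the `k`-triangulations
(`isKTriangulation_iff`). The reason is a Greene type count: the largest increasing set of contacts in
a box has as many edges as there are beams passing from its left side to its top
(`card_le_upCount`, `exists_card_eq_upCount`); so contacts of an arrangement contain no
`(k+1)`-crossing, while the greedy arrangement touching at all edges of a set without
`(k+1)`-crossing reaches the right endpoints. The mirrors reflecting the beam of a star are edges of
this star (`isEdgeOfStar`), so the arcs of the oriented dual multigraph are the contacts of the
arrangement (`dualMultigraph_adj_iff`), and the beam vector is, up to a constant, a sum of positions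
of pseudolines (`beamArea_eq`).

Flipping a contact with `i` below `j` moves the beam vector by a positive multiple of `e_i - e_j`
(`IsContact.exists_flip`). This gives the arcs as vectors of the cone at `ψ(T)`. Conversely, let `g`
be a functional which is non-negative on all arcs of `T`. It has to be shown that `T` minimizes `g`
among all beam vectors (`IsArrangement.sum_mul_posSum_le`). For an injective function `f` on the
labels that decreases along the pairs which do not cross, there is at most one arrangement at which
all contacts are sorted by `f` (`IsSorted.eq`), by induction on the number of pairs which `f` does not put in decreasing order. Ties
of `g` are broken by an injective refinement `f`; minimizing `f`, either among the minimizers of `g`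
or among the arrangements locally minimal for `g` with the same value as `T`, leads to arrangements
sorted by `f`, so both values of `g` agree. By Farkas' lemma, the cone at `ψ(T)` is the incidence cone
(`coneAt_beamPolytope`).

The other claims only depend on the cone. It contains a line if and only if there is an oriented
cycle. In the acyclic case, the incidence cone is generated by the cover relations, each of which
spans an extreme ray. Comparison with the greedy `k`-triangulation, whose dual multigraph contains a
path through all nodes, shows that the dual multigraph is connected, hence so is the Hasse diagram,
and the cone has codimension one. If the Hasse diagram is a tree, the cone is simplicial. If the
vertex is simple, then there are at most `dim Ω` minimal cuts, as each defines a facet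
(`IsMinimalCut.isFacet`); since the incidence cone is cut out by the minimal cuts
(`mem_incidenceCone_of_isMinimalCut`), it is then simplicial, which bounds the number of its rays, the
cover relations, by the number of edges of a tree (`isSimpleVertex_iff_isTree`).
-/

/-! ### Farkas' lemma -/

/-- **Farkas' lemma**: a vector which does not belong to a finitely generated cone is separated from
it by a linear functional. -/
theorem PointedCone.mem_hull_image_or_exists_linearMap {E ι : Type*} [AddCommGroup E]
    [Module ℝ E] (s : Finset ι) :
    ∀ (b : ι → E) (v : E), v ∈ PointedCone.hull ℝ (b '' s) ∨
      ∃ φ : E →ₗ[ℝ] ℝ, (∀ i ∈ s, 0 ≤ φ (b i)) ∧ φ v < 0 := by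
  classical
  induction s using Finset.induction_on with
  | empty =>
    intro b v
    by_cases hv : v = 0
    · left; rw [hv]; exact zero_mem _
    · right
      obtain ⟨φ, hφ⟩ : ∃ φ : Module.Dual ℝ E, φ v ≠ 0 := by
        by_contra hcon
        push Not at hcon
        exact hv ((Module.forall_dual_apply_eq_zero_iff ℝ v).1 hcon)
      rcases lt_or_gt_of_ne hφ with h | h
      · exact ⟨φ, by simp, h⟩
      · exact ⟨-φ, by simp, by simpa using h⟩
  | insert a s ha ih =>
    intro b v
    rcases ih b v with h | ⟨φ, hφ, hv⟩
    · left
      exact Submodule.span_mono (Set.image_mono (by simp)) h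
    by_cases hφa : 0 ≤ φ (b a)
    · right
      refine ⟨φ, fun i hi => ?_, hv⟩
      rcases Finset.mem_insert.1 hi with rfl | hi
      · exact hφa
      · exact hφ i hi
    push Not at hφa
    -- Project along `b a` onto the kernel of `φ`.
    rcases ih (fun i => b i - (φ (b i) / φ (b a)) • b a) (v - (φ v / φ (b a)) • b a) with
      h | ⟨ψ, hψ, hψv⟩
    · left
      have key : ∀ y ∈ PointedCone.hull ℝ ((fun i => b i - (φ (b i) / φ (b a)) • b a) '' s),
          ∃ t : ℝ, 0 ≤ t ∧ y - t • b a ∈ PointedCone.hull ℝ (b '' s) := by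
        intro y hy
        induction hy using Submodule.span_induction with
        | mem x hx =>
          obtain ⟨i, hi, rfl⟩ := hx
          refine ⟨-(φ (b i) / φ (b a)), ?_, ?_⟩
          · have := div_nonpos_of_nonneg_of_nonpos (hφ i hi) hφa.le
            linarith
          · have : b i - (φ (b i) / φ (b a)) • b a - -(φ (b i) / φ (b a)) • b a = b i := by
              module
            simp only [this]
            exact Submodule.subset_span ⟨i, hi, rfl⟩
        | zero => exact ⟨0, le_rfl, by simp⟩
        | add x y _ _ hx hy =>
          obtain ⟨t, ht, hx⟩ := hx
          obtain ⟨u, hu, hy⟩ := hy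
          refine ⟨t + u, add_nonneg ht hu, ?_⟩
          have : x + y - (t + u) • b a = (x - t • b a) + (y - u • b a) := by module
          rw [this]
          exact add_mem hx hy
        | smul c x _ hx =>
          obtain ⟨t, ht, hx⟩ := hx
          refine ⟨c * t, mul_nonneg c.2 ht, ?_⟩
          have : c • x - ((c : ℝ) * t) • b a = c • (x - t • b a) := by
            rw [smul_sub, mul_smul]; rfl
          rw [this]
          exact Submodule.smul_mem _ _ hx
      obtain ⟨t, ht, h1⟩ := key _ h
      have h2 : v = (v - (φ v / φ (b a)) • b a - t • b a) +
          (⟨φ v / φ (b a) + t, add_nonneg (div_pos_of_neg_of_neg hv hφa).le ht⟩ :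
            {c : ℝ // 0 ≤ c}) • b a := by
        change v = (v - (φ v / φ (b a)) • b a - t • b a) + (φ v / φ (b a) + t) • b a
        module
      rw [h2]
      refine add_mem (Submodule.span_mono (Set.image_mono (by simp)) h1)
        (Submodule.smul_mem _ _ (Submodule.subset_span ⟨a, by simp, rfl⟩))
    · right
      refine ⟨ψ ∘ₗ (LinearMap.id - (φ.smulRight ((φ (b a))⁻¹ • b a))), ?_, ?_⟩
      · intro i hi
        rcases Finset.mem_insert.1 hi with rfl | hi
        · simp [mul_inv_cancel_left₀ hφa.ne]
        · have := hψ i hi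
          simpa [div_eq_mul_inv, mul_assoc, mul_smul] using this
      · simpa [div_eq_mul_inv, mul_assoc, mul_smul] using hψv

/-! ### Incidence cones and cones of convex sets -/

namespace DirectedMultigraph

variable {V A : Type*} [DecidableEq V] (G : DirectedMultigraph V A)

theorem single_sub_single_mem_incidenceCone {i j : V} (h : G.Adj i j) :
    Pi.single i (1 : ℝ) - Pi.single j 1 ∈ G.incidenceCone :=
  Submodule.subset_span ⟨i, j, h, rfl⟩

variable [Fintype V]

/-- The dual of the incidence cone consists of the functions that do not increase along arcs. -/
theorem mem_incidenceCone_iff {x : V → ℝ} :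
    x ∈ G.incidenceCone ↔ ∀ g : V → ℝ, (∀ i j, G.Adj i j → g j ≤ g i) → 0 ≤ x ⬝ᵥ g := by
  classical
  constructor
  · intro hx g hg
    induction hx using Submodule.span_induction with
    | mem x hx =>
      obtain ⟨i, j, hij, rfl⟩ := hx
      simpa [sub_dotProduct] using hg i j hij
    | zero => simp
    | add x y _ _ hx hy => rw [add_dotProduct]; exact add_nonneg hx hy
    | smul c x _ hx =>
      change 0 ≤ ((c : ℝ) • x) ⬝ᵥ g
      rw [smul_dotProduct]; exact mul_nonneg c.2 hx
  · intro h
    rcases PointedCone.mem_hull_image_or_exists_linearMap (Finset.univ.filter fun p : V × V => G.Adj p.1 p.2)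
      (fun p => Pi.single p.1 (1 : ℝ) - Pi.single p.2 1) x with hx | ⟨φ, hφ, hx⟩
    · refine Submodule.span_mono ?_ hx
      rintro _ ⟨p, hp, rfl⟩
      exact ⟨p.1, p.2, by simpa using hp, rfl⟩
    · exfalso
      have h1 := h (fun v => φ (Pi.single v 1)) (fun i j hij => by
        have := hφ (i, j) (by simpa using hij)
        simpa using this)
      have h2 : φ x = x ⬝ᵥ fun v => φ (Pi.single v 1) := by
        rw [LinearMap.pi_apply_eq_sum_univ φ x]
        refine Finset.sum_congr rfl fun i _ => ?_
        have : (fun j => if i = j then (1:ℝ) else 0) = Pi.single i 1 := by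
          ext j; simp [Pi.single_apply, eq_comm]
        simp [this]
      linarith

end DirectedMultigraph

namespace ConvexPolytope

variable {E : Type*} [AddCommGroup E] [Module ℝ E] {P : Set E} {p : E}

theorem sub_mem_coneAt {x : E} (hx : x ∈ P) : x - p ∈ coneAt P p :=
  Submodule.subset_span ⟨x, hx, rfl⟩

/-- A convex set contains an initial segment of each ray of its cone at one of its points. -/
theorem exists_add_smul_mem_of_mem_coneAt (hP : Convex ℝ P) (hp : p ∈ P) {v : E}
    (hv : v ∈ coneAt P p) : ∃ t : ℝ, 0 < t ∧ p + t • v ∈ P := by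
  induction hv using Submodule.span_induction with
  | mem x hx =>
    obtain ⟨y, hy, rfl⟩ := hx
    exact ⟨1, one_pos, by simpa using hy⟩
  | zero => exact ⟨1, one_pos, by simpa using hp⟩
  | add x y _ _ hx hy =>
    obtain ⟨t, ht, hx⟩ := hx
    obtain ⟨u, hu, hy⟩ := hy
    refine ⟨t * u / (t + u), by positivity, ?_⟩
    have h := hP hx hy (a := u / (t + u)) (b := t / (t + u)) (by positivity) (by positivity)
      (by field_simp; ring)
    have h1 : p + (t * u / (t + u)) • (x + y) =
        (u / (t + u)) • (p + t • x) + (t / (t + u)) • (p + u • y) := by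
      have h2 : u / (t + u) + t / (t + u) = 1 := by field_simp; ring
      calc p + (t * u / (t + u)) • (x + y)
          = (u / (t + u) + t / (t + u)) • p + (t * u / (t + u)) • (x + y) := by
            rw [h2, one_smul]
        _ = _ := by module
    rw [h1]; exact h
  | smul c x _ hx =>
    obtain ⟨t, ht, hx⟩ := hx
    rcases eq_or_lt_of_le c.2 with hc | hc
    · refine ⟨1, one_pos, ?_⟩
      have : c = 0 := Subtype.ext hc.symm
      simpa [this] using hp
    · refine ⟨t / c, by positivity, ?_⟩
      have h1 : (t / (c : ℝ)) • (c • x) = t • x := by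
        change (t / (c : ℝ)) • ((c : ℝ) • x) = t • x
        rw [smul_smul, div_mul_cancel₀ _ (ne_of_gt hc)]
      rw [h1]; exact hx

/-- At an extreme point, the cone of a convex set contains no line. -/
theorem eq_zero_of_mem_coneAt_of_neg_mem (hP : Convex ℝ P) (hp : p ∈ P.extremePoints ℝ) {v : E}
    (h1 : v ∈ coneAt P p) (h2 : -v ∈ coneAt P p) : v = 0 := by
  obtain ⟨t, ht, h1⟩ := exists_add_smul_mem_of_mem_coneAt hP hp.1 h1
  obtain ⟨u, hu, h2⟩ := exists_add_smul_mem_of_mem_coneAt hP hp.1 h2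
  have h3 : p ∈ openSegment ℝ (p + t • v) (p + u • -v) := by
    refine ⟨u / (t + u), t / (t + u), by positivity, by positivity, by field_simp; ring, ?_⟩
    have h2 : u / (t + u) + t / (t + u) = 1 := by field_simp; ring
    calc (u / (t + u)) • (p + t • v) + (t / (t + u)) • (p + u • -v)
        = (u / (t + u) + t / (t + u)) • p := by module
      _ = p := by rw [h2, one_smul]
  have h4 := hp.2 h1 h2 h3
  have h5 : t • v = 0 := by simpa using h4
  exact (smul_eq_zero.1 h5).resolve_left ht.ne'

end ConvexPolytope

namespace DirectedMultigraph

variable {V A : Type*} [Fintype V]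

open Classical in
/-- For an acyclic directed multigraph, the number of nodes reachable from a node decreases
strictly along arcs. -/
theorem Acyclic.card_reachable_lt {G : DirectedMultigraph V A} (hG : G.Acyclic) {i j : V}
    (h : G.Adj i j) :
    (Finset.univ.filter fun u => Relation.ReflTransGen G.Adj j u).card <
      (Finset.univ.filter fun u => Relation.ReflTransGen G.Adj i u).card := by
  apply Finset.card_lt_card
  rw [Finset.ssubset_iff_of_subset]
  · refine ⟨i, by simp [Relation.ReflTransGen.refl], ?_⟩
    simp only [Finset.mem_filter, Finset.mem_univ, true_and]
    intro h1
    exact hG i (Relation.TransGen.head' h h1)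
  · intro u
    simp only [Finset.mem_filter, Finset.mem_univ, true_and]
    exact fun hu => hu.head h

variable [DecidableEq V]

/-- The incidence cone of an acyclic directed multigraph is pointed. -/
theorem Acyclic.eq_zero_of_mem_of_neg_mem {G : DirectedMultigraph V A} (hG : G.Acyclic)
    {v : V → ℝ} (h1 : v ∈ G.incidenceCone) (h2 : -v ∈ G.incidenceCone) : v = 0 := by
  classical
  -- A functional which is positive on all generators, and its perturbations by small multiples
  -- of coordinates, are all non-negative on the cone.
  set r : V → ℝ := fun i => (Finset.univ.filter fun u => Relation.ReflTransGen G.Adj i u).card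
    with hr
  have key : ∀ g : V → ℝ, (∀ i j, G.Adj i j → g j ≤ g i) → v ⬝ᵥ g = 0 := by
    intro g hg
    have h3 := (G.mem_incidenceCone_iff.1 h1) g hg
    have h4 := (G.mem_incidenceCone_iff.1 h2) g hg
    rw [neg_dotProduct] at h4
    linarith
  have hr0 : ∀ i j, G.Adj i j → r j + 1 ≤ r i := by
    intro i j hij
    have := hG.card_reachable_lt hij
    simp only [hr]
    exact_mod_cast this
  have h5 := key r (fun i j hij => by have := hr0 i j hij; linarith)
  ext u
  have h6 := key (r + Pi.single u 1) (fun i j hij => by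
    have := hr0 i j hij
    simp only [Pi.add_apply, Pi.single_apply]
    split_ifs <;> linarith)
  rw [dotProduct_add, h5] at h6
  simpa using h6

/-- A point of a convex set whose cone is the incidence cone of `G` is extreme if and only if `G` is
acyclic: an oriented cycle yields a line in the cone. -/
theorem mem_extremePoints_iff_acyclic (G : DirectedMultigraph V A) {P : Set (V → ℝ)} {p : V → ℝ} (hP : Convex ℝ P)
    (hp : p ∈ P) (hC : ConvexPolytope.coneAt P p = G.incidenceCone)
    (hloop : ∀ i, ¬ G.Adj i i) : p ∈ P.extremePoints ℝ ↔ G.Acyclic := by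
  constructor
  · intro hext i hi
    obtain ⟨j, hij, hji⟩ := Relation.TransGen.head'_iff.1 hi
    have h1 : Pi.single i (1 : ℝ) - Pi.single j 1 ∈ G.incidenceCone :=
      G.single_sub_single_mem_incidenceCone hij
    have h2 : -(Pi.single i (1 : ℝ) - Pi.single j 1) ∈ G.incidenceCone := by
      rw [neg_sub]
      clear hij hi h1
      induction hji using Relation.ReflTransGen.head_induction_on with
      | refl => simp
      | head hab _ ih =>
        have := add_mem (G.single_sub_single_mem_incidenceCone hab) ih
        rwa [sub_add_sub_cancel] at this
    have h3 := ConvexPolytope.eq_zero_of_mem_coneAt_of_neg_mem hP hext (hC ▸ h1) (hC ▸ h2)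
    have hne : i ≠ j := fun h => hloop i (by rwa [← h] at hij)
    have := congrFun h3 i
    simp [hne] at this
  · intro hG
    refine ⟨hp, fun x hx y hy hxy => ?_⟩
    obtain ⟨a, b, ha, hb, hab, hpe⟩ := hxy
    have h1 : x - p ∈ G.incidenceCone := hC ▸ ConvexPolytope.sub_mem_coneAt hx
    have h2 : y - p ∈ G.incidenceCone := hC ▸ ConvexPolytope.sub_mem_coneAt hy
    have h3 : -(x - p) = (⟨b / a, by positivity⟩ : {c : ℝ // 0 ≤ c}) • (y - p) := by
      change -(x - p) = (b / a) • (y - p)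
      have h4 : a • (x - p) + b • (y - p) = 0 := by
        have : a • (x - p) + b • (y - p) = (a • x + b • y) - (a + b) • p := by module
        rw [this, hpe, hab, one_smul, sub_self]
      have h5 : b • (y - p) = -(a • (x - p)) := (neg_eq_of_add_eq_zero_right h4).symm
      rw [div_eq_inv_mul, mul_smul, h5, smul_neg, smul_smul, inv_mul_cancel₀ ha.ne', one_smul]
    have h4 : -(x - p) ∈ G.incidenceCone := h3 ▸ Submodule.smul_mem _ _ h2
    exact sub_eq_zero.1 (hG.eq_zero_of_mem_of_neg_mem h1 h4)

end DirectedMultigraph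

/-! ### Facets through a point -/

namespace ConvexPolytope

section Facets

variable {E : Type*} [AddCommGroup E] [Module ℝ E] {P : Set E} {p : E}

theorem nonneg_of_mem_hull {B : Set E} (φ : E →ₗ[ℝ] ℝ) (hφ : ∀ b ∈ B, 0 ≤ φ b) {v : E}
    (hv : v ∈ PointedCone.hull ℝ B) : 0 ≤ φ v := by
  induction hv using Submodule.span_induction with
  | mem x hx => exact hφ x hx
  | zero => simp
  | add x y _ _ hx hy => rw [map_add]; exact add_nonneg hx hy
  | smul c x _ hx =>
    change 0 ≤ φ ((c : ℝ) • x)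
    rw [map_smul]; exact mul_nonneg c.2 hx

/-- The generators of the cone of a convex set at a point span its direction. -/
theorem vectorSpan_eq_span (hP : Convex ℝ P) (hp : p ∈ P) {B : Set E}
    (hC : coneAt P p = PointedCone.hull ℝ B) : vectorSpan ℝ P = Submodule.span ℝ B := by
  rw [vectorSpan_eq_span_vsub_set_right ℝ hp]
  apply le_antisymm
  · rw [Submodule.span_le]
    rintro _ ⟨x, hx, rfl⟩
    have h1 : x - p ∈ PointedCone.hull ℝ B := hC ▸ sub_mem_coneAt hx
    exact Submodule.span_subset_span _ ℝ B h1
  · rw [Submodule.span_le]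
    intro b hb
    have h1 : b ∈ coneAt P p := hC ▸ Submodule.subset_span hb
    obtain ⟨t, ht, h1⟩ := exists_add_smul_mem_of_mem_coneAt hP hp h1
    have h2 : t • b ∈ Submodule.span ℝ ((fun x => x -ᵥ p) '' P) :=
      Submodule.subset_span ⟨_, h1, by simp⟩
    exact (Submodule.smul_mem_iff _ ht.ne').1 h2

variable [FiniteDimensional ℝ E] [TopologicalSpace E] [IsTopologicalAddGroup E]
  [ContinuousSMul ℝ E] [T2Space E]

/-- A linear functional which is non-negative on generators of the cone of `P` at `p`, and whose
zeros among them span a hyperplane, cuts out a facet through `p`. -/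
theorem isFacet_of_hull (hP : Convex ℝ P) (hp : p ∈ P) {B : Set E}
    (hC : coneAt P p = PointedCone.hull ℝ B) (φ : E →ₗ[ℝ] ℝ) (hφ : ∀ b ∈ B, 0 ≤ φ b) {b₀ : E}
    (hb₀ : b₀ ∈ B) (hpos : 0 < φ b₀)
    (hspan : B ⊆ Submodule.span ℝ (insert b₀ {b ∈ B | φ b = 0})) :
    IsFacet P {x ∈ P | φ x = φ p} := by
  have hmin : ∀ y ∈ P, φ p ≤ φ y := by
    intro y hy
    have h1 : y - p ∈ PointedCone.hull ℝ B := hC ▸ sub_mem_coneAt hy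
    have h2 := nonneg_of_mem_hull φ hφ h1
    rw [map_sub] at h2; linarith
  have hpF : p ∈ {x ∈ P | φ x = φ p} := ⟨hp, rfl⟩
  refine ⟨⟨p, hpF⟩, fun _ => ⟨LinearMap.toContinuousLinearMap (-φ), ?_⟩, ?_⟩
  · ext x
    constructor
    · rintro ⟨hx, hxp⟩
      refine ⟨hx, fun y hy => ?_⟩
      have := hmin y hy
      simp [hxp, this]
    · rintro ⟨hx, hxp⟩
      refine ⟨hx, le_antisymm ?_ (hmin x hx)⟩
      simpa using hxp p hp
  · set F := {x ∈ P | φ x = φ p} with hF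
    have hS := vectorSpan_eq_span hP hp hC
    have hWS : vectorSpan ℝ F ≤ vectorSpan ℝ P := vectorSpan_mono ℝ (fun x hx => hx.1)
    have hWker : vectorSpan ℝ F ≤ LinearMap.ker φ := by
      rw [vectorSpan_eq_span_vsub_set_right ℝ hpF, Submodule.span_le]
      rintro _ ⟨x, hx, rfl⟩
      have : φ x = φ p := hx.2
      simp [this]
    have hb₀S : b₀ ∈ vectorSpan ℝ P := hS ▸ Submodule.subset_span hb₀
    have hlt : vectorSpan ℝ F < vectorSpan ℝ P := by
      refine lt_of_le_of_ne hWS fun h => ?_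
      have : b₀ ∈ LinearMap.ker φ := hWker (h ▸ hb₀S)
      rw [LinearMap.mem_ker] at this
      exact hpos.ne' this
    have h1 := Submodule.finrank_lt_finrank_of_lt hlt
    have h2 : vectorSpan ℝ P ≤ vectorSpan ℝ F ⊔ Submodule.span ℝ {b₀} := by
      rw [hS, Submodule.span_le]
      refine hspan.trans ?_
      rw [SetLike.coe_subset_coe, Submodule.span_le]
      rintro b (rfl | ⟨hb, hb0⟩)
      · exact Submodule.mem_sup_right (Submodule.mem_span_singleton_self b)
      · apply Submodule.mem_sup_left
        have h1 : b ∈ coneAt P p := hC ▸ Submodule.subset_span hb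
        obtain ⟨t, ht, h1⟩ := exists_add_smul_mem_of_mem_coneAt hP hp h1
        have h2 : p + t • b ∈ F := ⟨h1, by simp [hb0]⟩
        have h3 := vsub_mem_vectorSpan ℝ h2 hpF
        rw [vsub_eq_sub, add_sub_cancel_left] at h3
        exact (Submodule.smul_mem_iff _ ht.ne').1 h3
    have h3 := Submodule.finrank_mono h2
    have h4 := Submodule.finrank_add_le_finrank_add_finrank (vectorSpan ℝ F)
      (Submodule.span ℝ {b₀})
    have h5 : Module.finrank ℝ (Submodule.span ℝ {b₀}) ≤ 1 := by
      simpa using finrank_span_le_card (R := ℝ) ({b₀} : Set E)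
    unfold dim
    omega

/-- If the cone of `P` at `p` is simplicial, then the number of facets through `p` is the dimension
of `P`: these facets are cut out by the coordinates with respect to the generators of the cone. -/
theorem encard_facets_eq_of_linearIndependent (hP : Convex ℝ P) (hp : p ∈ P) {ι : Type*}
    [Fintype ι] {b : ι → E} (hb : LinearIndependent ℝ b)
    (hC : coneAt P p = PointedCone.hull ℝ (Set.range b)) :
    {F : Set E | IsFacet P F ∧ p ∈ F}.encard = dim P := by
  classical
  have hdim : dim P = Fintype.card ι := by
    unfold dim
    rw [vectorSpan_eq_span hP hp hC, finrank_span_eq_card hb]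
  obtain ⟨c, hc⟩ : ∃ c : ι → E →ₗ[ℝ] ℝ, ∀ l m, c l (b m) = if l = m then 1 else 0 := by
    have : ∀ l, ∃ c : E →ₗ[ℝ] ℝ, ∀ m, c (b m) = if l = m then 1 else 0 := by
      intro l
      obtain ⟨c, hc⟩ := LinearMap.exists_extend ((Finsupp.lapply l) ∘ₗ hb.repr)
      refine ⟨c, fun m => ?_⟩
      have h1 := congrArg (fun f => f ⟨b m, Submodule.subset_span ⟨m, rfl⟩⟩) hc
      simp only [LinearMap.comp_apply, Submodule.subtype_apply] at h1
      rw [h1]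
      have h2 := hb.repr_eq_single m ⟨b m, Submodule.subset_span ⟨m, rfl⟩⟩ rfl
      change (hb.repr ⟨b m, _⟩) l = _
      rw [h2, Finsupp.single_apply]
      simp [eq_comm]
    choose c hc using this
    exact ⟨c, hc⟩
  have hcnn : ∀ l, ∀ x ∈ Set.range b, 0 ≤ c l x := by
    rintro l _ ⟨m, rfl⟩
    rw [hc]; split_ifs <;> norm_num
  set F : ι → Set E := fun l => {x ∈ P | c l x = c l p} with hF
  have hFfacet : ∀ l, IsFacet P (F l) := by
    intro l
    refine isFacet_of_hull hP hp hC (c l) (hcnn l) ⟨l, rfl⟩ (by simp [hc]) ?_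
    rintro _ ⟨m, rfl⟩
    by_cases hlm : l = m
    · subst hlm; exact Submodule.subset_span (Set.mem_insert _ _)
    · exact Submodule.subset_span (Set.mem_insert_of_mem _ ⟨⟨m, rfl⟩, by simp [hc, hlm]⟩)
  have hinj : Function.Injective F := by
    intro l m hlm
    by_contra hne
    have h1 : b m ∈ coneAt P p := hC ▸ Submodule.subset_span ⟨m, rfl⟩
    obtain ⟨t, ht, h1⟩ := exists_add_smul_mem_of_mem_coneAt hP hp h1
    have h2 : p + t • b m ∈ F l := ⟨h1, by simp [hc, hne]⟩
    rw [hlm] at h2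
    have h3 := h2.2
    simp [hc] at h3
    exact ht.ne' h3
  have hset : {F : Set E | IsFacet P F ∧ p ∈ F} = Set.range F := by
    ext F'
    constructor
    · rintro ⟨⟨hne, hexp, hdimF⟩, hpF⟩
      obtain ⟨L, hL⟩ := hexp hne
      have hLp : ∀ y ∈ P, L y ≤ L p := by
        have := hpF
        rw [hL] at this
        exact this.2
      have hF' : F' = {x ∈ P | L x = L p} := by
        rw [hL]
        ext x
        constructor
        · rintro ⟨hx, h⟩
          exact ⟨hx, le_antisymm (hLp x hx) (h p hp)⟩
        · rintro ⟨hx, h⟩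
          exact ⟨hx, fun y hy => h ▸ hLp y hy⟩
      have hLb : ∀ m, L (b m) ≤ 0 := by
        intro m
        have h1 : b m ∈ coneAt P p := hC ▸ Submodule.subset_span ⟨m, rfl⟩
        obtain ⟨t, ht, h1⟩ := exists_add_smul_mem_of_mem_coneAt hP hp h1
        have h2 := hLp _ h1
        simp only [map_add, map_smul, smul_eq_mul] at h2
        by_contra h3
        push Not at h3
        have := mul_pos ht h3
        linarith
      obtain ⟨l, hl⟩ : ∃ l, L (b l) < 0 := by
        by_contra hcon
        push Not at hcon
        have : F' = P := by
          rw [hF']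
          ext x
          refine ⟨fun h => h.1, fun hx => ⟨hx, ?_⟩⟩
          have h1 : x - p ∈ PointedCone.hull ℝ (Set.range b) := hC ▸ sub_mem_coneAt hx
          have h2 := nonneg_of_mem_hull L.toLinearMap (by rintro _ ⟨m, rfl⟩; exact hcon m) h1
          have h3 := hLp x hx
          have h4 : 0 ≤ L (x - p) := h2
          rw [map_sub] at h4
          linarith
        rw [this] at hdimF
        omega
      -- On the cone, `-L` is at least `-L (b l)` times the coordinate `c l`.
      have hsub : F' ⊆ F l := by
        intro x hx
        rw [hF'] at hx
        refine ⟨hx.1, ?_⟩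
        have h1 : x - p ∈ PointedCone.hull ℝ (Set.range b) := hC ▸ sub_mem_coneAt hx.1
        have h2 := nonneg_of_mem_hull (-L.toLinearMap + L (b l) • c l) (by
          rintro _ ⟨m, rfl⟩
          by_cases hlm : l = m
          · subst hlm; simp [hc]
          · simpa [hc, hlm] using hLb m) h1
        have h3 := nonneg_of_mem_hull (c l) (hcnn l) h1
        have h4 : L x = L p := hx.2
        have h5 : -(L x - L p) + L (b l) * (c l x - c l p) = L (b l) * (c l x - c l p) := by
          rw [h4]; ring
        simp only [LinearMap.add_apply, LinearMap.neg_apply, LinearMap.smul_apply, map_sub,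
          smul_eq_mul] at h2 h3
        have h6 : 0 ≤ L (b l) * (c l x - c l p) := by
          have h7 : 0 ≤ -L x + L (b l) * c l x - (-L p + L (b l) * c l p) := h2
          linarith
        nlinarith
      refine ⟨l, ?_⟩
      have hspan : vectorSpan ℝ F' = vectorSpan ℝ (F l) := by
        refine Submodule.eq_of_le_of_finrank_eq (vectorSpan_mono ℝ hsub) ?_
        have := (hFfacet l).2.2
        unfold dim at this hdimF
        omega
      have hker : vectorSpan ℝ F' ≤ LinearMap.ker L.toLinearMap := by
        rw [vectorSpan_eq_span_vsub_set_right ℝ hpF, Submodule.span_le]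
        rintro _ ⟨x, hx, rfl⟩
        rw [hF'] at hx
        have : L x = L p := hx.2
        simp [this]
      apply Set.Subset.antisymm _ hsub
      intro x hx
      rw [hF']
      refine ⟨hx.1, ?_⟩
      have h1 : x -ᵥ p ∈ vectorSpan ℝ (F l) := vsub_mem_vectorSpan ℝ hx ⟨hp, rfl⟩
      have h2 := hker (hspan ▸ h1)
      simpa [sub_eq_zero] using h2
    · rintro ⟨l, rfl⟩
      exact ⟨hFfacet l, hp, rfl⟩
  rw [hset, ← Set.image_univ, hinj.encard_image, Set.encard_univ, hdim, ENat.card_eq_coe_fintype_card]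

end Facets

end ConvexPolytope

/-! ### Minimal cuts -/

namespace DirectedMultigraph

variable {V A : Type*}

/-- A directed multigraph is connected (when orientations are forgotten) if every function which is
constant along arcs is constant. -/
def IsConnected (G : DirectedMultigraph V A) : Prop :=
  ∀ g : V → ℝ, (∀ i j, G.Adj i j → g i = g j) → ∀ i j, g i = g j

/-- A proper nonempty set of nodes which no arc enters, such that the set and its complement are
both connected; the latter is expressed by functions that are constant along the arcs which do not
leave the set. These sets are the sources of the minimal directed cuts. -/
structure IsMinimalCut (G : DirectedMultigraph V A) (U : Finset V) : Prop where
  lower : ∀ i j, G.Adj i j → j ∈ U → i ∈ U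
  nonempty : U.Nonempty
  exists_notMem : ∃ v, v ∉ U
  eq_of_mem : ∀ g : V → ℝ, (∀ i j, G.Adj i j → (i ∈ U ↔ j ∈ U) → g i = g j) →
    ∀ i ∈ U, ∀ j ∈ U, g i = g j
  eq_of_notMem : ∀ g : V → ℝ, (∀ i j, G.Adj i j → (i ∈ U ↔ j ∈ U) → g i = g j) →
    ∀ i, i ∉ U → ∀ j, j ∉ U → g i = g j

variable {G : DirectedMultigraph V A}

theorem IsConnected.exists_adj_mem_notMem (hconn : G.IsConnected) {U : Finset V}
    (hU : ∀ i j, G.Adj i j → j ∈ U → i ∈ U) {a b : V} (ha : a ∈ U) (hb : b ∉ U) :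
    ∃ i j, G.Adj i j ∧ i ∈ U ∧ j ∉ U := by
  classical
  by_contra hcon
  push Not at hcon
  have := hconn (fun v => if v ∈ U then 1 else 0) (fun i j hij => by
    have h1 := hU i j hij
    have h2 := hcon i j hij
    have : i ∈ U ↔ j ∈ U := ⟨h2, h1⟩
    simp [this]) a b
  simp [ha, hb] at this

variable [Fintype V]

/-- A vector of sum zero which is non-negative on all minimal cuts is non-negative on all sets of
nodes that no arc enters: a set that is not a minimal cut is split, or its complement is, and the
pieces have fewer outgoing arcs. -/
theorem sum_nonneg_of_isMinimalCut (hconn : G.IsConnected) {x : V → ℝ} (hx : ∑ v, x v = 0)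
    (hcut : ∀ U, G.IsMinimalCut U → 0 ≤ ∑ v ∈ U, x v) (U : Finset V)
    (hU : ∀ i j, G.Adj i j → j ∈ U → i ∈ U) : 0 ≤ ∑ v ∈ U, x v := by
  classical
  induction hc : (Finset.univ.filter fun q : V × V => G.Adj q.1 q.2 ∧ q.1 ∈ U ∧ q.2 ∉ U).card
    using Nat.strong_induction_on generalizing U with
  | _ N ih =>
  rcases U.eq_empty_or_nonempty with rfl | hne
  · simp
  by_cases hall : ∀ v, v ∈ U
  · rw [Finset.eq_univ_of_forall hall, hx]
  push Not at hall
  by_cases h1 : ∀ g : V → ℝ, (∀ i j, G.Adj i j → (i ∈ U ↔ j ∈ U) → g i = g j) →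
    ∀ i ∈ U, ∀ j ∈ U, g i = g j
  · by_cases h2 : ∀ g : V → ℝ, (∀ i j, G.Adj i j → (i ∈ U ↔ j ∈ U) → g i = g j) →
      ∀ i, i ∉ U → ∀ j, j ∉ U → g i = g j
    · exact hcut U ⟨hU, hne, hall, h1, h2⟩
    · push Not at h2
      obtain ⟨g, hg, i, hi, j, hj, hij⟩ := h2
      have key : ∀ (Q : ℝ → Prop) (i j : V), i ∉ U → j ∉ U → Q (g i) → ¬ Q (g j) →
          ∀ S : Finset V, (∀ v, v ∈ S ↔ v ∉ U ∧ ¬ Q (g v)) → 0 ≤ ∑ v ∈ U ∪ S, x v := by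
        intro Q i j hi hj hQi hQj S hS
        obtain rfl : S = Finset.univ.filter fun v => v ∉ U ∧ ¬ Q (g v) := by
          ext v; simp [hS]
        set U' := U ∪ (Finset.univ.filter fun v => v ∉ U ∧ ¬ Q (g v)) with hU'
        set U'' := U ∪ (Finset.univ.filter fun v => v ∉ U ∧ Q (g v)) with hU''
        have hl' : ∀ a b, G.Adj a b → b ∈ U' → a ∈ U' := by
          intro a b hab hb
          simp only [hU', Finset.mem_union, Finset.mem_filter, Finset.mem_univ, true_and] at hb ⊢
          rcases hb with hb | ⟨hb, hb'⟩
          · exact Or.inl (hU a b hab hb)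
          · by_cases ha : a ∈ U
            · exact Or.inl ha
            · exact Or.inr ⟨ha, by rwa [hg a b hab (by simp [ha, hb])]⟩
        have hl'' : ∀ a b, G.Adj a b → b ∈ U'' → a ∈ U'' := by
          intro a b hab hb
          simp only [hU'', Finset.mem_union, Finset.mem_filter, Finset.mem_univ, true_and] at hb ⊢
          rcases hb with hb | ⟨hb, hb'⟩
          · exact Or.inl (hU a b hab hb)
          · by_cases ha : a ∈ U
            · exact Or.inl ha
            · exact Or.inr ⟨ha, by rwa [hg a b hab (by simp [ha, hb])]⟩
        refine ih _ ?_ U' hl' rfl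
        rw [← hc]
        apply Finset.card_lt_card
        rw [Finset.ssubset_iff_of_subset]
        · obtain ⟨a, b, hab, ha, hb⟩ := hconn.exists_adj_mem_notMem (U := U'') hl''
            (a := i) (b := j) (by simp [hU'', hi, hQi]) (by simp [hU'', hj, hQj])
          simp only [hU'', Finset.mem_union, Finset.mem_filter, Finset.mem_univ, true_and,
            not_or, not_and] at ha hb
          have haU : a ∈ U := by
            rcases ha with ha | ⟨ha, ha'⟩
            · exact ha
            · exact absurd (by rwa [← hg a b hab (by simp [ha, hb.1])]) (hb.2 hb.1)
          refine ⟨(a, b), by simp [hab, haU, hb.1], ?_⟩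
          simp only [hU', Finset.mem_filter, Finset.mem_univ, true_and, not_and, not_not,
            Finset.mem_union]
          exact fun _ _ => Or.inr ⟨hb.1, hb.2 hb.1⟩
        · rintro ⟨a, b⟩ hab
          simp only [hU', Finset.mem_filter, Finset.mem_univ, true_and, Finset.mem_union, not_or,
            not_and, not_not] at hab ⊢
          obtain ⟨hab, ha, hb, hb'⟩ := hab
          refine ⟨hab, ?_, hb⟩
          rcases ha with ha | ⟨ha, ha'⟩
          · exact ha
          · exact absurd (by rw [hg a b hab (by simp [ha, hb])]; exact hb' hb) ha'
      have k1 := key (fun r => r = g i) i j hi hj rfl (fun h => hij h.symm)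
        (Finset.univ.filter fun v => v ∉ U ∧ g v ≠ g i) (by simp)
      have k2 := key (fun r => r ≠ g i) j i hj hi (fun h => hij h.symm) (by simp)
        (Finset.univ.filter fun v => v ∉ U ∧ g v = g i) (by simp)
      rw [Finset.sum_union (by
        rw [Finset.disjoint_left]
        intro a ha ha'
        simp only [Finset.mem_filter] at ha'
        exact ha'.2.1 ha)] at k1 k2
      have h3 : ∑ v ∈ Finset.univ.filter (fun v => v ∉ U ∧ g v ≠ g i), x v +
          ∑ v ∈ Finset.univ.filter (fun v => v ∉ U ∧ g v = g i), x v + ∑ v ∈ U, x v = 0 := by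
        rw [← hx, ← Finset.sum_union, ← Finset.sum_union]
        · congr 1
          ext v
          simp only [Finset.mem_union, Finset.mem_filter, Finset.mem_univ, true_and, iff_true]
          tauto
        · rw [Finset.disjoint_left]
          intro a ha
          simp only [Finset.mem_union, Finset.mem_filter, Finset.mem_univ, true_and] at ha
          tauto
        · rw [Finset.disjoint_left]
          intro a ha
          simp only [Finset.mem_filter, Finset.mem_univ, true_and] at ha ⊢
          tauto
      linarith
  · push Not at h1
    obtain ⟨g, hg, i, hi, j, hj, hij⟩ := h1
    have key : ∀ (Q : ℝ → Prop) (i j : V), i ∈ U → j ∈ U → Q (g i) → ¬ Q (g j) →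
        ∀ S : Finset V, (∀ v, v ∈ S ↔ v ∈ U ∧ Q (g v)) → 0 ≤ ∑ v ∈ S, x v := by
      intro Q i j hi hj hQi hQj S hS
      obtain rfl : S = U.filter fun v => Q (g v) := by
        ext v; simp [hS]
      have hl : ∀ (Q : ℝ → Prop) a b, G.Adj a b → b ∈ U.filter (fun v => Q (g v)) →
          a ∈ U.filter (fun v => Q (g v)) := by
        intro Q a b hab hb
        simp only [Finset.mem_filter] at hb ⊢
        have ha := hU a b hab hb.1
        exact ⟨ha, by rw [hg a b hab (by simp [ha, hb.1])]; exact hb.2⟩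
      refine ih _ ?_ _ (hl Q) rfl
      rw [← hc]
      apply Finset.card_lt_card
      rw [Finset.ssubset_iff_of_subset]
      · obtain ⟨a, b, hab, ha, hb⟩ := hconn.exists_adj_mem_notMem
          (hl (fun r => ¬ Q r)) (a := j) (b := i) (by simp [hj, hQj]) (by simp [hQi])
        simp only [Finset.mem_filter, not_and, not_not] at ha hb
        have hbU : b ∉ U := fun h => ha.2 (by rw [hg a b hab (by simp [ha.1, h])]; exact hb h)
        exact ⟨(a, b), by simp [hab, ha.1, hbU], by simp [ha.2]⟩
      · rintro ⟨a, b⟩ hab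
        simp only [Finset.mem_filter, Finset.mem_univ, true_and, not_and] at hab ⊢
        refine ⟨hab.1, hab.2.1.1, fun hb => hab.2.2 hb ?_⟩
        rw [← hg a b hab.1 (by simp [hab.2.1.1, hb])]
        exact hab.2.1.2
    have k1 := key (fun r => r = g i) i j hi hj rfl (fun h => hij h.symm)
      (U.filter fun v => g v = g i) (by simp)
    have k2 := key (fun r => ¬ r = g i) j i hj hi (fun h => hij h.symm) (by simp)
      (U.filter fun v => ¬ g v = g i) (by simp)
    rw [← Finset.sum_filter_add_sum_filter_not U (fun v => g v = g i)]
    exact add_nonneg k1 k2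

variable [DecidableEq V]

/-- The incidence cone of a connected directed multigraph is cut out by its minimal cuts. -/
theorem mem_incidenceCone_of_isMinimalCut (hconn : G.IsConnected) {x : V → ℝ}
    (hx : ∑ v, x v = 0) (hcut : ∀ U, G.IsMinimalCut U → 0 ≤ ∑ v ∈ U, x v) :
    x ∈ G.incidenceCone := by
  classical
  rw [mem_incidenceCone_iff]
  intro g hg
  -- Peel off the highest level set of `g`.
  induction hc : (Finset.univ.image g).card using Nat.strong_induction_on generalizing g with
  | _ N ih =>
  rcases isEmpty_or_nonempty V with hV | hV
  · simp [dotProduct]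
  obtain ⟨m, -, hm⟩ := Finset.exists_max_image Finset.univ g Finset.univ_nonempty
  set U := Finset.univ.filter fun v => g v = g m with hUdef
  have hU : ∀ i j, G.Adj i j → j ∈ U → i ∈ U := by
    intro i j hij hj
    simp only [hUdef, Finset.mem_filter, Finset.mem_univ, true_and] at hj ⊢
    exact le_antisymm (hm i (Finset.mem_univ i)) (hj ▸ hg i j hij)
  by_cases hall : (Finset.univ.filter fun v => v ∉ U).Nonempty
  · obtain ⟨l, hl, hlm⟩ := Finset.exists_max_image _ g hall
    have hlU : g l ≠ g m := by simpa [hUdef] using hl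
    have hlt : g l < g m := lt_of_le_of_ne (hm l (Finset.mem_univ l)) hlU
    set g' : V → ℝ := fun v => if v ∈ U then g l else g v with hg'
    have hmem : ∀ v, v ∈ U ↔ g v = g m := by simp [hUdef]
    have hle : ∀ v, v ∉ U → g v ≤ g l := fun v hv => hlm v (by simpa using hv)
    have h1 : 0 ≤ x ⬝ᵥ g' := by
      refine ih _ ?_ g' ?_ rfl
      · rw [← hc]
        apply Finset.card_lt_card
        rw [Finset.ssubset_iff_of_subset]
        · refine ⟨g m, by simp, ?_⟩
          simp only [hg', Finset.mem_image, Finset.mem_univ, true_and, not_exists]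
          intro v
          split_ifs with hv
          · exact hlU
          · exact fun h => hv ((hmem v).2 h)
        · intro r hr
          simp only [hg', Finset.mem_image, Finset.mem_univ, true_and] at hr ⊢
          obtain ⟨v, rfl⟩ := hr
          split_ifs
          · exact ⟨l, rfl⟩
          · exact ⟨v, rfl⟩
      · intro i j hij
        have := hU i j hij
        simp only [hg']
        split_ifs with h1 h2 h2
        · exact le_rfl
        · exact absurd (this h1) h2
        · exact hle j h1
        · exact hg i j hij
    have h2 := sum_nonneg_of_isMinimalCut hconn hx hcut U hU
    have h3 : x ⬝ᵥ g = x ⬝ᵥ g' + (g m - g l) * ∑ v ∈ U, x v := by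
      have h4 : (g m - g l) * ∑ v ∈ U, x v = ∑ v, if v ∈ U then (g m - g l) * x v else 0 := by
        rw [Finset.mul_sum, ← Finset.sum_filter]
        congr 1
        ext v; simp
      rw [h4]
      simp only [dotProduct]
      rw [← Finset.sum_add_distrib]
      refine Finset.sum_congr rfl fun v _ => ?_
      simp only [hg']
      split_ifs with hv
      · rw [(hmem v).1 hv]; ring
      · ring
    rw [h3]
    exact add_nonneg h1 (mul_nonneg (by linarith) h2)
  · have hconst : ∀ v, g v = g m := by
      intro v
      by_contra hv
      exact hall ⟨v, by simpa [hUdef] using hv⟩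
    have : x ⬝ᵥ g = (∑ v, x v) * g m := by
      rw [Finset.sum_mul]
      exact Finset.sum_congr rfl fun v _ => by rw [hconst v]
    rw [this, hx, zero_mul]

theorem sum_eq_zero_of_mem_incidenceCone {x : V → ℝ} (hx : x ∈ G.incidenceCone) :
    ∑ v, x v = 0 := by
  have h1 := G.mem_incidenceCone_iff.1 hx (fun _ => 1) (fun _ _ _ => le_rfl)
  have h2 := G.mem_incidenceCone_iff.1 hx (fun _ => -1) (fun _ _ _ => le_rfl)
  simp only [dotProduct, mul_one, mul_neg, Finset.sum_neg_distrib] at h1 h2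
  linarith

/-- The set of the vectors `e_i - e_j`, for the arcs `(i, j)`. -/
def arcVectors (G : DirectedMultigraph V A) : Set (V → ℝ) :=
  {x | ∃ i j, G.Adj i j ∧ x = Pi.single i 1 - Pi.single j 1}

theorem mem_span_of_forall_linearMap {W : Submodule ℝ (V → ℝ)} {x : V → ℝ}
    (h : ∀ g : V → ℝ, (∀ w ∈ W, w ⬝ᵥ g = 0) → x ⬝ᵥ g = 0) : x ∈ W := by
  by_contra hx
  obtain ⟨φ, hφx, hφ⟩ := Submodule.exists_le_ker_of_notMem hx
  have h2 : ∀ y : V → ℝ, φ y = y ⬝ᵥ fun v => φ (Pi.single v 1) := by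
    intro y
    rw [LinearMap.pi_apply_eq_sum_univ φ y]
    refine Finset.sum_congr rfl fun i _ => ?_
    have : (fun j => if i = j then (1:ℝ) else 0) = Pi.single i 1 := by
      ext j; simp [Pi.single_apply, eq_comm]
    simp [this]
  apply hφx
  rw [h2]
  exact h _ (fun w hw => by rw [← h2]; exact hφ hw)

/-- The arc vectors of a connected directed multigraph span the hyperplane of the vectors with sum
zero. -/
theorem finrank_span_arcVectors [Nonempty V] (hconn : G.IsConnected) :
    Module.finrank ℝ (Submodule.span ℝ G.arcVectors) + 1 = Fintype.card V := by
  have h1 : Submodule.span ℝ G.arcVectors =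
      LinearMap.ker (∑ v, LinearMap.proj v : (V → ℝ) →ₗ[ℝ] ℝ) := by
    apply le_antisymm
    · rw [Submodule.span_le]
      rintro _ ⟨i, j, -, rfl⟩
      simp
    · intro x hx
      apply mem_span_of_forall_linearMap
      intro g hg
      obtain ⟨v₀⟩ := ‹Nonempty V›
      have h2 : ∀ v, g v = g v₀ := fun v => hconn g (fun i j hij => by
        have := hg _ (Submodule.subset_span ⟨i, j, hij, rfl⟩)
        rw [sub_dotProduct] at this
        simpa [sub_eq_zero] using this) v v₀
      have h3 : ∑ v, x v = 0 := by simpa using hx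
      have : x ⬝ᵥ g = (∑ v, x v) * g v₀ := by
        rw [Finset.sum_mul]
        exact Finset.sum_congr rfl fun v _ => by rw [h2 v]
      rw [this, h3, zero_mul]
  have h2 := LinearMap.finrank_range_add_finrank_ker
    (∑ v, LinearMap.proj v : (V → ℝ) →ₗ[ℝ] ℝ)
  have h3 : LinearMap.range (∑ v, LinearMap.proj v : (V → ℝ) →ₗ[ℝ] ℝ) = ⊤ := by
    rw [LinearMap.range_eq_top]
    intro r
    obtain ⟨v₀⟩ := ‹Nonempty V›
    exact ⟨Pi.single v₀ r, by simp⟩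
  rw [h3, finrank_top, Module.finrank_self, Module.finrank_fintype_fun_eq_card] at h2
  rw [h1]; omega

end DirectedMultigraph

/-! ### Cover relations and simple vertices -/

namespace DirectedMultigraph

variable {V A : Type*} {G : DirectedMultigraph V A}

/-- The node `j` covers `i` in the order of reachability by oriented paths. -/
def IsCover (G : DirectedMultigraph V A) (i j : V) : Prop :=
  Relation.TransGen G.Adj i j ∧ ∀ u, Relation.TransGen G.Adj i u → ¬ Relation.TransGen G.Adj u j

theorem lt_iff_transGen (h : G.Acyclic) {i j : V} :
    (G.toPartialOrder h).lt i j ↔ Relation.TransGen G.Adj i j := by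
  let _ := G.toPartialOrder h
  change i < j ↔ _
  rw [lt_iff_le_and_ne]
  change Relation.ReflTransGen G.Adj i j ∧ _ ↔ _
  rw [Relation.reflTransGen_iff_eq_or_transGen]
  constructor
  · rintro ⟨h1 | h1, h2⟩
    · exact absurd h1.symm h2
    · exact h1
  · intro h1
    exact ⟨Or.inr h1, fun h2 => h i (by rwa [← h2] at h1)⟩

theorem covBy_iff_isCover (h : G.Acyclic) {i j : V} :
    @CovBy V (G.toPartialOrder h).toLT i j ↔ G.IsCover i j := by
  unfold CovBy IsCover
  constructor
  · rintro ⟨h1, h2⟩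
    refine ⟨(lt_iff_transGen h).1 h1, fun u hu hu' => ?_⟩
    exact h2 ((lt_iff_transGen h).2 hu) ((lt_iff_transGen h).2 hu')
  · rintro ⟨h1, h2⟩
    refine ⟨(lt_iff_transGen h).2 h1, fun u hu hu' => ?_⟩
    exact h2 u ((lt_iff_transGen h).1 hu) ((lt_iff_transGen h).1 hu')

theorem hasseDiagram_adj (h : G.Acyclic) {i j : V} :
    (G.hasseDiagram h).Adj i j ↔ G.IsCover i j ∨ G.IsCover j i := by
  rw [← covBy_iff_isCover h, ← covBy_iff_isCover h]
  rfl

theorem IsCover.adj {i j : V} (hc : G.IsCover i j) : G.Adj i j := by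
  obtain ⟨u, hiu, huj⟩ := Relation.TransGen.head'_iff.1 hc.1
  rcases Relation.reflTransGen_iff_eq_or_transGen.1 huj with rfl | huj
  · exact hiu
  · exact absurd huj (hc.2 u (Relation.TransGen.single hiu))

theorem transGen_isCover_of_adj [Finite V] (h : G.Acyclic) {i j : V} (hij : G.Adj i j) :
    Relation.TransGen G.IsCover i j := by
  classical
  let _ := Fintype.ofFinite V
  let _ := G.toPartialOrder h
  let _ : DecidableLE V := Classical.decRel _
  let _ : LocallyFiniteOrder V := Fintype.toLocallyFiniteOrder
  have h1 : i < j := (lt_iff_transGen h).2 (Relation.TransGen.single hij)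
  exact Relation.TransGen.mono (fun a b hab => (covBy_iff_isCover h).1 hab) _ _
    (transGen_covBy_of_lt h1)

theorem hasseDiagram_connected [Finite V] [Nonempty V] (h : G.Acyclic) (hconn : G.IsConnected) :
    (G.hasseDiagram h).Connected := by
  classical
  refine ⟨fun a b => ?_⟩
  have := hconn (fun v => if (G.hasseDiagram h).Reachable a v then 1 else 0) (fun i j hij => by
    have h1 : (G.hasseDiagram h).Reachable i j := by
      have h2 := transGen_isCover_of_adj h hij
      clear hij
      induction h2 with
      | single hc => exact ((hasseDiagram_adj h).2 (Or.inl hc)).reachable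
      | tail _ hc ih => exact ih.trans ((hasseDiagram_adj h).2 (Or.inl hc)).reachable
    have h2 : (G.hasseDiagram h).Reachable a i ↔ (G.hasseDiagram h).Reachable a j :=
      ⟨fun h3 => h3.trans h1, fun h3 => h3.trans h1.symm⟩
    simp [h2]) a b
  by_contra hab
  simp [hab] at this

theorem card_edgeSet_hasseDiagram (h : G.Acyclic) :
    Nat.card (G.hasseDiagram h).edgeSet = Nat.card {q : V × V // G.IsCover q.1 q.2} := by
  symm
  refine Nat.card_congr (Equiv.ofBijective
    (fun q => ⟨s(q.1.1, q.1.2), (hasseDiagram_adj h).2 (Or.inl q.2)⟩) ⟨?_, ?_⟩)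
  · rintro ⟨⟨a, b⟩, hab⟩ ⟨⟨c, d⟩, hcd⟩ heq
    have heq' : s(a, b) = s(c, d) := congrArg Subtype.val heq
    simp only [Subtype.mk.injEq, Prod.mk.injEq]
    rcases Sym2.eq_iff.1 heq' with h1 | ⟨rfl, rfl⟩
    · exact h1
    · exact absurd (hab.1.trans hcd.1) (h _)
  · rintro ⟨e, he⟩
    induction e using Sym2.ind with
    | _ a b =>
    rcases (hasseDiagram_adj h).1 he with hc | hc
    · exact ⟨⟨(a, b), hc⟩, rfl⟩
    · exact ⟨⟨(b, a), hc⟩, Subtype.ext Sym2.eq_swap⟩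

/-- The cover relations suffice to generate the incidence cone, because an arc is the sum of the
cover relations on a maximal chain between its ends. -/
theorem incidenceCone_eq_hull_isCover [DecidableEq V] [Finite V] (h : G.Acyclic) :
    G.incidenceCone = PointedCone.hull ℝ (Set.range fun q : {q : V × V // G.IsCover q.1 q.2} =>
      (Pi.single q.1.1 1 - Pi.single q.1.2 1 : V → ℝ)) := by
  apply le_antisymm
  · unfold incidenceCone
    rw [PointedCone.hull, Submodule.span_le]
    rintro _ ⟨i, j, hij, rfl⟩
    have h2 := transGen_isCover_of_adj h hij
    clear hij
    induction h2 with
    | single hc => exact Submodule.subset_span ⟨⟨(_, _), hc⟩, rfl⟩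
    | tail _ hc ih =>
      have := add_mem ih (Submodule.subset_span ⟨⟨(_, _), hc⟩, rfl⟩)
      simpa using this
  · refine Submodule.span_mono ?_
    rintro _ ⟨q, rfl⟩
    exact ⟨_, _, q.2.adj, rfl⟩

variable [Fintype V] [DecidableEq V]

/-- Every cover relation generates an exposed ray of the incidence cone. The functional counts the
nodes reachable from a node in the graph where `i` and `j` are identified. -/
theorem IsCover.exists_functional (h : G.Acyclic) {i j : V} (hc : G.IsCover i j) :
    ∃ g : V → ℝ, (∀ s t, G.Adj s t → g t ≤ g s) ∧ g i = g j ∧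
      ∀ y ∈ G.incidenceCone, y ⬝ᵥ g = 0 → ∃ α : ℝ, y = α • (Pi.single i 1 - Pi.single j 1) := by
  classical
  set R := Relation.ReflTransGen G.Adj with hR
  set N : V → Finset V := fun v => Finset.univ.filter fun u => R v u ∨ (R v j ∧ R i u) with hN
  have hmem : ∀ v u, u ∈ N v ↔ R v u ∨ (R v j ∧ R i u) := by simp [hN]
  have hsub : ∀ s t, G.Adj s t → N t ⊆ N s := by
    intro s t hst u
    rw [hmem, hmem]
    rintro (h1 | ⟨h1, h2⟩)
    · exact Or.inl (h1.head hst)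
    · exact Or.inr ⟨h1.head hst, h2⟩
  have hlt : ∀ s t, G.Adj s t → (s, t) ≠ (i, j) → (N t).card < (N s).card := by
    intro s t hst hne
    apply Finset.card_lt_card
    rw [Finset.ssubset_iff_of_subset (hsub s t hst)]
    refine ⟨s, (hmem _ _).2 (Or.inl Relation.ReflTransGen.refl), ?_⟩
    rw [hmem]
    rintro (h1 | ⟨h1, h2⟩)
    · exact h s (Relation.TransGen.head' hst h1)
    · rcases Relation.reflTransGen_iff_eq_or_transGen.1 h2 with rfl | h2
      · rcases Relation.reflTransGen_iff_eq_or_transGen.1 h1 with rfl | h1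
        · exact hne rfl
        · exact hc.2 t (Relation.TransGen.single hst) h1
      · exact hc.2 s h2 (Relation.TransGen.head' hst h1)
  have heq : N i = N j := by
    ext u
    rw [hmem, hmem]
    have hij : R i j := hc.1.to_reflTransGen
    constructor
    · rintro (h1 | ⟨-, h1⟩) <;> exact Or.inr ⟨Relation.ReflTransGen.refl, h1⟩
    · rintro (h1 | ⟨-, h1⟩)
      · exact Or.inl (hij.trans h1)
      · exact Or.inl h1
  refine ⟨fun v => (N v).card, fun s t hst => ?_, by simp [heq], ?_⟩
  · exact Nat.cast_le.2 (Finset.card_le_card (hsub s t hst))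
  · intro y hy
    have hnn : ∀ y ∈ G.incidenceCone, 0 ≤ y ⬝ᵥ (fun v => ((N v).card : ℝ)) := fun y hy =>
      G.mem_incidenceCone_iff.1 hy _ (fun s t hst => by
        exact_mod_cast Finset.card_le_card (hsub s t hst))
    induction hy using Submodule.span_induction with
    | mem x hx =>
      obtain ⟨s, t, hst, rfl⟩ := hx
      intro h0
      by_cases hne : (s, t) = (i, j)
      · obtain ⟨rfl, rfl⟩ := Prod.mk.inj hne
        exact ⟨1, (one_smul _ _).symm⟩
      · exfalso
        have h1 := hlt s t hst hne
        rw [sub_dotProduct] at h0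
        simp only [single_dotProduct, one_mul, sub_eq_zero] at h0
        have : (N s).card = (N t).card := by exact_mod_cast h0
        omega
    | zero => exact fun _ => ⟨0, (zero_smul _ _).symm⟩
    | add x z hx hz ihx ihz =>
      intro h0
      rw [add_dotProduct] at h0
      have h1 := hnn x hx
      have h2 := hnn z hz
      obtain ⟨α, hα⟩ := ihx (by linarith)
      obtain ⟨β, hβ⟩ := ihz (by linarith)
      refine ⟨α + β, ?_⟩
      rw [add_smul, ← hα, ← hβ]
    | smul c x hx ih =>
      intro h0
      change ((c : ℝ) • x) ⬝ᵥ _ = 0 at h0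
      rw [smul_dotProduct, smul_eq_mul, mul_eq_zero] at h0
      rcases h0 with h0 | h0
      · refine ⟨0, ?_⟩
        change (c : ℝ) • x = _
        rw [h0, zero_smul, zero_smul]
      · obtain ⟨α, hα⟩ := ih h0
        refine ⟨c * α, ?_⟩
        change (c : ℝ) • x = _
        rw [mul_smul, ← hα]

theorem sum_eq_sum_dotProduct (x : V → ℝ) (U : Finset V) :
    ∑ v ∈ U, x v = x ⬝ᵥ fun v => if v ∈ U then 1 else 0 := by
  simp [dotProduct, Finset.sum_ite_mem]

/-- A minimal cut defines a facet. -/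
theorem IsMinimalCut.isFacet (hconn : G.IsConnected) {P : Set (V → ℝ)} {p : V → ℝ}
    (hP : Convex ℝ P) (hp : p ∈ P) (hC : ConvexPolytope.coneAt P p = G.incidenceCone)
    {U : Finset V} (hU : G.IsMinimalCut U) :
    ConvexPolytope.IsFacet P {x ∈ P | ∑ v ∈ U, x v = ∑ v ∈ U, p v} := by
  obtain ⟨u, hu⟩ := hU.nonempty
  obtain ⟨w, hw⟩ := hU.exists_notMem
  obtain ⟨i, j, hij, hi, hj⟩ := hconn.exists_adj_mem_notMem hU.lower hu hw
  have hφ : ∀ x : V → ℝ, (∑ v ∈ U, LinearMap.proj v : (V → ℝ) →ₗ[ℝ] ℝ) x = ∑ v ∈ U, x v := by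
    intro x; simp
  have hval : ∀ a b, ∑ v ∈ U, (Pi.single a (1 : ℝ) - Pi.single b 1 : V → ℝ) v =
      (if a ∈ U then 1 else 0) - (if b ∈ U then 1 else 0) := by
    intro a b
    rw [sum_eq_sum_dotProduct, sub_dotProduct]
    simp
  have := ConvexPolytope.isFacet_of_hull (B := G.arcVectors) hP hp hC
    (∑ v ∈ U, LinearMap.proj v) (by
      rintro _ ⟨a, b, hab, rfl⟩
      rw [hφ, hval]
      have := hU.lower a b hab
      split_ifs <;> simp_all) (b₀ := Pi.single i 1 - Pi.single j 1) ⟨i, j, hij, rfl⟩ (by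
      rw [hφ, hval]; simp [hi, hj]) ?_
  · simpa only [hφ] using this
  · rintro _ ⟨a, b, hab, rfl⟩
    apply mem_span_of_forall_linearMap
    intro g hg
    have hg1 : ∀ c d, G.Adj c d → (c ∈ U ↔ d ∈ U) → g c = g d := by
      intro c d hcd hiff
      have := hg (Pi.single c 1 - Pi.single d 1) (Submodule.subset_span (Set.mem_insert_of_mem _
        ⟨⟨c, d, hcd, rfl⟩, by rw [hφ, hval]; simp [hiff]⟩))
      rw [sub_dotProduct] at this
      simpa [sub_eq_zero] using this
    have hg0 : g i = g j := by
      have := hg (Pi.single i 1 - Pi.single j 1) (Submodule.subset_span (Set.mem_insert _ _))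
      rw [sub_dotProduct] at this
      simpa [sub_eq_zero] using this
    have h3 : ∀ v, g v = g i := by
      intro v
      by_cases hv : v ∈ U
      · exact hU.eq_of_mem g hg1 v hv i hi
      · rw [hg0]; exact hU.eq_of_notMem g hg1 v hv j hj
    rw [sub_dotProduct]
    simp [h3 a, h3 b]

/-- Distinct minimal cuts define distinct facets. -/
theorem IsMinimalCut.eq_of_facet_eq (hconn : G.IsConnected) {P : Set (V → ℝ)} {p : V → ℝ}
    (hP : Convex ℝ P) (hp : p ∈ P) (hC : ConvexPolytope.coneAt P p = G.incidenceCone)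
    {U W : Finset V} (hU : G.IsMinimalCut U) (hW : G.IsMinimalCut W)
    (heq : {x ∈ P | ∑ v ∈ U, x v = ∑ v ∈ U, p v} = {x ∈ P | ∑ v ∈ W, x v = ∑ v ∈ W, p v}) :
    U = W := by
  have hval : ∀ (U : Finset V) a b, ∑ v ∈ U, (Pi.single a (1 : ℝ) - Pi.single b 1 : V → ℝ) v =
      (if a ∈ U then 1 else 0) - (if b ∈ U then 1 else 0) := by
    intro U a b
    rw [sum_eq_sum_dotProduct, sub_dotProduct]
    simp
  have h1 : ∀ a b, G.Adj a b → (a ∈ U ↔ b ∈ U) →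
      (if a ∈ W then (1 : ℝ) else 0) = if b ∈ W then 1 else 0 := by
    intro a b hab hiff
    have h2 : Pi.single a (1 : ℝ) - Pi.single b 1 ∈ ConvexPolytope.coneAt P p :=
      hC ▸ G.single_sub_single_mem_incidenceCone hab
    obtain ⟨t, ht, h2⟩ := ConvexPolytope.exists_add_smul_mem_of_mem_coneAt hP hp h2
    have hsum : ∀ U : Finset V,
        ∑ v ∈ U, (p + t • (Pi.single a (1 : ℝ) - Pi.single b 1) : V → ℝ) v =
          ∑ v ∈ U, p v + t * ((if a ∈ U then 1 else 0) - (if b ∈ U then 1 else 0)) := by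
      intro U
      rw [← hval, Finset.mul_sum, ← Finset.sum_add_distrib]
      rfl
    have h3 : p + t • (Pi.single a (1 : ℝ) - Pi.single b 1) ∈
        {x ∈ P | ∑ v ∈ U, x v = ∑ v ∈ U, p v} := ⟨h2, by rw [hsum]; simp [hiff]⟩
    rw [heq] at h3
    have h4 := h3.2
    rw [hsum, add_eq_left, mul_eq_zero] at h4
    exact sub_eq_zero.1 (h4.resolve_left ht.ne')
  have h2 := hU.eq_of_mem (fun v => if v ∈ W then 1 else 0) h1
  have h3 := hU.eq_of_notMem (fun v => if v ∈ W then 1 else 0) h1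
  obtain ⟨u, hu⟩ := hU.nonempty
  obtain ⟨w, hw⟩ := hU.exists_notMem
  obtain ⟨i, j, hij, hi, hj⟩ := hconn.exists_adj_mem_notMem hU.lower hu hw
  have hiff : ∀ a b, ((if a ∈ W then (1 : ℝ) else 0) = if b ∈ W then 1 else 0) →
      (a ∈ W ↔ b ∈ W) := by
    intro a b
    by_cases ha : a ∈ W <;> by_cases hb : b ∈ W <;> simp [ha, hb]
  have h4 : ∀ v, v ∈ U → (v ∈ W ↔ i ∈ W) := fun v hv => hiff _ _ (h2 v hv i hi)
  have h5 : ∀ v, v ∉ U → (v ∈ W ↔ j ∈ W) := fun v hv => hiff _ _ (h3 v hv j hj)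
  obtain ⟨a, ha⟩ := hW.nonempty
  obtain ⟨b, hb⟩ := hW.exists_notMem
  have h6 := hW.lower i j hij
  have hiW : i ∈ W := by
    by_cases haU : a ∈ U
    · exact (h4 a haU).1 ha
    · exact h6 ((h5 a haU).1 ha)
  have hjW : j ∉ W := by
    by_cases hbU : b ∈ U
    · exact absurd ((h4 b hbU).2 hiW) hb
    · exact fun hjW => hb ((h5 b hbU).2 hjW)
  ext v
  by_cases hv : v ∈ U
  · simp [hv, h4 v hv, hiW]
  · simp [hv, h5 v hv, hjW]

/-- If there are fewer minimal cuts than nodes, there are at most as many cover relations as minimal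
cuts: the incidence cone is then an orthant with respect to the coordinates given by the minimal
cuts, and every cover relation generates one of its axes. -/
theorem card_isCover_le_card_isMinimalCut (h : G.Acyclic) (hconn : G.IsConnected)
    (hcard : Nat.card {U : Finset V // G.IsMinimalCut U} + 1 ≤ Fintype.card V) :
    Nat.card {q : V × V // G.IsCover q.1 q.2} ≤ Nat.card {U : Finset V // G.IsMinimalCut U} := by
  classical
  let _ : Fintype {U : Finset V // G.IsMinimalCut U} := Fintype.ofFinite _
  rw [Nat.card_eq_fintype_card (α := {U : Finset V // G.IsMinimalCut U})] at hcard
  set Θ : (V → ℝ) →ₗ[ℝ] ({U : Finset V // G.IsMinimalCut U} → ℝ) × ℝ :=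
    LinearMap.prod (LinearMap.pi fun U => ∑ v ∈ U.1, LinearMap.proj v) (∑ v, LinearMap.proj v)
    with hΘ
  have hΘ1 : ∀ x U, (Θ x).1 U = ∑ v ∈ U.1, x v := by intro x U; simp [hΘ]
  have hΘ2 : ∀ x, (Θ x).2 = ∑ v, x v := by intro x; simp [hΘ]
  have hcone : ∀ x, (∀ U, 0 ≤ (Θ x).1 U) → (Θ x).2 = 0 → x ∈ G.incidenceCone := by
    intro x h1 h2
    exact mem_incidenceCone_of_isMinimalCut hconn (by rw [← hΘ2, h2])
      (fun U hU => by rw [← hΘ1 x ⟨U, hU⟩]; exact h1 _)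
  have hinj : Function.Injective Θ := by
    rw [injective_iff_map_eq_zero]
    intro x hx
    refine h.eq_zero_of_mem_of_neg_mem (hcone x ?_ ?_) (hcone (-x) ?_ ?_) <;> simp [hx]
  have hsurj : Function.Surjective Θ := by
    have h1 := LinearMap.finrank_le_finrank_of_injective hinj
    simp only [Module.finrank_fintype_fun_eq_card, Module.finrank_prod, Module.finrank_self] at h1
    refine (LinearMap.injective_iff_surjective_of_finrank_eq_finrank ?_).1 hinj
    simp only [Module.finrank_fintype_fun_eq_card, Module.finrank_prod, Module.finrank_self]
    omega
  have hr : ∀ U : {U : Finset V // G.IsMinimalCut U}, ∃ r, Θ r = (Pi.single U 1, 0) :=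
    fun U => hsurj _
  choose r hr using hr
  have key : ∀ q : {q : V × V // G.IsCover q.1 q.2}, ∃ U,
      r U = Pi.single q.1.1 1 - Pi.single q.1.2 1 := by
    rintro ⟨⟨i, j⟩, hc⟩
    set b : V → ℝ := Pi.single i 1 - Pi.single j 1 with hb
    have hbC : b ∈ G.incidenceCone := G.single_sub_single_mem_incidenceCone hc.adj
    have hb2 : (Θ b).2 = 0 := by rw [hΘ2]; exact sum_eq_zero_of_mem_incidenceCone hbC
    have hb1 : ∀ U, (Θ b).1 U = 0 ∨ (Θ b).1 U = 1 := by
      intro U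
      rw [hΘ1, sum_eq_sum_dotProduct, hb, sub_dotProduct]
      have := U.2.lower i j hc.adj
      by_cases hi : i ∈ U.1 <;> by_cases hj : j ∈ U.1 <;> simp_all
    obtain ⟨U, hU⟩ : ∃ U, (Θ b).1 U = 1 := by
      by_contra hcon
      push Not at hcon
      have h1 : b = 0 := hinj (by
        rw [map_zero]
        exact Prod.ext (funext fun U => (hb1 U).resolve_right (hcon U)) hb2)
      have h2 := congrFun h1 i
      have hne : i ≠ j := fun hij => h i (by have := hc.1; rwa [← hij] at this)
      simp [hb, hne] at h2
    refine ⟨U, ?_⟩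
    have hrC : r U ∈ G.incidenceCone := by
      apply hcone
      · intro W
        rw [hr]
        simp only [Pi.single_apply]
        split_ifs <;> norm_num
      · rw [hr]
    have hbrC : b - r U ∈ G.incidenceCone := by
      apply hcone
      · intro W
        rw [map_sub, hr]
        simp only [Prod.fst_sub, Pi.sub_apply, Pi.single_apply]
        split_ifs with hW
        · rw [hW, hU]; norm_num
        · rcases hb1 W with h1 | h1 <;> rw [h1] <;> norm_num
      · rw [map_sub, hr]; simp [hb2]
    obtain ⟨g, hg, hgij, hgray⟩ := hc.exists_functional h
    have h1 := G.mem_incidenceCone_iff.1 hrC g hg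
    have h2 := G.mem_incidenceCone_iff.1 hbrC g hg
    have h3 : b ⬝ᵥ g = 0 := by rw [hb, sub_dotProduct]; simp [hgij]
    rw [sub_dotProduct, h3] at h2
    obtain ⟨α, hα⟩ := hgray _ hrC (by linarith)
    have h4 : (Θ (r U)).1 U = 1 := by rw [hr]; simp
    rw [hα, map_smul, Prod.smul_fst, Pi.smul_apply, hU, smul_eq_mul, mul_one] at h4
    rw [hα, h4, one_smul]
  choose f hf using key
  refine Nat.card_le_card_of_injective f ?_
  rintro ⟨⟨a, b⟩, hab⟩ ⟨⟨c, d⟩, hcd⟩ heq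
  have h1 := hf ⟨(a, b), hab⟩
  rw [heq, hf ⟨(c, d), hcd⟩] at h1
  have hne : a ≠ b := fun hij => h a (by have := hab.1; rwa [← hij] at this)
  have hne' : c ≠ d := fun hij => h c (by have := hcd.1; rwa [← hij] at this)
  have h2 := congrFun h1 a
  have h3 := congrFun h1 b
  simp only [Pi.sub_apply, Pi.single_apply, hne, hne.symm, if_true, if_false] at h2 h3
  have hac : a = c := by
    by_contra hac
    split_ifs at h2 <;> norm_num at h2
  have hbd : b = d := by
    by_contra hbd
    split_ifs at h3 <;> norm_num at h3
  subst hac hbd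
  rfl

/-- A polytope whose cone at `p` is the incidence cone of a connected acyclic directed multigraph is
simple at `p` if and only if the Hasse diagram is a tree. If the Hasse diagram is a tree, the cone is
simplicial. Conversely, the number of facets at `p` bounds the number of minimal cuts, hence the
number of cover relations. -/
theorem isSimpleVertex_iff_isTree [Nonempty V] (h : G.Acyclic) (hconn : G.IsConnected)
    {P : Set (V → ℝ)} {p : V → ℝ} (hP : Convex ℝ P) (hp : p ∈ P)
    (hC : ConvexPolytope.coneAt P p = G.incidenceCone) :
    ConvexPolytope.IsSimpleVertex P p ↔ (G.hasseDiagram h).IsTree := by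
  classical
  have hext : p ∈ P.extremePoints ℝ := (G.mem_extremePoints_iff_acyclic hP hp hC
    (fun i hi => h i (Relation.TransGen.single hi))).2 h
  have hspan := ConvexPolytope.vectorSpan_eq_span (B := G.arcVectors) hP hp hC
  have hdim : ConvexPolytope.dim P + 1 = Fintype.card V := by
    unfold ConvexPolytope.dim
    rw [hspan]; exact finrank_span_arcVectors hconn
  have hHconn := hasseDiagram_connected h hconn
  rw [SimpleGraph.isTree_iff_connected_and_card, card_edgeSet_hasseDiagram h,
    Nat.card_eq_fintype_card (α := V)]
  constructor
  · rintro ⟨-, hfac⟩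
    have hle : Nat.card {U : Finset V // G.IsMinimalCut U} ≤ ConvexPolytope.dim P := by
      have h1 : (Set.range fun U : {U : Finset V // G.IsMinimalCut U} =>
          {x ∈ P | ∑ v ∈ U.1, x v = ∑ v ∈ U.1, p v}) ⊆
          {F : Set (V → ℝ) | ConvexPolytope.IsFacet P F ∧ p ∈ F} := by
        rintro _ ⟨U, rfl⟩
        exact ⟨U.2.isFacet hconn hP hp hC, hp, rfl⟩
      have h2 := Set.encard_le_encard h1
      rw [hfac, ← Set.image_univ, Function.Injective.encard_image, Set.encard_univ] at h2
      · let _ : Fintype {U : Finset V // G.IsMinimalCut U} := Fintype.ofFinite _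
        rw [ENat.card_eq_coe_fintype_card] at h2
        rw [Nat.card_eq_fintype_card]
        exact_mod_cast h2
      · intro U W hUW
        exact Subtype.ext (U.2.eq_of_facet_eq hconn hP hp hC W.2 hUW)
    have h3 := card_isCover_le_card_isMinimalCut h hconn (by omega)
    have h4 := hHconn.card_vert_le_card_edgeSet_add_one
    rw [card_edgeSet_hasseDiagram h, Nat.card_eq_fintype_card (α := V)] at h4
    exact ⟨hHconn, by omega⟩
  · rintro ⟨-, hcard⟩
    refine ⟨hext, ?_⟩
    let _ : Fintype {q : V × V // G.IsCover q.1 q.2} := Fintype.ofFinite _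
    have hC' := hC.trans (incidenceCone_eq_hull_isCover h)
    refine ConvexPolytope.encard_facets_eq_of_linearIndependent hP hp ?_ hC'
    rw [linearIndependent_iff_card_eq_finrank_span]
    rw [Set.finrank, ← ConvexPolytope.vectorSpan_eq_span hP hp hC']
    rw [Nat.card_eq_fintype_card] at hcard
    unfold ConvexPolytope.dim at hdim
    omega

end DirectedMultigraph

/-! ### Sorting networks and pseudoline arrangements -/

/-- A sorting network: at each time `t` of `active`, a commutator joins the positions `level t` and
`level t + 1`. The positions are `0, …, size - 1`, and `target` is the permutation that the
pseudolines have to realize. -/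
structure SortingNetwork where
  size : ℕ
  length : ℕ
  level : ℕ → ℕ
  active : Finset ℕ
  target : Equiv.Perm ℕ
  lt_length : ∀ t ∈ active, t < length
  level_lt : ∀ t ∈ active, level t + 1 < size

namespace SortingNetwork

variable (𝒩 : SortingNetwork) {X X' : Finset ℕ}

/-- The pseudolines cross at the commutators of `X` and touch at the others: `𝒩.state X t p` is the
label of the pseudoline which is at position `p` just before the time `t`. -/
def state (X : Finset ℕ) : ℕ → Equiv.Perm ℕ
  | 0 => 1
  | t + 1 => if t ∈ X then state X t * Equiv.swap (𝒩.level t) (𝒩.level t + 1) else state X t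

/-- The position of the pseudoline `c` just before the time `t`. -/
def pos (X : Finset ℕ) (t c : ℕ) : ℕ := (𝒩.state X t)⁻¹ c

/-- Whenever two pseudolines cross, the one with the smaller label goes up. -/
def IsReduced (X : Finset ℕ) : Prop :=
  ∀ t ∈ X, 𝒩.state X t (𝒩.level t) < 𝒩.state X t (𝒩.level t + 1)

/-- The pseudoline arrangements supported by the network, given by the times of their crossings. -/
structure IsArrangement (X : Finset ℕ) : Prop where
  subset : X ⊆ 𝒩.active
  state_length : 𝒩.state X 𝒩.length = 𝒩.target
  reduced : 𝒩.IsReduced X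

/-- At time `t`, the pseudolines `i` and `j` touch, with `i` below `j`. -/
structure IsContact (X : Finset ℕ) (t i j : ℕ) : Prop where
  mem : t ∈ 𝒩.active
  notMem : t ∉ X
  lower : 𝒩.state X t (𝒩.level t) = i
  upper : 𝒩.state X t (𝒩.level t + 1) = j

variable {𝒩}

theorem state_succ_of_mem {t : ℕ} (h : t ∈ X) : 𝒩.state X (t + 1) =
    𝒩.state X t * Equiv.swap (𝒩.level t) (𝒩.level t + 1) := by
  rw [state, if_pos h]

theorem state_succ_of_notMem {t : ℕ} (h : t ∉ X) : 𝒩.state X (t + 1) = 𝒩.state X t := by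
  rw [state, if_neg h]

theorem state_pos (t c : ℕ) : 𝒩.state X t (𝒩.pos X t c) = c := by simp [pos]

theorem pos_state (t p : ℕ) : 𝒩.pos X t (𝒩.state X t p) = p := by simp [pos]

theorem pos_eq_iff {t c p : ℕ} : 𝒩.pos X t c = p ↔ 𝒩.state X t p = c := by
  constructor
  · rintro rfl; exact state_pos t c
  · rintro rfl; exact pos_state t p

theorem pos_injective (t : ℕ) : Function.Injective (𝒩.pos X t) := fun a b h => by
  simpa [pos] using h

theorem pos_succ_of_mem {t c : ℕ} (h : t ∈ X) : 𝒩.pos X (t + 1) c =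
    Equiv.swap (𝒩.level t) (𝒩.level t + 1) (𝒩.pos X t c) := by
  simp [pos, state_succ_of_mem h]

theorem pos_succ_of_notMem {t c : ℕ} (h : t ∉ X) : 𝒩.pos X (t + 1) c = 𝒩.pos X t c := by
  simp [pos, state_succ_of_notMem h]

theorem state_congr {t : ℕ} (h : ∀ s < t, s ∈ X' ↔ s ∈ X) : 𝒩.state X' t = 𝒩.state X t := by
  induction t with
  | zero => rfl
  | succ t ih =>
    have h1 := ih fun s hs => h s (by omega)
    by_cases ht : t ∈ X
    · rw [state_succ_of_mem ht, state_succ_of_mem ((h t (by omega)).2 ht), h1]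
    · rw [state_succ_of_notMem ht, state_succ_of_notMem (fun h2 => ht ((h t (by omega)).1 h2)), h1]

theorem state_lt_iff (hX : X ⊆ 𝒩.active) (t p : ℕ) : 𝒩.state X t p < 𝒩.size ↔ p < 𝒩.size := by
  induction t generalizing p with
  | zero => rfl
  | succ t ih =>
    by_cases ht : t ∈ X
    · have := 𝒩.level_lt t (hX ht)
      rw [state_succ_of_mem ht, Equiv.Perm.mul_apply, ih, Equiv.swap_apply_def]
      split_ifs <;> omega
    · rw [state_succ_of_notMem ht, ih]

theorem IsContact.lt_size {t i j : ℕ} (h : 𝒩.IsContact X t i j) (hX : X ⊆ 𝒩.active) :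
    i < 𝒩.size ∧ j < 𝒩.size := by
  have := 𝒩.level_lt t h.mem
  exact ⟨h.lower ▸ (state_lt_iff hX t _).2 (by omega), h.upper ▸ (state_lt_iff hX t _).2 this⟩

theorem IsContact.ne {t i j : ℕ} (h : 𝒩.IsContact X t i j) : i ≠ j := by
  rw [← h.lower, ← h.upper]
  intro h1
  have := (𝒩.state X t).injective h1
  omega

theorem IsContact.pos_lower {t i j : ℕ} (h : 𝒩.IsContact X t i j) : 𝒩.pos X t i = 𝒩.level t :=
  pos_eq_iff.2 h.lower

theorem IsContact.pos_upper {t i j : ℕ} (h : 𝒩.IsContact X t i j) :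
    𝒩.pos X t j = 𝒩.level t + 1 := pos_eq_iff.2 h.upper

/-! ### Inversions -/

/-- The inversions of a permutation of positions: the pairs of labels in the wrong order. -/
def inversions (n : ℕ) (σ : Equiv.Perm ℕ) : Finset (ℕ × ℕ) :=
  (Finset.range n ×ˢ Finset.range n).filter fun q => q.1 < q.2 ∧ σ⁻¹ q.2 < σ⁻¹ q.1

theorem card_inversions_mul_swap {n p : ℕ} {σ : Equiv.Perm ℕ} (h1 : σ p < n) (h2 : σ (p + 1) < n)
    (h : σ p < σ (p + 1)) :
    (inversions n (σ * Equiv.swap p (p + 1))).card = (inversions n σ).card + 1 := by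
  have hins : inversions n (σ * Equiv.swap p (p + 1)) =
      insert (σ p, σ (p + 1)) (inversions n σ) := by
    ext ⟨i, j⟩
    simp only [inversions, Finset.mem_filter, Finset.mem_product, Finset.mem_range,
      Finset.mem_insert, Prod.mk.injEq, mul_inv_rev, Equiv.swap_inv, Equiv.Perm.mul_apply]
    obtain ⟨u, rfl⟩ := σ.surjective i
    obtain ⟨v, rfl⟩ := σ.surjective j
    have hinv : ∀ u, σ⁻¹ (σ u) = u := fun u => by simp
    simp only [hinv, EmbeddingLike.apply_eq_iff_eq]
    have hu : u ≠ p + 1 ∨ v ≠ p ∨ ¬ σ u < σ v := by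
      by_cases hu : u = p + 1
      · by_cases hv : v = p
        · subst hu hv; right; right; omega
        · exact Or.inr (Or.inl hv)
      · exact Or.inl hu
    by_cases huv : u = p ∧ v = p + 1
    · obtain ⟨rfl, rfl⟩ := huv
      simp [h1, h2, h]
    · rw [Equiv.swap_apply_def, Equiv.swap_apply_def]
      split_ifs <;> omega
  rw [hins, Finset.card_insert_of_notMem]
  simp [inversions]

/-- The number of crossings is the number of inversions, plus twice the number of the crossings at
which the larger label goes up. -/
theorem card_inversions_state (hX : X ⊆ 𝒩.active) (t : ℕ) :
    (inversions 𝒩.size (𝒩.state X t)).card + 2 * (X.filter fun s => s < t ∧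
      ¬ 𝒩.state X s (𝒩.level s) < 𝒩.state X s (𝒩.level s + 1)).card =
    (X.filter fun s => s < t).card := by
  induction t with
  | zero =>
    simp only [not_lt_zero, false_and, Finset.filter_false, Finset.card_empty, mul_zero, add_zero,
      Finset.card_eq_zero, inversions, state, inv_one, Equiv.Perm.coe_one, id_eq]
    apply Finset.filter_false_of_mem
    intro q _ h
    omega
  | succ t ih =>
    by_cases ht : t ∈ X
    · have hl := 𝒩.level_lt t (hX ht)
      have h1 := (state_lt_iff hX t (𝒩.level t)).2 (by omega)
      have h2 := (state_lt_iff hX t (𝒩.level t + 1)).2 hl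
      have htot : X.filter (fun s => s < t + 1) = insert t (X.filter fun s => s < t) := by
        ext s
        simp only [Finset.mem_filter, Finset.mem_insert]
        constructor
        · rintro ⟨h3, h4⟩
          by_cases hs : s = t
          · exact Or.inl hs
          · exact Or.inr ⟨h3, by omega⟩
        · rintro (rfl | ⟨h3, h4⟩)
          · exact ⟨ht, by omega⟩
          · exact ⟨h3, by omega⟩
      rw [htot, Finset.card_insert_of_notMem (by simp), ← ih, state_succ_of_mem ht]
      by_cases hlt : 𝒩.state X t (𝒩.level t) < 𝒩.state X t (𝒩.level t + 1)
      · have hbad : X.filter (fun s => s < t + 1 ∧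
            ¬ 𝒩.state X s (𝒩.level s) < 𝒩.state X s (𝒩.level s + 1)) = X.filter (fun s => s < t ∧
            ¬ 𝒩.state X s (𝒩.level s) < 𝒩.state X s (𝒩.level s + 1)) := by
          ext s
          simp only [Finset.mem_filter]
          constructor
          · rintro ⟨h3, h4, h5⟩
            have : s ≠ t := by rintro rfl; exact h5 hlt
            exact ⟨h3, by omega, h5⟩
          · rintro ⟨h3, h4, h5⟩
            exact ⟨h3, by omega, h5⟩
        rw [hbad, card_inversions_mul_swap h1 h2 hlt]
        ring
      · have hbad : X.filter (fun s => s < t + 1 ∧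
            ¬ 𝒩.state X s (𝒩.level s) < 𝒩.state X s (𝒩.level s + 1)) =
            insert t (X.filter (fun s => s < t ∧
            ¬ 𝒩.state X s (𝒩.level s) < 𝒩.state X s (𝒩.level s + 1))) := by
          ext s
          simp only [Finset.mem_filter, Finset.mem_insert]
          constructor
          · rintro ⟨h3, h4, h5⟩
            by_cases hs : s = t
            · exact Or.inl hs
            · exact Or.inr ⟨h3, by omega, h5⟩
          · rintro (rfl | ⟨h3, h4, h5⟩)
            · exact ⟨ht, by omega, hlt⟩
            · exact ⟨h3, by omega, h5⟩
        have hne : 𝒩.state X t (𝒩.level t) ≠ 𝒩.state X t (𝒩.level t + 1) := fun h => by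
          have := (𝒩.state X t).injective h
          omega
        have h3 := card_inversions_mul_swap (n := 𝒩.size) (p := 𝒩.level t)
          (σ := 𝒩.state X t * Equiv.swap (𝒩.level t) (𝒩.level t + 1)) (by simpa using h2)
          (by simpa using h1) (by simp; omega)
        rw [mul_assoc, Equiv.swap_mul_self, mul_one] at h3
        rw [hbad, Finset.card_insert_of_notMem (by simp), h3]
        ring
    · rw [state_succ_of_notMem ht]
      have : ∀ Q : ℕ → Prop, ∀ s ∈ X, (s < t + 1 ∧ Q s ↔ s < t ∧ Q s) := by
        intro Q s hs
        have : s ≠ t := by rintro rfl; exact ht hs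
        constructor <;> rintro ⟨h1, h2⟩ <;> exact ⟨by omega, h2⟩
      rw [Finset.filter_congr (this _)]
      have h2 : X.filter (fun s => s < t + 1) = X.filter fun s => s < t :=
        Finset.filter_congr fun s hs => by simpa using this (fun _ => True) s hs
      rw [h2, ih]

theorem IsArrangement.card_eq (hX : 𝒩.IsArrangement X) :
    X.card = (inversions 𝒩.size 𝒩.target).card := by
  have h := card_inversions_state hX.subset 𝒩.length
  have h1 : X.filter (fun s => s < 𝒩.length ∧
      ¬ 𝒩.state X s (𝒩.level s) < 𝒩.state X s (𝒩.level s + 1)) = ∅ :=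
    Finset.filter_false_of_mem fun s hs h => h.2 (hX.reduced s hs)
  rw [h1, Finset.filter_true_of_mem (fun s hs => 𝒩.lt_length s (hX.subset hs)),
    hX.state_length] at h
  simpa using h.symm

/-- A set of crossings which realizes the target with the least possible number of crossings is
reduced. -/
theorem isArrangement_of_card (hX : X ⊆ 𝒩.active) (hst : 𝒩.state X 𝒩.length = 𝒩.target)
    (hcard : X.card = (inversions 𝒩.size 𝒩.target).card) : 𝒩.IsArrangement X := by
  refine ⟨hX, hst, fun t ht => ?_⟩
  have h := card_inversions_state hX 𝒩.length
  rw [hst, Finset.filter_true_of_mem (p := fun s => s < 𝒩.length)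
    (fun s hs => 𝒩.lt_length s (hX hs)), hcard] at h
  have h2 : X.filter (fun s => s < 𝒩.length ∧
      ¬ 𝒩.state X s (𝒩.level s) < 𝒩.state X s (𝒩.level s + 1)) = ∅ := by
    rw [← Finset.card_eq_zero]; omega
  by_contra hcon
  have h3 := Finset.notMem_empty t
  rw [← h2] at h3
  exact h3 (Finset.mem_filter.2 ⟨ht, 𝒩.lt_length t (hX ht), hcon⟩)

/-! ### Relative positions of two pseudolines -/

theorem IsReduced.pos_lt_succ (hX : 𝒩.IsReduced X) {i j t : ℕ} (hij : i < j)
    (h : 𝒩.pos X t j < 𝒩.pos X t i) : 𝒩.pos X (t + 1) j < 𝒩.pos X (t + 1) i := by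
  by_cases ht : t ∈ X
  · rw [pos_succ_of_mem ht, pos_succ_of_mem ht]
    have h1 : ¬ (𝒩.pos X t j = 𝒩.level t ∧ 𝒩.pos X t i = 𝒩.level t + 1) := by
      rintro ⟨h2, h3⟩
      have := hX t ht
      rw [pos_eq_iff.1 h2, pos_eq_iff.1 h3] at this
      omega
    rw [Equiv.swap_apply_def, Equiv.swap_apply_def]
    split_ifs <;> omega
  · rwa [pos_succ_of_notMem ht, pos_succ_of_notMem ht]

theorem IsReduced.pos_lt_of_le (hX : 𝒩.IsReduced X) {i j t s : ℕ} (hij : i < j) (hts : t ≤ s)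
    (h : 𝒩.pos X t j < 𝒩.pos X t i) : 𝒩.pos X s j < 𝒩.pos X s i := by
  induction s, hts using Nat.le_induction with
  | base => exact h
  | succ s _ ih => exact hX.pos_lt_succ hij ih

/-- Two pseudolines cross exactly once if the target permutation inverts them: they are in their
original order until the time of the crossing, and in the reverse order from then on. -/
theorem IsArrangement.exists_crossing (hX : 𝒩.IsArrangement X) {i j : ℕ} (hij : i < j)
    (hinv : 𝒩.target⁻¹ j < 𝒩.target⁻¹ i) :
    ∃ a ∈ X, 𝒩.state X a (𝒩.level a) = i ∧ 𝒩.state X a (𝒩.level a + 1) = j ∧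
      (∀ t ≤ a, 𝒩.pos X t i < 𝒩.pos X t j) ∧ ∀ t, a < t → 𝒩.pos X t j < 𝒩.pos X t i := by
  classical
  have hex : ∃ t, 𝒩.pos X t j < 𝒩.pos X t i := ⟨𝒩.length, by rwa [pos, pos, hX.state_length]⟩
  have hmin := fun t (ht : t < Nat.find hex) => Nat.find_min hex ht
  have hspec := Nat.find_spec hex
  set m := Nat.find hex with hm
  have hm0 : m ≠ 0 := by
    intro h0
    rw [h0] at hspec
    simp only [pos, state, inv_one, Equiv.Perm.coe_one, id_eq] at hspec
    omega
  obtain ⟨a, ha⟩ := Nat.exists_eq_succ_of_ne_zero hm0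
  have hlt : ∀ t ≤ a, 𝒩.pos X t i < 𝒩.pos X t j := by
    intro t ht
    have h1 := hmin t (by omega)
    have h2 : 𝒩.pos X t i ≠ 𝒩.pos X t j := fun h => hij.ne (pos_injective t h)
    omega
  have h1 := hlt a le_rfl
  rw [ha, Nat.succ_eq_add_one] at hspec
  have haX : a ∈ X := by
    by_contra haX
    rw [pos_succ_of_notMem haX, pos_succ_of_notMem haX] at hspec
    omega
  have h2 : 𝒩.pos X a i = 𝒩.level a ∧ 𝒩.pos X a j = 𝒩.level a + 1 := by
    have h3 := hspec
    rw [pos_succ_of_mem haX, pos_succ_of_mem haX, Equiv.swap_apply_def, Equiv.swap_apply_def] at h3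
    split_ifs at h3 <;> omega
  exact ⟨a, haX, pos_eq_iff.1 h2.1, pos_eq_iff.1 h2.2, hlt,
    fun t ht => hX.reduced.pos_lt_of_le hij ht hspec⟩

/-- A pair of pseudolines that are in reverse order at some time is inverted by the target. -/
theorem IsArrangement.inverted_of_pos_lt (hX : 𝒩.IsArrangement X) {i j t : ℕ} (hij : i < j)
    (ht : t ≤ 𝒩.length) (h : 𝒩.pos X t j < 𝒩.pos X t i) : 𝒩.target⁻¹ j < 𝒩.target⁻¹ i := by
  have := hX.reduced.pos_lt_of_le hij ht h
  rwa [pos, pos, hX.state_length] at this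

/-- Two pseudolines cross at most once. -/
theorem IsArrangement.eq_of_crossing (hX : 𝒩.IsArrangement X) {a b i j : ℕ} (ha : a ∈ X)
    (hb : b ∈ X) (hai : 𝒩.state X a (𝒩.level a) = i) (haj : 𝒩.state X a (𝒩.level a + 1) = j)
    (hbi : 𝒩.state X b (𝒩.level b) = i) (hbj : 𝒩.state X b (𝒩.level b + 1) = j) : a = b := by
  have key : ∀ a b, a ∈ X → b ∈ X → 𝒩.state X a (𝒩.level a) = i →
      𝒩.state X a (𝒩.level a + 1) = j → 𝒩.state X b (𝒩.level b) = i →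
      𝒩.state X b (𝒩.level b + 1) = j → ¬ a < b := by
    intro a b ha _ hai haj hbi hbj hab
    have hij : i < j := hai ▸ haj ▸ hX.reduced a ha
    have h1 : 𝒩.pos X (a + 1) j < 𝒩.pos X (a + 1) i := by
      rw [pos_succ_of_mem ha, pos_succ_of_mem ha, pos_eq_iff.2 hai, pos_eq_iff.2 haj]
      simp
    have h2 := hX.reduced.pos_lt_of_le hij hab h1
    rw [pos_eq_iff.2 hbi, pos_eq_iff.2 hbj] at h2
    omega
  have h1 := key a b ha hb hai haj hbi hbj
  have h2 := key b a hb ha hbi hbj hai haj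
  omega

/-! ### Flips -/

/-- Exchanging the status of two meetings of the same pseudolines exchanges their labels in between,
which is composition with the transposition `τ`. -/
theorem state_eq_of_exchange {t₁ t₂ : ℕ} (h12 : t₁ < t₂) {τ : Equiv.Perm ℕ}
    (h1 : Equiv.swap (𝒩.state X t₁ (𝒩.level t₁)) (𝒩.state X t₁ (𝒩.level t₁ + 1)) = τ)
    (h2 : Equiv.swap (𝒩.state X t₂ (𝒩.level t₂)) (𝒩.state X t₂ (𝒩.level t₂ + 1)) = τ)
    (hne : ∀ s, s ≠ t₁ → s ≠ t₂ → (s ∈ X' ↔ s ∈ X)) (h1X : t₁ ∈ X' ↔ t₁ ∉ X)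
    (h2X : t₂ ∈ X' ↔ t₂ ∉ X) (t : ℕ) :
    𝒩.state X' t = if t₁ < t ∧ t ≤ t₂ then τ * 𝒩.state X t else 𝒩.state X t := by
  have hτ : τ * τ = 1 := by rw [← h1, Equiv.swap_mul_self]
  have hcomm : ∀ s, Equiv.swap (𝒩.state X s (𝒩.level s)) (𝒩.state X s (𝒩.level s + 1)) = τ →
      𝒩.state X s * Equiv.swap (𝒩.level s) (𝒩.level s + 1) = τ * 𝒩.state X s := by
    intro s hs
    rw [← hs, Equiv.mul_swap_eq_swap_mul]
  induction t with
  | zero => simp [state]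
  | succ t ih =>
    by_cases ht1 : t = t₁
    · subst ht1
      rw [if_neg (by omega)] at ih
      rw [if_pos (by omega)]
      by_cases htX : t ∈ X
      · rw [state_succ_of_notMem (by tauto), state_succ_of_mem htX, ih, hcomm t h1, ← mul_assoc,
          hτ, one_mul]
      · rw [state_succ_of_mem (h1X.2 htX), state_succ_of_notMem htX, ih, hcomm t h1]
    · by_cases ht2 : t = t₂
      · subst ht2
        rw [if_pos (by omega)] at ih
        rw [if_neg (by omega)]
        by_cases htX : t ∈ X
        · rw [state_succ_of_notMem (by tauto), state_succ_of_mem htX, ih, hcomm t h2]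
        · rw [state_succ_of_mem (h2X.2 htX), state_succ_of_notMem htX, ih, mul_assoc,
            hcomm t h2, ← mul_assoc, hτ, one_mul]
      · have hiff := hne t ht1 ht2
        have hc : (t₁ < t + 1 ∧ t + 1 ≤ t₂) ↔ (t₁ < t ∧ t ≤ t₂) := by omega
        simp only [hc]
        by_cases htX : t ∈ X
        · rw [state_succ_of_mem (hiff.2 htX), state_succ_of_mem htX, ih]
          split_ifs
          · rw [mul_assoc]
          · rfl
        · rw [state_succ_of_notMem (fun h => htX (hiff.1 h)), state_succ_of_notMem htX, ih]

/-- Exchanging a crossing `a` with a contact `b` of the same two pseudolines yields an arrangement,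
in which these pseudolines are exchanged between `a` and `b`. -/
theorem IsArrangement.flip (hX : 𝒩.IsArrangement X) {a b i j : ℕ} (ha : a ∈ X)
    (hb : b ∈ 𝒩.active) (hbX : b ∉ X)
    (h1 : Equiv.swap (𝒩.state X a (𝒩.level a)) (𝒩.state X a (𝒩.level a + 1)) = Equiv.swap i j)
    (h2 : Equiv.swap (𝒩.state X b (𝒩.level b)) (𝒩.state X b (𝒩.level b + 1)) = Equiv.swap i j) :
    𝒩.IsArrangement (insert b (X.erase a)) ∧ ∀ t, 𝒩.state (insert b (X.erase a)) t =
      if min a b < t ∧ t ≤ max a b then Equiv.swap i j * 𝒩.state X t else 𝒩.state X t := by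
  have hab : a ≠ b := by rintro rfl; exact hbX ha
  have hst : ∀ t, 𝒩.state (insert b (X.erase a)) t =
      if min a b < t ∧ t ≤ max a b then Equiv.swap i j * 𝒩.state X t else 𝒩.state X t := by
    rcases lt_or_gt_of_ne hab with h | h
    · rw [min_eq_left h.le, max_eq_right h.le]
      refine state_eq_of_exchange h h1 h2 ?_ ?_ ?_
      · intro s hs1 hs2; simp [hs1, hs2]
      · simp [ha, hab]
      · simp [hbX]
    · rw [min_eq_right h.le, max_eq_left h.le]
      refine state_eq_of_exchange h h2 h1 ?_ ?_ ?_
      · intro s hs1 hs2; simp [hs1, hs2]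
      · simp [hbX]
      · simp [ha, hab]
  refine ⟨isArrangement_of_card ?_ ?_ ?_, hst⟩
  · intro s hs
    rcases Finset.mem_insert.1 hs with rfl | hs
    · exact hb
    · exact hX.subset (Finset.mem_of_mem_erase hs)
  · rw [hst, if_neg, hX.state_length]
    have := 𝒩.lt_length a (hX.subset ha)
    have := 𝒩.lt_length b hb
    omega
  · rw [Finset.card_insert_of_notMem (by simp [hbX]), Finset.card_erase_of_mem ha, ← hX.card_eq]
    have := Finset.card_pos.2 ⟨a, ha⟩
    omega

end SortingNetwork

namespace SortingNetwork

variable {𝒩 : SortingNetwork} {X X' : Finset ℕ}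

/-! ### Sorted arrangements -/

/-- The arrangement is sorted by `f`: at each contact, the lower pseudoline has the larger value. -/
def IsSorted (𝒩 : SortingNetwork) (f : ℕ → ℝ) (X : Finset ℕ) : Prop :=
  ∀ t i j, 𝒩.IsContact X t i j → f j < f i

/-- If contacts only occur before crossings, the arrangement can be read off from the target
permutation, backwards in time. -/
theorem IsArrangement.eq_of_contact_lt {X₁ X₂ : Finset ℕ} (h₁ : 𝒩.IsArrangement X₁)
    (h₂ : 𝒩.IsArrangement X₂) (hc₁ : ∀ t i j, 𝒩.IsContact X₁ t i j → i < j)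
    (hc₂ : ∀ t i j, 𝒩.IsContact X₂ t i j → i < j) : X₁ = X₂ := by
  have hmem : ∀ {X}, 𝒩.IsArrangement X → (∀ t i j, 𝒩.IsContact X t i j → i < j) → ∀ t ∈ 𝒩.active,
      (t ∈ X ↔ 𝒩.state X (t + 1) (𝒩.level t + 1) < 𝒩.state X (t + 1) (𝒩.level t)) := by
    intro X hX hc t ht
    by_cases htX : t ∈ X
    · simpa [htX, state_succ_of_mem htX] using hX.reduced t htX
    · simpa [htX, state_succ_of_notMem htX] using (hc t _ _ ⟨ht, htX, rfl, rfl⟩).le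
  have key : ∀ d, d ≤ 𝒩.length → 𝒩.state X₁ (𝒩.length - d) = 𝒩.state X₂ (𝒩.length - d) ∧
      ∀ t, 𝒩.length - d ≤ t → (t ∈ X₁ ↔ t ∈ X₂) := by
    intro d hd
    induction d with
    | zero =>
      refine ⟨h₁.state_length.trans h₂.state_length.symm, fun t ht => ?_⟩
      have h3 : t ∉ X₁ := fun h => by
        have := 𝒩.lt_length t (h₁.subset h); omega
      have h4 : t ∉ X₂ := fun h => by
        have := 𝒩.lt_length t (h₂.subset h); omega
      simp [h3, h4]
    | succ d ih =>
      obtain ⟨ih1, ih2⟩ := ih (by omega)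
      set t := 𝒩.length - (d + 1) with ht
      have hts : 𝒩.length - d = t + 1 := by omega
      rw [hts] at ih1 ih2
      have hiff : t ∈ X₁ ↔ t ∈ X₂ := by
        by_cases hta : t ∈ 𝒩.active
        · rw [hmem h₁ hc₁ t hta, hmem h₂ hc₂ t hta, ih1]
        · have h3 : t ∉ X₁ := fun h => hta (h₁.subset h)
          have h4 : t ∉ X₂ := fun h => hta (h₂.subset h)
          simp [h3, h4]
      refine ⟨?_, fun s hs => ?_⟩
      · by_cases htX : t ∈ X₁
        · rw [state_succ_of_mem htX, state_succ_of_mem (hiff.1 htX)] at ih1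
          exact mul_right_cancel ih1
        · rwa [state_succ_of_notMem htX, state_succ_of_notMem fun h => htX (hiff.2 h)] at ih1
      · rcases eq_or_lt_of_le hs with rfl | hs
        · exact hiff
        · exact ih2 s hs
  ext t
  exact (key 𝒩.length le_rfl).2 t (by omega)

/-- If the values of `a` and `b` are adjacent among those of `f`, then exchanging them preserves all
other comparisons. -/
theorem swap_lt_swap_of_adjacent {f : ℕ → ℝ} {n a b c d : ℕ} (hf : Set.InjOn f (Set.Iio n))
    (han : a < n) (hbn : b < n) (hab : f a < f b) (hadj : ∀ c < n, ¬ (f a < f c ∧ f c < f b))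
    (hc : c < n) (hd : d < n) (hdc : f d < f c) (hne : ¬ (c = b ∧ d = a)) :
    f (Equiv.swap a b d) < f (Equiv.swap a b c) := by
  have hlow : ∀ e < n, e ≠ a → f e < f b → f e < f a := by
    intro e he hea heb
    refine lt_of_le_of_ne (not_lt.1 fun h => hadj e he ⟨h, heb⟩) fun h => hea (hf he han h)
  have hhigh : ∀ e < n, e ≠ b → f a < f e → f b < f e := by
    intro e he heb hea
    refine lt_of_le_of_ne (not_lt.1 fun h => hadj e he ⟨hea, h⟩) fun h => heb (hf hbn he h).symm
  rcases eq_or_ne c a with rfl | hca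
  · rw [Equiv.swap_apply_left]
    have hdb : d ≠ b := by rintro rfl; linarith
    have hdc' : d ≠ c := by rintro rfl; linarith
    rw [Equiv.swap_apply_of_ne_of_ne hdc' hdb]
    linarith
  · rcases eq_or_ne c b with rfl | hcb
    · rw [Equiv.swap_apply_right]
      have hda : d ≠ a := fun h => hne ⟨rfl, h⟩
      have hdc' : d ≠ c := by rintro rfl; linarith
      rw [Equiv.swap_apply_of_ne_of_ne hda hdc']
      exact hlow d hd hda hdc
    · rw [Equiv.swap_apply_of_ne_of_ne hca hcb]
      rcases eq_or_ne d a with rfl | hda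
      · rw [Equiv.swap_apply_left]; exact hhigh c hc hcb hdc
      · rcases eq_or_ne d b with rfl | hdb
        · rw [Equiv.swap_apply_right]; linarith
        · rwa [Equiv.swap_apply_of_ne_of_ne hda hdb]

/-- Let `a < b` have adjacent values of `f` with `f a < f b`. An arrangement `X` sorted by `f` is
turned into an arrangement sorted by `f ∘ swap a b` by exchanging the crossing of `a` and `b` with
their last contact, if there is any contact. The crossing then becomes their first contact, from
which `X` is recovered. -/
theorem IsSorted.exists_isSorted_swap {f : ℕ → ℝ} {a b : ℕ}
    (hf : Set.InjOn f (Set.Iio 𝒩.size)) (hbn : b < 𝒩.size) (hlt : a < b) (hab : f a < f b)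
    (hadj : ∀ c < 𝒩.size, ¬ (f a < f c ∧ f c < f b)) (hinv : 𝒩.target⁻¹ b < 𝒩.target⁻¹ a)
    (hX : 𝒩.IsArrangement X) (hs : 𝒩.IsSorted f X) :
    ∃ Z, 𝒩.IsArrangement Z ∧ 𝒩.IsSorted (fun c => f (Equiv.swap a b c)) Z ∧
      ((X = Z ∧ ∀ t, ¬ 𝒩.IsContact Z t a b) ∨
        ∃ s e, 𝒩.IsContact Z s a b ∧ (∀ t < s, ¬ 𝒩.IsContact Z t a b) ∧ e ∈ Z ∧
          𝒩.state Z e (𝒩.level e) = a ∧ 𝒩.state Z e (𝒩.level e + 1) = b ∧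
          X = insert s (Z.erase e)) := by
  classical
  have han : a < 𝒩.size := hlt.trans hbn
  have hnc : ∀ t, ¬ 𝒩.IsContact X t a b := fun t ht => lt_asymm hab (hs t a b ht)
  by_cases hex : ∃ t, 𝒩.IsContact X t b a
  · obtain ⟨s, hsX, hsa, hsb, hle, hgt⟩ := hX.exists_crossing hlt hinv
    obtain ⟨e, he, hemax⟩ : ∃ e, 𝒩.IsContact X e b a ∧ ∀ t, 𝒩.IsContact X t b a → t ≤ e := by
      have hne : (𝒩.active.filter fun t => 𝒩.IsContact X t b a).Nonempty := by
        obtain ⟨t, ht⟩ := hex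
        exact ⟨t, Finset.mem_filter.2 ⟨ht.mem, ht⟩⟩
      obtain ⟨e, he, hmax⟩ := Finset.exists_max_image _ id hne
      exact ⟨e, (Finset.mem_filter.1 he).2, fun t ht => hmax t (Finset.mem_filter.2 ⟨ht.mem, ht⟩)⟩
    have hafter : ∀ t, 𝒩.IsContact X t b a → s < t := by
      intro t ht
      by_contra hcon
      have := hle t (by omega)
      rw [ht.pos_lower, ht.pos_upper] at this
      omega
    have hse := hafter e he
    obtain ⟨hZ, hst⟩ := hX.flip (i := a) (j := b) hsX he.mem he.notMem (by rw [hsa, hsb])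
      (by rw [he.lower, he.upper, Equiv.swap_comm])
    rw [min_eq_left hse.le, max_eq_right hse.le] at hst
    set Z := insert e (X.erase s) with hZdef
    have hsZ : s ∉ Z := by
      simp only [hZdef, Finset.mem_insert, Finset.mem_erase]
      omega
    have heZ : e ∈ Z := by simp [hZdef]
    have hmemZ : ∀ t, t ∉ Z → t ≠ s → t ∉ X := by
      intro t ht hts htX
      exact ht (by simp [hZdef, htX, hts])
    have hstout : ∀ t, ¬ (s < t ∧ t ≤ e) → 𝒩.state Z t = 𝒩.state X t := fun t ht => by
      rw [hst, if_neg ht]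
    have hstin : ∀ t, s < t → t ≤ e → 𝒩.state Z t = Equiv.swap a b * 𝒩.state X t :=
      fun t h1 h2 => by rw [hst, if_pos ⟨h1, h2⟩]
    have hstX : 𝒩.state Z s = 𝒩.state X s := hstout s (by omega)
    refine ⟨Z, hZ, ?_, Or.inr ⟨s, e, ⟨hX.subset hsX, hsZ, by rw [hstX, hsa], by rw [hstX, hsb]⟩,
      ?_, heZ, ?_, ?_, ?_⟩⟩
    · intro t c d hcd
      by_cases hts : t = s
      · subst hts
        have hc : c = a := by rw [← hcd.lower, hstX, hsa]
        have hd : d = b := by rw [← hcd.upper, hstX, hsb]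
        simpa [hc, hd] using hab
      · have htX := hmemZ t hcd.notMem hts
        by_cases hin : s < t ∧ t ≤ e
        · have h1 := hcd.lower
          have h2 := hcd.upper
          rw [hstin t hin.1 hin.2, Equiv.Perm.mul_apply] at h1 h2
          have h3 := hs t _ _ ⟨hcd.mem, htX, rfl, rfl⟩
          simpa [← h1, ← h2] using h3
        · have h1 : 𝒩.IsContact X t c d := ⟨hcd.mem, htX, by rw [← hstout t hin, hcd.lower],
            by rw [← hstout t hin, hcd.upper]⟩
          obtain ⟨hc, hd⟩ := h1.lt_size hX.subset
          refine swap_lt_swap_of_adjacent hf han hbn hab hadj hc hd (hs t c d h1) ?_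
          rintro ⟨rfl, rfl⟩
          exact hin ⟨hafter t h1, hemax t h1⟩
    · intro t hts ht
      have h1 := hstout t (by omega)
      exact hnc t ⟨ht.mem, hmemZ t ht.notMem (by omega), by rw [← h1, ht.lower],
        by rw [← h1, ht.upper]⟩
    · rw [hstin e hse le_rfl, Equiv.Perm.mul_apply, he.lower, Equiv.swap_apply_right]
    · rw [hstin e hse le_rfl, Equiv.Perm.mul_apply, he.upper, Equiv.swap_apply_left]
    · rw [hZdef, Finset.erase_insert (by simp [he.notMem]), Finset.insert_erase hsX]
  · push Not at hex
    refine ⟨X, hX, ?_, Or.inl ⟨rfl, hnc⟩⟩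
    intro t c d hcd
    obtain ⟨hc, hd⟩ := hcd.lt_size hX.subset
    refine swap_lt_swap_of_adjacent hf han hbn hab hadj hc hd (hs t c d hcd) ?_
    rintro ⟨rfl, rfl⟩
    exact hex t hcd

/-- There is at most one arrangement sorted by a given `f`, provided that each pair of labels which
`f` puts in increasing order has to cross. If there is no such pair, contacts only occur before
crossings. Otherwise, a pair with the least difference of values is exchanged. -/
theorem IsSorted.eq {f : ℕ → ℝ} (hf : Set.InjOn f (Set.Iio 𝒩.size))
    (hinv : ∀ a b, a < b → b < 𝒩.size → f a < f b → 𝒩.target⁻¹ b < 𝒩.target⁻¹ a)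
    {X₁ X₂ : Finset ℕ} (h₁ : 𝒩.IsArrangement X₁) (h₂ : 𝒩.IsArrangement X₂)
    (hs₁ : 𝒩.IsSorted f X₁) (hs₂ : 𝒩.IsSorted f X₂) : X₁ = X₂ := by
  classical
  induction hN : ((Finset.range 𝒩.size ×ˢ Finset.range 𝒩.size).filter
    fun q => q.1 < q.2 ∧ f q.1 < f q.2).card using Nat.strong_induction_on
    generalizing f X₁ X₂ with
  | _ N ih =>
  set D := (Finset.range 𝒩.size ×ˢ Finset.range 𝒩.size).filter
    fun q => q.1 < q.2 ∧ f q.1 < f q.2 with hD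
  have hmemD : ∀ q, q ∈ D ↔ (q.1 < q.2 ∧ q.2 < 𝒩.size) ∧ f q.1 < f q.2 := by
    intro q
    simp only [hD, Finset.mem_filter, Finset.mem_product, Finset.mem_range]
    constructor
    · rintro ⟨h1, h2, h3⟩; exact ⟨⟨h2, h1.2⟩, h3⟩
    · rintro ⟨⟨h1, h2⟩, h3⟩; exact ⟨⟨h1.trans h2, h2⟩, h1, h3⟩
  rcases D.eq_empty_or_nonempty with hE | hne
  · have hlt : ∀ {X}, 𝒩.IsArrangement X → 𝒩.IsSorted f X → ∀ t i j, 𝒩.IsContact X t i j →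
        i < j := by
      intro X hX hs t i j hc
      by_contra hcon
      have hij : j < i := lt_of_le_of_ne (not_lt.1 hcon) hc.ne.symm
      have : (j, i) ∈ D := (hmemD _).2 ⟨⟨hij, (hc.lt_size hX.subset).1⟩, hs t i j hc⟩
      rw [hE] at this
      exact Finset.notMem_empty _ this
    exact h₁.eq_of_contact_lt h₂ (hlt h₁ hs₁) (hlt h₂ hs₂)
  · obtain ⟨⟨a, b⟩, hq, hmin⟩ := Finset.exists_min_image D (fun q => f q.2 - f q.1) hne
    obtain ⟨⟨hlt, hbn⟩, hab⟩ := (hmemD _).1 hq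
    have han : a < 𝒩.size := hlt.trans hbn
    simp only at hlt hbn hab hmin
    have hadj : ∀ c < 𝒩.size, ¬ (f a < f c ∧ f c < f b) := by
      rintro c hc ⟨h1, h2⟩
      by_cases hac : a < c
      · have := hmin (a, c) ((hmemD _).2 ⟨⟨hac, hc⟩, h1⟩)
        simp only at this
        linarith
      · have hcb : c < b := by omega
        have := hmin (c, b) ((hmemD _).2 ⟨⟨hcb, hbn⟩, h2⟩)
        simp only at this
        linarith
    have hi := hinv a b hlt hbn hab
    obtain ⟨Z₁, hZ₁, hsZ₁, hrec₁⟩ := hs₁.exists_isSorted_swap hf hbn hlt hab hadj hi h₁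
    obtain ⟨Z₂, hZ₂, hsZ₂, hrec₂⟩ := hs₂.exists_isSorted_swap hf hbn hlt hab hadj hi h₂
    have hsw : ∀ c, Equiv.swap a b c < 𝒩.size ↔ c < 𝒩.size := by
      intro c
      rw [Equiv.swap_apply_def]
      split_ifs <;> omega
    have hsub : ∀ c d, c < d → d < 𝒩.size → f (Equiv.swap a b c) < f (Equiv.swap a b d) →
        (f c < f d ∧ ¬ (c = a ∧ d = b)) := by
      intro c d hcd hd h
      have hne : ¬ (c = a ∧ d = b) := by
        rintro ⟨rfl, rfl⟩
        rw [Equiv.swap_apply_left, Equiv.swap_apply_right] at h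
        linarith
      refine ⟨?_, hne⟩
      have h1 := swap_lt_swap_of_adjacent hf han hbn hab hadj ((hsw d).2 hd)
        ((hsw c).2 (hcd.trans hd)) h (by
        rintro ⟨h2, h3⟩
        have hda : d = a := (Equiv.swap a b).injective (h2.trans (Equiv.swap_apply_left a b).symm)
        have hcb : c = b := (Equiv.swap a b).injective (h3.trans (Equiv.swap_apply_right a b).symm)
        omega)
      simpa using h1
    have hZ : Z₁ = Z₂ := by
      refine ih _ ?_ (f := fun c => f (Equiv.swap a b c)) ?_ ?_ hZ₁ hZ₂ hsZ₁ hsZ₂ rfl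
      · rw [← hN]
        apply Finset.card_lt_card
        rw [Finset.ssubset_iff_of_subset]
        · refine ⟨(a, b), hq, ?_⟩
          simp only [Finset.mem_filter, not_and]
          intro _ _ h
          rw [Equiv.swap_apply_left, Equiv.swap_apply_right] at h
          linarith
        · rintro ⟨c, d⟩ h
          simp only [Finset.mem_filter, Finset.mem_product, Finset.mem_range] at h
          exact (hmemD _).2 ⟨⟨h.2.1, h.1.2⟩, (hsub c d h.2.1 h.1.2 h.2.2).1⟩
      · intro c hc d hd h
        have := hf ((hsw c).2 hc) ((hsw d).2 hd) h
        simpa using this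
      · intro c d hcd hd h
        exact hinv c d hcd hd (hsub c d hcd hd h).1
    subst hZ
    rcases hrec₁ with ⟨rfl, hn₁⟩ | ⟨s₁, e₁, hc₁, hf₁, he₁, hea₁, heb₁, rfl⟩
    · rcases hrec₂ with ⟨rfl, -⟩ | ⟨s₂, e₂, hc₂, -⟩
      · rfl
      · exact absurd hc₂ (hn₁ _)
    · rcases hrec₂ with ⟨rfl, hn₂⟩ | ⟨s₂, e₂, hc₂, hf₂, he₂, hea₂, heb₂, rfl⟩
      · exact absurd hc₁ (hn₂ _)
      · have h1 : e₁ = e₂ := hZ₁.eq_of_crossing he₁ he₂ hea₁ heb₁ hea₂ heb₂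
        have h2 : s₁ = s₂ := by
          by_contra hne
          rcases lt_or_gt_of_ne hne with h | h
          · exact hf₂ _ h hc₁
          · exact hf₁ _ h hc₂
        rw [h1, h2]

/-! ### Sums of positions -/

/-- The sum of the positions of the pseudoline `c` at the times of `S`. -/
def posSum (𝒩 : SortingNetwork) (S X : Finset ℕ) (c : ℕ) : ℝ := ∑ s ∈ S, (𝒩.pos X s c : ℝ)

/-- Between two meetings of the same pseudolines, there is a time of `S`. -/
def Separates (𝒩 : SortingNetwork) (S : Finset ℕ) : Prop :=
  ∀ X ⊆ 𝒩.active, ∀ t₁ ∈ 𝒩.active, ∀ t₂ ∈ 𝒩.active, t₁ < t₂ →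
    Equiv.swap (𝒩.state X t₁ (𝒩.level t₁)) (𝒩.state X t₁ (𝒩.level t₁ + 1)) =
      Equiv.swap (𝒩.state X t₂ (𝒩.level t₂)) (𝒩.state X t₂ (𝒩.level t₂ + 1)) →
    ∃ s ∈ S, t₁ < s ∧ s ≤ t₂

/-- The pseudolines `i` and `j` cross. -/
def Crosses (𝒩 : SortingNetwork) (i j : ℕ) : Prop :=
  (i < j ∧ 𝒩.target⁻¹ j < 𝒩.target⁻¹ i) ∨ (j < i ∧ 𝒩.target⁻¹ i < 𝒩.target⁻¹ j)

/-- Flipping a contact of two crossing pseudolines `i` (below) and `j` (above) changes the sums of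
positions by a positive multiple of `e_i - e_j`, and exchanges the two labels in some contacts. -/
theorem IsContact.exists_flip {S : Finset ℕ} (hS : 𝒩.Separates S) (hX : 𝒩.IsArrangement X)
    {b i j : ℕ} (hb : 𝒩.IsContact X b i j) (hcr : 𝒩.Crosses i j) :
    ∃ X', 𝒩.IsArrangement X' ∧
      (∃ A : ℝ, 0 < A ∧ ∀ c, 𝒩.posSum S X' c =
        𝒩.posSum S X c + A * ((if c = i then 1 else 0) - (if c = j then 1 else 0))) ∧
      ∀ t c d, 𝒩.IsContact X' t c d → (c = i ∧ d = j) ∨ (c = j ∧ d = i) ∨ 𝒩.IsContact X t c d ∨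
        𝒩.IsContact X t (Equiv.swap i j c) (Equiv.swap i j d) := by
  classical
  obtain ⟨a, haX, hpair, hlt, hpij⟩ : ∃ a ∈ X,
      ((𝒩.state X a (𝒩.level a) = i ∧ 𝒩.state X a (𝒩.level a + 1) = j) ∨
       (𝒩.state X a (𝒩.level a) = j ∧ 𝒩.state X a (𝒩.level a + 1) = i)) ∧ a ≠ b ∧
      ∀ t, min a b < t → t ≤ max a b → 𝒩.pos X t i < 𝒩.pos X t j := by
    have hpb : 𝒩.pos X b i < 𝒩.pos X b j := by rw [hb.pos_lower, hb.pos_upper]; omega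
    rcases hcr with ⟨hij, hinv⟩ | ⟨hij, hinv⟩
    · obtain ⟨a, haX, h1, h2, hle, hgt⟩ := hX.exists_crossing hij hinv
      refine ⟨a, haX, Or.inl ⟨h1, h2⟩, fun h => hb.notMem (h ▸ haX), fun t _ ht => hle t ?_⟩
      have : b ≤ a := by
        by_contra hcon
        have := hgt b (by omega)
        omega
      omega
    · obtain ⟨a, haX, h1, h2, hle, hgt⟩ := hX.exists_crossing hij hinv
      refine ⟨a, haX, Or.inr ⟨h1, h2⟩, fun h => hb.notMem (h ▸ haX), fun t ht _ => hgt t ?_⟩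
      have : a < b := by
        by_contra hcon
        have := hle b (by omega)
        omega
      omega
  have hsa : Equiv.swap (𝒩.state X a (𝒩.level a)) (𝒩.state X a (𝒩.level a + 1)) =
      Equiv.swap i j := by
    rcases hpair with ⟨h1, h2⟩ | ⟨h1, h2⟩
    · rw [h1, h2]
    · rw [h1, h2, Equiv.swap_comm]
  have hsb : Equiv.swap (𝒩.state X b (𝒩.level b)) (𝒩.state X b (𝒩.level b + 1)) =
      Equiv.swap i j := by rw [hb.lower, hb.upper]
  obtain ⟨hX', hst⟩ := hX.flip haX hb.mem hb.notMem hsa hsb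
  refine ⟨_, hX', ?_, ?_⟩
  · refine ⟨∑ s ∈ S.filter (fun s => min a b < s ∧ s ≤ max a b),
      ((𝒩.pos X s j : ℝ) - 𝒩.pos X s i), ?_, ?_⟩
    · apply Finset.sum_pos
      · intro s hs
        have := hpij s (Finset.mem_filter.1 hs).2.1 (Finset.mem_filter.1 hs).2.2
        rw [sub_pos]
        exact_mod_cast this
      · rcases lt_or_gt_of_ne hlt with h | h
        · obtain ⟨s, hs, h1, h2⟩ := hS X hX.subset a (hX.subset haX) b hb.mem h
            (hsa.trans hsb.symm)
          exact ⟨s, Finset.mem_filter.2 ⟨hs, by omega, by omega⟩⟩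
        · obtain ⟨s, hs, h1, h2⟩ := hS X hX.subset b hb.mem a (hX.subset haX) h
            (hsb.trans hsa.symm)
          exact ⟨s, Finset.mem_filter.2 ⟨hs, by omega, by omega⟩⟩
    · intro c
      have hpos : ∀ s, 𝒩.pos (insert b (X.erase a)) s c =
          if min a b < s ∧ s ≤ max a b then 𝒩.pos X s (Equiv.swap i j c) else 𝒩.pos X s c := by
        intro s
        unfold pos
        rw [hst]
        split_ifs
        · simp
        · rfl
      unfold posSum
      rw [Finset.sum_mul, Finset.sum_filter, ← Finset.sum_add_distrib]
      refine Finset.sum_congr rfl fun s _ => ?_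
      rw [hpos]
      have hne := hb.ne
      split_ifs with h1 h2 h3 h3
      · exact absurd (h2.symm.trans h3) hne
      · rw [h2, Equiv.swap_apply_left]; ring
      · rw [h3, Equiv.swap_apply_right]; ring
      · rw [Equiv.swap_apply_of_ne_of_ne h2 h3]; ring
      all_goals ring
  · intro t c d hcd
    by_cases hta : t = a
    · subst hta
      have h1 := hcd.lower
      have h2 := hcd.upper
      rw [hst] at h1 h2
      split_ifs at h1 h2
      · rw [Equiv.Perm.mul_apply] at h1 h2
        rcases hpair with ⟨h3, h4⟩ | ⟨h3, h4⟩
        · rw [h3, Equiv.swap_apply_left] at h1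
          rw [h4, Equiv.swap_apply_right] at h2
          exact Or.inr (Or.inl ⟨h1.symm, h2.symm⟩)
        · rw [h3, Equiv.swap_apply_right] at h1
          rw [h4, Equiv.swap_apply_left] at h2
          exact Or.inl ⟨h1.symm, h2.symm⟩
      · rcases hpair with ⟨h3, h4⟩ | ⟨h3, h4⟩
        · exact Or.inl ⟨h1.symm.trans h3, h2.symm.trans h4⟩
        · exact Or.inr (Or.inl ⟨h1.symm.trans h3, h2.symm.trans h4⟩)
    · have htX : t ∉ X := fun h => hcd.notMem (by simp [h, hta])
      have h1 := hcd.lower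
      have h2 := hcd.upper
      rw [hst] at h1 h2
      split_ifs at h1 h2
      · rw [Equiv.Perm.mul_apply] at h1 h2
        exact Or.inr (Or.inr (Or.inr ⟨hcd.mem, htX, by rw [← h1, Equiv.swap_apply_self],
          by rw [← h2, Equiv.swap_apply_self]⟩))
      · exact Or.inr (Or.inr (Or.inl ⟨hcd.mem, htX, h1, h2⟩))

/-- In an arrangement, a contact of two pseudolines that do not cross has the smaller label below. -/
theorem IsArrangement.contact_lt (hX : 𝒩.IsArrangement X) {t i j : ℕ} (hc : 𝒩.IsContact X t i j)
    (hcr : ¬ 𝒩.Crosses i j) : i < j := by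
  by_contra hcon
  have hij : j < i := lt_of_le_of_ne (not_lt.1 hcon) hc.ne.symm
  refine hcr (Or.inr ⟨hij, hX.inverted_of_pos_lt hij (𝒩.lt_length t hc.mem).le ?_⟩)
  rw [hc.pos_lower, hc.pos_upper]
  omega

/-- A function of the labels is compatible with the network if it does not increase along the pairs
`i < j` of pseudolines which do not cross. -/
def IsCompatible (𝒩 : SortingNetwork) (g : ℕ → ℝ) : Prop :=
  ∀ i j, i < j → j < 𝒩.size → ¬ 𝒩.Crosses i j → g j ≤ g i

/-- A compatible function has a refinement with distinct values, where ties are broken by putting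
the smaller label first. -/
theorem exists_refinement (g : ℕ → ℝ) (n : ℕ) : ∃ f : ℕ → ℝ, Set.InjOn f (Set.Iio n) ∧
    ∀ i < n, ∀ j < n, f j < f i ↔ g j < g i ∨ (g j = g i ∧ i < j) := by
  classical
  set D : ℕ → Finset ℕ := fun i => (Finset.range n).filter fun l => g l < g i ∨ (g l = g i ∧ i < l)
    with hD
  have hlt : ∀ i j, j < n → (g j < g i ∨ (g j = g i ∧ i < j)) → (D j).card < (D i).card := by
    intro i j hj h
    apply Finset.card_lt_card
    rw [Finset.ssubset_iff_of_subset]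
    · exact ⟨j, by simp [hD, hj, h], by simp [hD]⟩
    · intro l
      simp only [hD, Finset.mem_filter]
      rintro ⟨h1, h2⟩
      refine ⟨h1, ?_⟩
      rcases h with h | ⟨h, h'⟩ <;> rcases h2 with h2 | ⟨h2, h2'⟩
      · exact Or.inl (h2.trans h)
      · exact Or.inl (h2 ▸ h)
      · exact Or.inl (h ▸ h2)
      · exact Or.inr ⟨h2.trans h, h'.trans h2'⟩
  have htri : ∀ i j, i ≠ j → (g j < g i ∨ (g j = g i ∧ i < j)) ∨ (g i < g j ∨ (g i = g j ∧ j < i)) := by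
    intro i j hij
    rcases lt_trichotomy (g i) (g j) with h | h | h
    · exact Or.inr (Or.inl h)
    · rcases lt_or_gt_of_ne hij with h' | h'
      · exact Or.inl (Or.inr ⟨h.symm, h'⟩)
      · exact Or.inr (Or.inr ⟨h, h'⟩)
    · exact Or.inl (Or.inl h)
  refine ⟨fun i => (D i).card, ?_, ?_⟩
  · intro i hi j hj h
    by_contra hij
    have h' : (D i).card = (D j).card := Nat.cast_injective (R := ℝ) h
    rcases htri i j hij with h1 | h1
    · have := hlt i j hj h1; omega
    · have := hlt j i hi h1; omega
  · intro i hi j hj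
    rw [Nat.cast_lt]
    constructor
    · intro h
      have hij : i ≠ j := by rintro rfl; omega
      rcases htri i j hij with h1 | h1
      · exact h1
      · have := hlt j i hi h1; omega
    · exact hlt i j hj

/-- Local minimality implies global minimality: if a compatible function `g` does not increase from
the lower to the upper pseudoline at any contact of `X`, then `X` minimizes the linear functional
`g` of the sums of positions. -/
theorem IsArrangement.sum_mul_posSum_le {S : Finset ℕ} (hS : 𝒩.Separates S)
    (hX : 𝒩.IsArrangement X) (hX' : 𝒩.IsArrangement X') {g : ℕ → ℝ} (hg : 𝒩.IsCompatible g)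
    (hmin : ∀ t i j, 𝒩.IsContact X t i j → g j ≤ g i) :
    ∑ c ∈ Finset.range 𝒩.size, 𝒩.posSum S X c * g c ≤
      ∑ c ∈ Finset.range 𝒩.size, 𝒩.posSum S X' c * g c := by
  classical
  obtain ⟨f, hfinj, hf⟩ := exists_refinement g 𝒩.size
  set val : (ℕ → ℝ) → Finset ℕ → ℝ := fun h Y =>
    ∑ c ∈ Finset.range 𝒩.size, 𝒩.posSum S Y c * h c with hval
  change val g X ≤ val g X'
  have hflip : ∀ {Y b i j}, 𝒩.IsArrangement Y → 𝒩.IsContact Y b i j → f i < f j →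
      ∃ Y', 𝒩.IsArrangement Y' ∧ (∃ A : ℝ, 0 < A ∧ ∀ h, val h Y' = val h Y + A * (h i - h j)) ∧
      ∀ t c d, 𝒩.IsContact Y' t c d → (c = i ∧ d = j) ∨ (c = j ∧ d = i) ∨ 𝒩.IsContact Y t c d ∨
        𝒩.IsContact Y t (Equiv.swap i j c) (Equiv.swap i j d) := by
    intro Y b i j hY hc hij
    obtain ⟨hi, hj⟩ := hc.lt_size hY.subset
    have hcr : 𝒩.Crosses i j := by
      by_contra hcr
      have h1 := hY.contact_lt hc hcr
      have h2 := hg i j h1 hj hcr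
      have h3 := (hf i hi j hj).2 (by
        rcases lt_or_eq_of_le h2 with h | h
        · exact Or.inl h
        · exact Or.inr ⟨h, h1⟩)
      linarith
    obtain ⟨Y', hY', ⟨A, hA, hpos⟩, hcont⟩ := hc.exists_flip hS hY hcr
    refine ⟨Y', hY', ⟨A, hA, fun h => ?_⟩, hcont⟩
    have hsum : ∀ l < 𝒩.size, ∑ c ∈ Finset.range 𝒩.size, (if c = l then (1 : ℝ) else 0) * h c = h l := by
      intro l hl
      simp [Finset.mem_range.2 hl]
    rw [← hsum i hi, ← hsum j hj, ← Finset.sum_sub_distrib, Finset.mul_sum]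
    simp only [hval]
    rw [← Finset.sum_add_distrib]
    refine Finset.sum_congr rfl fun c _ => ?_
    rw [hpos]; ring
  have hgle : ∀ {i j}, i < 𝒩.size → j < 𝒩.size → f i < f j → g i ≤ g j := by
    intro i j hi hj h
    rcases (hf j hj i hi).1 h with h1 | h1
    · exact h1.le
    · exact h1.1.le
  have hexmin : ∀ (Q : Finset ℕ → Prop) (h : ℕ → ℝ), (∃ Y, 𝒩.IsArrangement Y ∧ Q Y) →
      ∃ Y, (𝒩.IsArrangement Y ∧ Q Y) ∧ ∀ Y', 𝒩.IsArrangement Y' → Q Y' → val h Y ≤ val h Y' := by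
    rintro Q h ⟨Y₀, hY₀, hQ₀⟩
    obtain ⟨Y, hY, hYmin⟩ := Finset.exists_min_image
      (𝒩.active.powerset.filter fun Y => 𝒩.IsArrangement Y ∧ Q Y) (val h)
      ⟨Y₀, Finset.mem_filter.2 ⟨Finset.mem_powerset.2 hY₀.subset, hY₀, hQ₀⟩⟩
    exact ⟨Y, (Finset.mem_filter.1 hY).2, fun Y' h1 h2 => hYmin Y'
      (Finset.mem_filter.2 ⟨Finset.mem_powerset.2 h1.subset, h1, h2⟩)⟩
  have hsorted : ∀ Y, 𝒩.IsArrangement Y →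
      (∀ t i j, 𝒩.IsContact Y t i j → ¬ f i < f j) → 𝒩.IsSorted f Y := by
    intro Y hY h t i j hc
    obtain ⟨hi, hj⟩ := hc.lt_size hY.subset
    exact lt_of_le_of_ne (not_lt.1 (h t i j hc)) fun h1 => hc.ne (hfinj hj hi h1).symm
  -- Among the arrangements at which `g` is locally minimal, with the same value of `g` as `X`,
  -- one that minimizes `f` is sorted by `f`.
  obtain ⟨Y, ⟨hY, hYmin, hYval⟩, hYf⟩ := hexmin
    (fun Y => (∀ t i j, 𝒩.IsContact Y t i j → g j ≤ g i) ∧ val g Y = val g X) f ⟨X, hX, hmin, rfl⟩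
  have hYs : 𝒩.IsSorted f Y := by
    refine hsorted Y hY fun t i j hc hij => ?_
    obtain ⟨hi, hj⟩ := hc.lt_size hY.subset
    obtain ⟨Y', hY', ⟨A, hA, hv⟩, hcont⟩ := hflip hY hc hij
    have hgij : g i = g j := le_antisymm (hgle hi hj hij) (hYmin t i j hc)
    have hsw : ∀ c, g (Equiv.swap i j c) = g c := by
      intro c
      rw [Equiv.swap_apply_def]
      split_ifs with h1 h2
      · rw [h1, hgij]
      · rw [h2, hgij]
      · rfl
    have h1 := hYf Y' hY' ⟨?_, ?_⟩
    · rw [hv f] at h1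
      have := mul_pos hA (sub_pos.2 hij)
      have h2 : A * (f i - f j) = - (A * (f j - f i)) := by ring
      linarith
    · intro t c d hcd
      rcases hcont t c d hcd with ⟨rfl, rfl⟩ | ⟨rfl, rfl⟩ | h | h
      · exact hgij.ge
      · exact hgij.le
      · exact hYmin t c d h
      · have := hYmin t _ _ h
        rwa [hsw, hsw] at this
    · rw [hv g, hgij, sub_self, mul_zero, add_zero, hYval]
  -- So is an arrangement that minimizes `g` and, among these, minimizes `f`.
  obtain ⟨W₀, ⟨hW₀, -⟩, hW₀min⟩ := hexmin (fun _ => True) g ⟨X, hX, trivial⟩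
  obtain ⟨W, ⟨hW, hWval⟩, hWf⟩ := hexmin (fun Y => val g Y = val g W₀) f ⟨W₀, hW₀, rfl⟩
  have hWs : 𝒩.IsSorted f W := by
    refine hsorted W hW fun t i j hc hij => ?_
    obtain ⟨hi, hj⟩ := hc.lt_size hW.subset
    obtain ⟨W', hW', ⟨A, hA, hv⟩, -⟩ := hflip hW hc hij
    have h1 := hgle hi hj hij
    have h2 := hW₀min W' hW' trivial
    rw [hv g, hWval] at h2
    have hgij : g i = g j := by
      by_contra hne
      have := mul_pos hA (sub_pos.2 (lt_of_le_of_ne h1 hne))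
      have h3 : A * (g i - g j) = - (A * (g j - g i)) := by ring
      linarith
    have h3 := hWf W' hW' (by rw [hv g, hgij, sub_self, mul_zero, add_zero, hWval])
    rw [hv f] at h3
    have := mul_pos hA (sub_pos.2 hij)
    have h4 : A * (f i - f j) = - (A * (f j - f i)) := by ring
    linarith
  have hYW : Y = W := by
    refine IsSorted.eq hfinj (fun a b hab hb h => ?_) hY hW hYs hWs
    have ha := hab.trans hb
    have hcr : 𝒩.Crosses a b := by
      by_contra hcr
      have h1 := hg a b hab hb hcr
      rcases (hf b hb a ha).1 h with h2 | h2
      · linarith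
      · omega
    rcases hcr with h1 | h1
    · exact h1.2
    · omega
  rw [← hYval, hYW, hWval]
  exact hW₀min X' hX' trivial

end SortingNetwork

/-! ### Greedy arrangements -/

namespace SortingNetwork

variable {𝒩 : SortingNetwork} {X : Finset ℕ}

/-- A position does not change its label before it takes part in a crossing. -/
theorem state_apply_eq_of_forall_level_ne {p t₁ t₂ : ℕ} (h12 : t₁ ≤ t₂)
    (h : ∀ s, t₁ ≤ s → s < t₂ → s ∈ X → p ≠ 𝒩.level s ∧ p ≠ 𝒩.level s + 1) :
    𝒩.state X t₂ p = 𝒩.state X t₁ p := by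
  induction t₂, h12 using Nat.le_induction with
  | base => rfl
  | succ t ht ih =>
    rw [← ih fun s h1 h2 => h s h1 (by omega)]
    by_cases htX : t ∈ X
    · obtain ⟨h1, h2⟩ := h t ht (by omega) htX
      rw [state_succ_of_mem htX, Equiv.Perm.mul_apply, Equiv.swap_apply_of_ne_of_ne h1 h2]
    · rw [state_succ_of_notMem htX]

/-- The greedy arrangement with prescribed contacts: outside of `C`, two pseudolines cross as soon
as they meet for the first time, and never again. -/
theorem exists_greedy (𝒩 : SortingNetwork) (C : Set ℕ) : ∃ X ⊆ 𝒩.active, 𝒩.IsReduced X ∧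
    (∀ t ∈ X, t ∉ C) ∧ ∀ t ∈ 𝒩.active, t ∉ X → t ∉ C →
      𝒩.state X t (𝒩.level t + 1) < 𝒩.state X t (𝒩.level t) := by
  classical
  have key : ∀ m, ∃ X ⊆ 𝒩.active, (∀ t ∈ X, t < m) ∧ 𝒩.IsReduced X ∧
      (∀ t ∈ X, t ∉ C) ∧ ∀ t ∈ 𝒩.active, t < m → t ∉ X → t ∉ C →
        𝒩.state X t (𝒩.level t + 1) < 𝒩.state X t (𝒩.level t) := by
    intro m
    induction m with
    | zero => exact ⟨∅, by simp, by simp, by simp [IsReduced], by simp, by simp⟩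
    | succ m ih =>
      obtain ⟨X, hX, hlt, hred, hXC, hc⟩ := ih
      by_cases hm : m ∈ 𝒩.active ∧ m ∉ C ∧
          𝒩.state X m (𝒩.level m) < 𝒩.state X m (𝒩.level m + 1)
      · obtain ⟨hma, hmC, hmlt⟩ := hm
        have hst : ∀ t ≤ m, 𝒩.state (insert m X) t = 𝒩.state X t := by
          intro t ht
          refine state_congr fun s hs => ?_
          have : s ≠ m := by omega
          simp [this]
        refine ⟨insert m X, ?_, ?_, ?_, ?_, ?_⟩
        · intro t ht
          rcases Finset.mem_insert.1 ht with rfl | ht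
          · exact hma
          · exact hX ht
        · intro t ht
          rcases Finset.mem_insert.1 ht with rfl | ht
          · omega
          · have := hlt t ht; omega
        · intro t ht
          rcases Finset.mem_insert.1 ht with rfl | ht
          · rwa [hst t le_rfl]
          · rw [hst t (hlt t ht).le]; exact hred t ht
        · intro t ht
          rcases Finset.mem_insert.1 ht with rfl | ht
          · exact hmC
          · exact hXC t ht
        · intro t hta htm htX htC
          have h1 : t ≠ m := by rintro rfl; simp at htX
          rw [hst t (by omega)]
          exact hc t hta (by omega) (fun h => htX (Finset.mem_insert_of_mem h)) htC
      · refine ⟨X, hX, fun t ht => (hlt t ht).trans (by omega), hred, hXC, ?_⟩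
        intro t hta htm htX htC
        by_cases h1 : t = m
        · subst h1
          have h2 : ¬ 𝒩.state X t (𝒩.level t) < 𝒩.state X t (𝒩.level t + 1) :=
            fun h => hm ⟨hta, htC, h⟩
          refine lt_of_le_of_ne (not_lt.1 h2) fun h => ?_
          have := (𝒩.state X t).injective h
          omega
        · exact hc t hta (by omega) htX htC
  obtain ⟨X, hX, -, hred, hXC, hc⟩ := key 𝒩.length
  exact ⟨X, hX, hred, hXC, fun t ht => hc t ht (𝒩.lt_length t ht)⟩

end SortingNetwork

namespace Multitriangulation

open SortingNetwork

/-! ### The network of the polygon -/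

/-- The permutation that reverses the positions `k, …, n - k - 1` and fixes all others. -/
def kernelPerm (n k : ℕ) : Equiv.Perm ℕ :=
  Function.Involutive.toPerm (fun p => if k ≤ p ∧ p + k < n then n - 1 - p else p) (by
    intro p
    dsimp only
    split_ifs <;> omega)

theorem kernelPerm_apply (n k p : ℕ) :
    kernelPerm n k p = if k ≤ p ∧ p + k < n then n - 1 - p else p := rfl

theorem kernelPerm_inv (n k : ℕ) : (kernelPerm n k)⁻¹ = kernelPerm n k :=
  Function.Involutive.toPerm_symm _

/-- The sorting network whose commutators are the grid points `(x, y)` with `x < y < n`. They are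
ordered column by column, and upwards in each column: the time of `(x, y)` is `x * n + y`. At this
time, the positions are, in this order: the horizontal lines at the heights `x + 1, …, y - 1`, to the
right of the column `x`; the vertical line of the column `x`, below `y`; the horizontal lines at the
heights `y, …, n - 1`, to the left of the column `x`; the vertical lines of the columns
`x - 1, …, 0`, above the grid. A horizontal line at height `x` is turned upwards at the diagonal point
`(x, x)`. -/
def polygonNetwork (n k : ℕ) : SortingNetwork where
  size := n
  length := n * n
  level t := t % n - t / n - 1
  active := (Finset.range (n * n)).filter fun t => t / n < t % n
  target := kernelPerm n k
  lt_length t ht := by simpa using (Finset.mem_filter.1 ht).1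
  level_lt t ht := by
    have h1 := (Finset.mem_filter.1 ht).2
    have h2 : 0 < n := by
      rcases Nat.eq_zero_or_pos n with rfl | h
      · simp at ht
      · exact h
    have h3 := Nat.mod_lt t h2
    generalize t % n = r at *
    generalize t / n = q at *
    omega

variable {n k : ℕ} {X : Finset ℕ}

theorem time_div {x y : ℕ} (hy : y < n) : (x * n + y) / n = x := by
  rw [mul_comm, Nat.mul_add_div (by omega), Nat.div_eq_of_lt hy, add_zero]

theorem time_mod {x y : ℕ} (hy : y < n) : (x * n + y) % n = y := by
  rw [mul_comm, Nat.mul_add_mod, Nat.mod_eq_of_lt hy]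

theorem time_lt {x y z : ℕ} (hx : x < z) (hy : y < n) : x * n + y < z * n := by
  have : (x + 1) * n ≤ z * n := Nat.mul_le_mul_right n hx
  rw [add_mul, one_mul] at this
  omega

theorem time_mem_active {x y : ℕ} (hxy : x < y) (hy : y < n) :
    x * n + y ∈ (polygonNetwork n k).active :=
  Finset.mem_filter.2 ⟨Finset.mem_range.2 (time_lt (hxy.trans hy) hy), by
    rwa [time_div hy, time_mod hy]⟩

theorem exists_of_mem_active {t : ℕ} (ht : t ∈ (polygonNetwork n k).active) :
    ∃ x y, x < y ∧ y < n ∧ t = x * n + y := by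
  have h1 := Finset.mem_filter.1 ht
  have hn : 0 < n := by
    rcases Nat.eq_zero_or_pos n with rfl | h
    · simp at h1
    · exact h
  exact ⟨t / n, t % n, h1.2, Nat.mod_lt t hn, by rw [mul_comm, Nat.div_add_mod]⟩

theorem level_time {x y : ℕ} (hy : y < n) : (polygonNetwork n k).level (x * n + y) = y - x - 1 := by
  change (x * n + y) % n - (x * n + y) / n - 1 = _
  rw [time_div hy, time_mod hy]

/-- The label of the beam that arrives at the grid point `(x, y)` from the left. -/
def fromLeft (n k : ℕ) (X : Finset ℕ) (x y : ℕ) : ℕ :=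
  (polygonNetwork n k).state X (x * n + y) (y - x)

/-- The label of the beam that arrives at the grid point `(x, y)` from below. -/
def fromBelow (n k : ℕ) (X : Finset ℕ) (x y : ℕ) : ℕ :=
  (polygonNetwork n k).state X (x * n + y) (y - x - 1)

theorem state_time_lower {x y : ℕ} (hy : y < n) :
    (polygonNetwork n k).state X (x * n + y) ((polygonNetwork n k).level (x * n + y)) =
      fromBelow n k X x y := by
  rw [level_time hy, fromBelow]

theorem state_time_upper {x y : ℕ} (hxy : x < y) (hy : y < n) :
    (polygonNetwork n k).state X (x * n + y) ((polygonNetwork n k).level (x * n + y) + 1) =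
      fromLeft n k X x y := by
  rw [level_time hy, fromLeft]
  congr 1
  omega

theorem fromLeft_zero (hX : X ⊆ (polygonNetwork n k).active) {y : ℕ} (hy : y < n) :
    fromLeft n k X 0 y = y := by
  unfold fromLeft
  rw [state_apply_eq_of_forall_level_ne (t₁ := 0) (Nat.zero_le _)]
  · simp [state]
  · intro s _ hs hsX
    have h1 : s < n := by omega
    have h2 := level_time (n := n) (k := k) (x := 0) h1
    rw [zero_mul, zero_add] at h2 hs
    have h3 := (Finset.mem_filter.1 (hX hsX)).2
    rw [Nat.div_eq_of_lt h1, Nat.mod_eq_of_lt h1] at h3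
    omega

theorem fromBelow_succ_self (hX : X ⊆ (polygonNetwork n k).active) {x : ℕ} (hx : x < n) :
    fromBelow n k X x (x + 1) = fromLeft n k X x x := by
  unfold fromBelow fromLeft
  have h1 : x * n + x ∉ X := by
    intro h
    have := (Finset.mem_filter.1 (hX h)).2
    rw [time_div hx, time_mod hx] at this
    omega
  rw [← add_assoc, state_succ_of_notMem h1]
  congr 1
  omega

theorem fromLeft_succ (hX : X ⊆ (polygonNetwork n k).active) {x y : ℕ} (hxy : x < y) (hy : y < n) :
    fromLeft n k X (x + 1) y = (polygonNetwork n k).state X (x * n + y + 1) (y - x - 1) := by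
  unfold fromLeft
  have h0 : (x + 1) * n = x * n + n := by ring
  rw [state_apply_eq_of_forall_level_ne (t₁ := x * n + y + 1) (by omega)]
  · congr 1
  · intro s h1 h2 hsX
    obtain ⟨u, v, huv, hv, rfl⟩ := exists_of_mem_active (hX hsX)
    rw [level_time hv]
    have hu : u = x ∧ y < v ∨ u = x + 1 ∧ v < y := by
      rcases lt_trichotomy u x with h | h | h
      · have := time_lt h hv; omega
      · subst h; left; omega
      · right
        rcases eq_or_lt_of_le (Nat.succ_le_of_lt h) with h | h
        · have : u = x + 1 := by omega
          subst this; omega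
        · have := time_lt (y := y) (show x + 1 < u from h) hy
          omega
    omega

theorem fromBelow_succ (x y : ℕ) :
    fromBelow n k X x (y + 1) = (polygonNetwork n k).state X (x * n + y + 1) (y - x) := by
  unfold fromBelow
  congr 1
  omega

/-- At a crossing, both beams go straight. -/
theorem fromBelow_succ_of_mem (hX : X ⊆ (polygonNetwork n k).active) {x y : ℕ} (hxy : x < y)
    (hy : y < n) (h : x * n + y ∈ X) :
    fromBelow n k X x (y + 1) = fromBelow n k X x y ∧
      fromLeft n k X (x + 1) y = fromLeft n k X x y := by
  rw [fromBelow_succ, fromLeft_succ hX hxy hy, state_succ_of_mem h, level_time hy]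
  have h1 : y - x - 1 + 1 = y - x := by omega
  simp only [Equiv.Perm.mul_apply, h1, Equiv.swap_apply_left, Equiv.swap_apply_right]
  exact ⟨rfl, rfl⟩

/-- At a contact, both beams are reflected. -/
theorem fromBelow_succ_of_notMem (hX : X ⊆ (polygonNetwork n k).active) {x y : ℕ} (hxy : x < y)
    (hy : y < n) (h : x * n + y ∉ X) :
    fromBelow n k X x (y + 1) = fromLeft n k X x y ∧
      fromLeft n k X (x + 1) y = fromBelow n k X x y := by
  rw [fromBelow_succ, fromLeft_succ hX hxy hy, state_succ_of_notMem h]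
  exact ⟨rfl, rfl⟩

/-- The beam which leaves the grid through the column `x` keeps its position afterwards. -/
theorem fromBelow_top_of_le (hX : X ⊆ (polygonNetwork n k).active) {x t : ℕ} (hx : x < n)
    (ht : (x + 1) * n ≤ t) :
    fromBelow n k X x n = (polygonNetwork n k).state X t (n - 1 - x) := by
  unfold fromBelow
  have h0 : (x + 1) * n = x * n + n := by ring
  rw [state_apply_eq_of_forall_level_ne (p := n - 1 - x) (t₁ := x * n + n) (t₂ := t) (h0 ▸ ht)]
  · congr 1
    omega
  · intro s h1 h2 hsX
    obtain ⟨u, v, huv, hv, rfl⟩ := exists_of_mem_active (hX hsX)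
    rw [level_time hv]
    have hu : x < u := by
      by_contra hcon
      have := time_lt (x := u) (z := x + 1) (by omega) hv
      omega
    omega

/-- The beam which leaves the grid through the column `x`. -/
theorem fromBelow_top (hX : X ⊆ (polygonNetwork n k).active) {x : ℕ} (hx : x < n) :
    fromBelow n k X x n = (polygonNetwork n k).state X (n * n) (n - 1 - x) :=
  fromBelow_top_of_le hX hx (Nat.mul_le_mul_right n hx)

theorem fromBelow_lt_fromLeft (hred : (polygonNetwork n k).IsReduced X) {x y : ℕ} (hxy : x < y) (hy : y < n)
    (h : x * n + y ∈ X) : fromBelow n k X x y < fromLeft n k X x y := by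
  have := hred _ h
  rwa [state_time_lower hy, state_time_upper hxy hy] at this

/-- Beams never go below their initial height, which is their label. -/
theorem fromLeft_le (hX : X ⊆ (polygonNetwork n k).active) {x y : ℕ} (hxy : x ≤ y) (hy : y < n) :
    fromLeft n k X x y ≤ y ∧ (x < y → fromBelow n k X x y < y) := by
  induction x generalizing y with
  | zero =>
    refine ⟨(fromLeft_zero hX hy).le, fun h => ?_⟩
    induction y, h using Nat.le_induction with
    | base =>
      rw [fromBelow_succ_self hX (by omega), fromLeft_zero hX (by omega)]
      omega
    | succ y h ih =>
      have ih := ih (by omega) (by omega)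
      by_cases hm : 0 * n + y ∈ X
      · rw [(fromBelow_succ_of_mem hX h (by omega) hm).1]; omega
      · rw [(fromBelow_succ_of_notMem hX h (by omega) hm).1, fromLeft_zero hX (by omega)]; omega
  | succ x ihx =>
    have hleft : ∀ y, x + 1 ≤ y → y < n → fromLeft n k X (x + 1) y ≤ y := by
      intro y hxy hy
      have h1 := ihx (y := y) (by omega) hy
      by_cases hm : x * n + y ∈ X
      · rw [(fromBelow_succ_of_mem hX hxy hy hm).2]; exact h1.1
      · rw [(fromBelow_succ_of_notMem hX hxy hy hm).2]; exact (h1.2 (by omega)).le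
    refine ⟨hleft y hxy hy, fun h => ?_⟩
    induction y, h using Nat.le_induction with
    | base =>
      rw [fromBelow_succ_self hX (by omega)]
      have := hleft (x + 1) le_rfl (by omega)
      omega
    | succ y h ih =>
      have ih := ih (by omega) (by omega)
      have h2 := hleft y (by omega) (by omega)
      by_cases hm : (x + 1) * n + y ∈ X
      · rw [(fromBelow_succ_of_mem hX h (by omega) hm).1]; omega
      · rw [(fromBelow_succ_of_notMem hX h (by omega) hm).1]; omega

/-! ### Crossings of edges and beams -/

/-- The number of the columns `u < x` in which a beam with a label at least `c` arrives at height
`y` from below. -/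
def upCount (n k : ℕ) (X : Finset ℕ) (c x y : ℕ) : ℕ :=
  ((Finset.range x).filter fun u => c ≤ fromBelow n k X u y).card

theorem upCount_succ_left (c x y : ℕ) : upCount n k X c (x + 1) y =
    upCount n k X c x y + if c ≤ fromBelow n k X x y then 1 else 0 := by
  unfold upCount
  rw [Finset.range_add_one, Finset.filter_insert]
  split_ifs
  · rw [Finset.card_insert_of_notMem (by simp)]
  · simp

theorem upCount_succ_right (hX : X ⊆ (polygonNetwork n k).active) {c x y : ℕ} (hxc : x ≤ c)
    (hcy : c ≤ y) (hy : y < n) : upCount n k X c x (y + 1) =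
      upCount n k X c x y + if fromLeft n k X x y < c then 1 else 0 := by
  induction x with
  | zero => simp [upCount, fromLeft_zero hX hy, hcy]
  | succ x ih =>
    rw [upCount_succ_left, upCount_succ_left, ih (by omega)]
    by_cases hm : x * n + y ∈ X
    · obtain ⟨h1, h2⟩ := fromBelow_succ_of_mem hX (by omega) hy hm
      rw [h1, h2]; ring
    · obtain ⟨h1, h2⟩ := fromBelow_succ_of_notMem hX (by omega) hy hm
      rw [h1, h2]
      split_ifs <;> omega

theorem upCount_base (hX : X ⊆ (polygonNetwork n k).active) {c x : ℕ} (hxc : x ≤ c) (hc : c < n) :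
    upCount n k X c x c = 0 := by
  unfold upCount
  rw [Finset.card_eq_zero]
  refine Finset.filter_false_of_mem fun u hu => ?_
  have := Finset.mem_range.1 hu
  have := (fromLeft_le hX (x := u) (y := c) (by omega) hc).2 (by omega)
  omega

/-- The edges of `D` are increasing in both coordinates. -/
def IsIncreasing (D : Finset (ℕ × ℕ)) : Prop :=
  ∀ e ∈ D, ∀ f ∈ D, e ≠ f → (e.1 < f.1 ∧ e.2 < f.2) ∨ (f.1 < e.1 ∧ f.2 < e.2)

/-- An increasing set of contacts is crossed by at least as many beams. -/
theorem card_le_upCount (hX : X ⊆ (polygonNetwork n k).active) {c : ℕ} {D : Finset (ℕ × ℕ)}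
    (hD : IsIncreasing D) {x y : ℕ} (hDX : ∀ e ∈ D, e.1 * n + e.2 ∉ X) (hxc : x ≤ c) (hcy : c ≤ y)
    (hy : y ≤ n) (hbox : ∀ e ∈ D, e.1 < x ∧ c ≤ e.2 ∧ e.2 < y) : D.card ≤ upCount n k X c x y := by
  induction x generalizing D y with
  | zero =>
    have : D = ∅ := Finset.eq_empty_of_forall_notMem fun e he => by
      have := (hbox e he).1; omega
    simp [this]
  | succ x ihx =>
    induction y, hcy using Nat.le_induction generalizing D with
    | base =>
      have : D = ∅ := Finset.eq_empty_of_forall_notMem fun e he => by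
        have := (hbox e he).2; omega
      simp [this]
    | succ y hcy ihy =>
      have hup := upCount_succ_right hX (x := x + 1) hxc hcy (by omega)
      have hleft := upCount_succ_left (n := n) (k := k) (X := X) c x (y + 1)
      by_cases hxy : (x, y) ∈ D
      · have hm : x * n + y ∉ X := hDX _ hxy
        obtain ⟨h1, h2⟩ := fromBelow_succ_of_notMem hX (by omega) (by omega) hm
        have h3 : (D.erase (x, y)).card ≤ upCount n k X c x y := by
          refine ihx (fun e he f hf => hD e (Finset.mem_of_mem_erase he) f
            (Finset.mem_of_mem_erase hf)) (fun e he => hDX e (Finset.mem_of_mem_erase he))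
            (by omega) hcy (by omega) fun e he => ?_
          have h4 := hD e (Finset.mem_of_mem_erase he) _ hxy (Finset.ne_of_mem_erase he)
          have h5 := hbox e (Finset.mem_of_mem_erase he)
          simp only at h4
          omega
        have h4 := Finset.card_erase_add_one hxy
        have h5 := upCount_succ_right hX (x := x) (by omega) hcy (by omega)
        rw [hleft, h1, h5]
        split_ifs <;> omega
      · by_cases h1 : ∀ e ∈ D, e.1 < x
        · have := ihx hD hDX (y := y + 1) (by omega) (by omega) hy
            fun e he => ⟨h1 e he, (hbox e he).2⟩
          omega
        · by_cases h2 : ∀ e ∈ D, e.2 < y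
          · have := ihy hD hDX (by omega) fun e he => ⟨(hbox e he).1, (hbox e he).2.1, h2 e he⟩
            omega
          · exfalso
            push Not at h1 h2
            obtain ⟨e, he, hex⟩ := h1
            obtain ⟨f, hf, hfy⟩ := h2
            have h3 := hbox e he
            have h4 := hbox f hf
            have hne : e ≠ f := by
              rintro rfl
              exact hxy (by
                have : e = (x, y) := Prod.ext (by omega) (by omega)
                rwa [← this])
            have := hD e he f hf hne
            omega

/-- If all contacts which are not in `T` take place after a crossing, then there is an increasing
subset of `T` with as many elements as there are beams passing from the left to the top. -/
theorem exists_card_eq_upCount (hX : X ⊆ (polygonNetwork n k).active)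
    (hred : (polygonNetwork n k).IsReduced X) {T : Finset (ℕ × ℕ)}
    (hT : ∀ x y, x < y → y < n → x * n + y ∉ X → (x, y) ∉ T →
      fromLeft n k X x y < fromBelow n k X x y) {c x y : ℕ} (hxc : x ≤ c) (hcy : c ≤ y)
    (hy : y ≤ n) (hc : c < n) : ∃ D ⊆ T, IsIncreasing D ∧ (∀ e ∈ D, e.1 < x ∧ c ≤ e.2 ∧ e.2 < y) ∧
      D.card = upCount n k X c x y := by
  induction x generalizing y with
  | zero => exact ⟨∅, by simp, by simp [IsIncreasing], by simp, by simp [upCount]⟩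
  | succ x ihx =>
    induction y, hcy using Nat.le_induction with
    | base => exact ⟨∅, by simp, by simp [IsIncreasing], by simp, by
        rw [upCount_base hX hxc hc, Finset.card_empty]⟩
    | succ y hcy ihy =>
      have hup := upCount_succ_right hX (x := x + 1) hxc hcy (by omega)
      have hleft := upCount_succ_left (n := n) (k := k) (X := X) c x (y + 1)
      have hup' := upCount_succ_right hX (x := x) (by omega) hcy (by omega)
      have hleft' := upCount_succ_left (n := n) (k := k) (X := X) c x y
      have hxlty : x < y := by omega
      have hyn : y < n := by omega
      have fromX : upCount n k X c (x + 1) (y + 1) = upCount n k X c x (y + 1) →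
          ∃ D ⊆ T, IsIncreasing D ∧ (∀ e ∈ D, e.1 < x + 1 ∧ c ≤ e.2 ∧ e.2 < y + 1) ∧
            D.card = upCount n k X c (x + 1) (y + 1) := by
        intro h
        obtain ⟨D, h1, h2, h3, h4⟩ := ihx (y := y + 1) (by omega) (by omega) hy
        exact ⟨D, h1, h2, fun e he => ⟨by have := h3 e he; omega, (h3 e he).2⟩, h4.trans h.symm⟩
      have fromY : upCount n k X c (x + 1) (y + 1) = upCount n k X c (x + 1) y →
          ∃ D ⊆ T, IsIncreasing D ∧ (∀ e ∈ D, e.1 < x + 1 ∧ c ≤ e.2 ∧ e.2 < y + 1) ∧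
            D.card = upCount n k X c (x + 1) (y + 1) := by
        intro h
        obtain ⟨D, h1, h2, h3, h4⟩ := ihy (by omega)
        exact ⟨D, h1, h2, fun e he => by have := h3 e he; omega, h4.trans h.symm⟩
      by_cases hm : x * n + y ∈ X
      · obtain ⟨h1, h2⟩ := fromBelow_succ_of_mem hX hxlty hyn hm
        have hlt := fromBelow_lt_fromLeft hred hxlty hyn hm
        by_cases hcb : c ≤ fromBelow n k X x y
        · refine fromY ?_
          rw [hup, h2, if_neg (by omega), add_zero]
        · refine fromX ?_
          rw [hleft, h1, if_neg hcb, add_zero]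
      · obtain ⟨h1, h2⟩ := fromBelow_succ_of_notMem hX hxlty hyn hm
        by_cases hxyT : (x, y) ∈ T
        · obtain ⟨D, hDT, hD, hbox, hcard⟩ := ihx (y := y) (by omega) hcy (by omega)
          have hnot : (x, y) ∉ D := fun h => by
            have := hbox _ h; simp at this
          refine ⟨insert (x, y) D, Finset.insert_subset hxyT hDT, ?_, ?_, ?_⟩
          · intro e he f hf hne
            rcases Finset.mem_insert.1 he with rfl | he' <;>
              rcases Finset.mem_insert.1 hf with rfl | hf'
            · exact absurd rfl hne
            · have := hbox f hf'; simp only; omega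
            · have := hbox e he'; simp only; omega
            · exact hD e he' f hf' hne
          · intro e he
            rcases Finset.mem_insert.1 he with rfl | he'
            · simp only; omega
            · have := hbox e he'; omega
          · rw [Finset.card_insert_of_notMem hnot, hcard, hleft, h1, hup']
            split_ifs <;> omega
        · have hlt := hT x y hxlty hyn hm hxyT
          by_cases hcl : fromLeft n k X x y < c
          · refine fromX ?_
            rw [hleft, h1, if_neg (by omega), add_zero]
          · refine fromY ?_
            rw [hup, h2, if_neg (by omega), add_zero]

end Multitriangulation

namespace Multitriangulation

open SortingNetwork

variable {n k : ℕ} {X : Finset ℕ} {T : Finset (ℕ × ℕ)}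

/-! ### Multitriangulations and pseudoline arrangements -/

theorem mem_edges {e : ℕ × ℕ} : e ∈ edges n ↔ e.1 < e.2 ∧ e.2 < n := by
  simp only [edges, Finset.mem_filter, Finset.mem_product, Finset.mem_range]
  omega

/-- The edges at which the beams touch. -/
def contactEdges (n : ℕ) (X : Finset ℕ) : Finset (ℕ × ℕ) :=
  (edges n).filter fun e => e.1 * n + e.2 ∉ X

/-- The times of the grid points which are not edges of `T`. -/
def crossingTimes (n k : ℕ) (T : Finset (ℕ × ℕ)) : Finset ℕ :=
  (polygonNetwork n k).active.filter fun t => (t / n, t % n) ∉ T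

theorem mem_contactEdges {x y : ℕ} :
    (x, y) ∈ contactEdges n X ↔ (x < y ∧ y < n) ∧ x * n + y ∉ X := by
  rw [contactEdges, Finset.mem_filter, mem_edges]

theorem crossingTimes_subset : crossingTimes n k T ⊆ (polygonNetwork n k).active :=
  Finset.filter_subset _ _

theorem time_mem_crossingTimes {x y : ℕ} (hxy : x < y) (hy : y < n) :
    x * n + y ∈ crossingTimes n k T ↔ (x, y) ∉ T := by
  rw [crossingTimes, Finset.mem_filter, time_div hy, time_mod hy]
  exact ⟨fun h => h.2, fun h => ⟨time_mem_active hxy hy, h⟩⟩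

theorem contactEdges_crossingTimes (hT : T ⊆ edges n) : contactEdges n (crossingTimes n k T) = T := by
  ext ⟨x, y⟩
  rw [mem_contactEdges]
  constructor
  · rintro ⟨⟨hxy, hy⟩, h⟩
    rw [time_mem_crossingTimes hxy hy] at h
    exact not_not.1 h
  · intro h
    obtain ⟨hxy, hy⟩ := mem_edges.1 (hT h)
    exact ⟨⟨hxy, hy⟩, by rw [time_mem_crossingTimes hxy hy]; exact not_not.2 h⟩

theorem crossingTimes_contactEdges (hX : X ⊆ (polygonNetwork n k).active) :
    crossingTimes n k (contactEdges n X) = X := by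
  ext t
  constructor
  · intro ht
    obtain ⟨x, y, hxy, hy, rfl⟩ := exists_of_mem_active (crossingTimes_subset ht)
    rw [time_mem_crossingTimes hxy hy, mem_contactEdges] at ht
    by_contra h
    exact ht ⟨⟨hxy, hy⟩, h⟩
  · intro ht
    obtain ⟨x, y, hxy, hy, rfl⟩ := exists_of_mem_active (hX ht)
    rw [time_mem_crossingTimes hxy hy, mem_contactEdges]
    exact fun h => h.2 ht

theorem isArrangement_state (hX : (polygonNetwork n k).IsArrangement X) :
    (polygonNetwork n k).state X (n * n) = kernelPerm n k := hX.state_length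

theorem fromBelow_top_eq (hX : (polygonNetwork n k).IsArrangement X) {x : ℕ} (hx : x < n) :
    fromBelow n k X x n = kernelPerm n k (n - 1 - x) := by
  rw [fromBelow_top hX.subset hx, isArrangement_state hX]

/-- The beams that leave the grid to the left of the column `c` and come from above `c` are those of
the `k` largest labels. -/
theorem upCount_top (hX : (polygonNetwork n k).IsArrangement X) {c : ℕ} (hkc : k ≤ c)
    (hcn : c + k ≤ n) : upCount n k X c c n = k := by
  unfold upCount
  have : (Finset.range c).filter (fun u => c ≤ fromBelow n k X u n) = Finset.range k := by
    ext u
    simp only [Finset.mem_filter, Finset.mem_range]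
    constructor
    · rintro ⟨h1, h2⟩
      rw [fromBelow_top_eq hX (by omega), kernelPerm_apply] at h2
      split_ifs at h2 <;> omega
    · intro h1
      refine ⟨by omega, ?_⟩
      rw [fromBelow_top_eq hX (by omega), kernelPerm_apply]
      split_ifs <;> omega
  rw [this, Finset.card_range]

theorem lt_of_pairwise_crosses {D : Finset (ℕ × ℕ)} (hD : D ⊆ edges n)
    (hc : (D : Set (ℕ × ℕ)).Pairwise Crosses) {e f : ℕ × ℕ} (he : e ∈ D) (hf : f ∈ D) :
    e.1 < f.2 := by
  by_cases hef : e = f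
  · subst hef; exact (mem_edges.1 (hD he)).1
  · have := hc he hf hef
    have := mem_edges.1 (hD he)
    unfold Crosses at *
    omega

theorem isIncreasing_of_pairwise_crosses {D : Finset (ℕ × ℕ)}
    (hc : (D : Set (ℕ × ℕ)).Pairwise Crosses) : IsIncreasing D := by
  intro e he f hf hne
  have := hc he hf hne
  unfold Crosses at this
  omega

/-- The contacts of an arrangement contain no `(k+1)`-crossing, since such a crossing would force
`k + 1` beams to pass from the left to the top. -/
theorem crossingFree_contactEdges (hX : (polygonNetwork n k).IsArrangement X) :
    CrossingFree (k + 1) (contactEdges n X) := by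
  intro D hD hc hcard
  have hDe : D ⊆ edges n := hD.trans (Finset.filter_subset _ _)
  have hinc := isIncreasing_of_pairwise_crosses hc
  have hne : D.Nonempty := Finset.card_pos.1 (by omega)
  obtain ⟨e₀, he₀, hmin⟩ := Finset.exists_min_image D Prod.snd hne
  set c := e₀.2 with hcdef
  have hlt : ∀ e ∈ D, e.1 < c := fun e he => lt_of_pairwise_crosses hDe hc he he₀
  have h1 : k + 1 ≤ c := by
    have := Finset.card_le_card_of_injOn (s := D) (t := Finset.range c) Prod.fst
      (fun e he => by simpa using hlt e he) (fun e he f hf h => by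
        by_contra hne
        have := hinc e he f hf hne
        omega)
    rwa [hcard, Finset.card_range] at this
  have h2 : k + 1 ≤ n - c := by
    have := Finset.card_le_card_of_injOn (s := D) (t := Finset.Ico c n) Prod.snd
      (fun e he => by
        have h3 := hmin e he
        have h4 := (mem_edges.1 (hDe he)).2
        simp only [Finset.coe_Ico, Set.mem_Ico]
        exact ⟨h3, h4⟩) (fun e he f hf h => by
        by_contra hne
        have := hinc e he f hf hne
        omega)
    rwa [hcard, Nat.card_Ico] at this
  have h3 := card_le_upCount (k := k) hX.subset (c := c) (x := c) (y := n) hinc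
    (fun e he => (Finset.mem_filter.1 (hD he)).2) le_rfl (by omega) le_rfl
    (fun e he => ⟨hlt e he, hmin e he, (mem_edges.1 (hDe he)).2⟩)
  rw [upCount_top hX (by omega) (by omega)] at h3
  omega

/-- A `(k+1)`-crossing contains `k`-relevant edges only: each of its other edges has an end on each
side. -/
theorem crossingFree_insert {e : ℕ × ℕ} (hT : T ⊆ edges n) (hfree : CrossingFree (k + 1) T)
    (he : e ∈ edges n) (hrel : ¬ IsRelevant n k e) : CrossingFree (k + 1) (insert e T) := by
  intro D hD hc hcard
  by_cases heD : e ∈ D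
  · apply hrel
    have hDe : D ⊆ edges n := hD.trans (Finset.insert_subset he hT)
    have hcard' : (D.erase e).card = k := by rw [Finset.card_erase_of_mem heD]; omega
    have hmem : ∀ f ∈ D.erase e, Crosses e f ∧ f.1 < f.2 ∧ f.2 < n := fun f hf =>
      ⟨hc heD (Finset.mem_of_mem_erase hf) (Finset.ne_of_mem_erase hf).symm,
        mem_edges.1 (hDe (Finset.mem_of_mem_erase hf))⟩
    have hpair : ∀ f ∈ D.erase e, ∀ g ∈ D.erase e, f ≠ g → Crosses f g := fun f hf g hg =>
      hc (Finset.mem_of_mem_erase hf) (Finset.mem_of_mem_erase hg)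
    have he' := mem_edges.1 he
    unfold Crosses at hmem hpair
    have h1 := Finset.card_le_card_of_injOn (s := D.erase e) (t := Finset.Ioo e.1 e.2)
      (fun f => if e.1 < f.1 then f.1 else f.2) (fun f hf => by
        have := hmem f hf
        simp only [Finset.coe_Ioo, Set.mem_Ioo]
        split_ifs <;> omega) (fun f hf g hg h => by
        by_contra hne
        have h1 := hpair f hf g hg hne
        have h2 := hmem f hf
        have h3 := hmem g hg
        simp only at h
        split_ifs at h <;> omega)
    have h2 := Finset.card_le_card_of_injOn (s := D.erase e)
      (t := Finset.range e.1 ∪ Finset.Ioo e.2 n)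
      (fun f => if e.1 < f.1 then f.2 else f.1) (fun f hf => by
        have := hmem f hf
        simp only [Finset.coe_union, Finset.coe_range, Finset.coe_Ioo, Set.mem_union, Set.mem_Iio,
          Set.mem_Ioo]
        split_ifs <;> omega) (fun f hf g hg h => by
        by_contra hne
        have h1 := hpair f hf g hg hne
        have h2 := hmem f hf
        have h3 := hmem g hg
        simp only at h
        split_ifs at h <;> omega)
    have h3 := h2.trans (Finset.card_union_le _ _)
    rw [hcard', Nat.card_Ioo] at h1
    rw [hcard', Finset.card_range, Nat.card_Ioo] at h3
    unfold IsRelevant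
    omega
  · refine hfree D (fun f hf => ?_) hc hcard
    rcases Finset.mem_insert.1 (hD hf) with rfl | h
    · exact absurd hf heD
    · exact h

/-- If all irrelevant edges are contacts, then no crossing moves the `k` lowest and the `k` highest
positions. -/
theorem state_outer (hX : X ⊆ (polygonNetwork n k).active)
    (hrel : ∀ x y, x < y → y < n → x * n + y ∈ X → IsRelevant n k (x, y)) (t : ℕ) {p : ℕ}
    (hp : p < k ∨ n ≤ p + k) : (polygonNetwork n k).state X t p = p := by
  rw [state_apply_eq_of_forall_level_ne (Nat.zero_le t)]
  · rfl
  · intro s _ _ hs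
    obtain ⟨x, y, hxy, hy, rfl⟩ := exists_of_mem_active (hX hs)
    have := hrel x y hxy hy hs
    rw [level_time hy]
    unfold IsRelevant at this
    simp only at this
    omega

/-- The greedy arrangement of the beams which touch at the edges of a set `T` without
`(k+1)`-crossing, containing all irrelevant edges, has the required endpoints. -/
theorem isArrangement_of_greedy (hk : 1 ≤ k) (hX : X ⊆ (polygonNetwork n k).active)
    (hred : (polygonNetwork n k).IsReduced X)
    (hTX : ∀ x y, x < y → y < n → x * n + y ∈ X → (x, y) ∉ T)
    (hT : ∀ x y, x < y → y < n → x * n + y ∉ X → (x, y) ∉ T →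
      fromLeft n k X x y < fromBelow n k X x y)
    (hfree : CrossingFree (k + 1) T)
    (hirr : ∀ e ∈ edges n, ¬ IsRelevant n k e → e ∈ T) :
    (polygonNetwork n k).IsArrangement X := by
  refine ⟨hX, ?_, hred⟩
  change (polygonNetwork n k).state X (n * n) = kernelPerm n k
  have houter : ∀ t {p : ℕ}, (p < k ∨ n ≤ p + k) → (polygonNetwork n k).state X t p = p := by
    refine fun t p => state_outer hX (fun x y hxy hy hm => ?_) t
    by_contra h
    exact hTX x y hxy hy hm (hirr _ (mem_edges.2 ⟨hxy, hy⟩) h)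
  -- Otherwise, `k + 1` beams would pass over the point `(x, x)`, forcing a `(k+1)`-crossing.
  have hle : ∀ x, k ≤ x → x + k < n → fromBelow n k X x n ≤ x := by
    intro x hkx hxn
    by_contra hcon
    obtain ⟨D, hDT, hinc, hbox, hcard⟩ := exists_card_eq_upCount hX hred hT
      (c := x + 1) (x := x + 1) (y := n) le_rfl (by omega) le_rfl (by omega)
    have h1 : k + 1 ≤ D.card := by
      rw [hcard]
      unfold upCount
      have h2 : insert x (Finset.range k) ⊆
          (Finset.range (x + 1)).filter fun u => x + 1 ≤ fromBelow n k X u n := by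
        intro u hu
        simp only [Finset.mem_filter, Finset.mem_range]
        rcases Finset.mem_insert.1 hu with rfl | hu
        · omega
        · have := Finset.mem_range.1 hu
          refine ⟨by omega, ?_⟩
          rw [fromBelow_top hX (by omega), houter _ (by omega)]
          omega
      have h3 := Finset.card_le_card h2
      rwa [Finset.card_insert_of_notMem (by simpa using hkx), Finset.card_range] at h3
    obtain ⟨D', hD', hcard'⟩ := Finset.exists_subset_card_eq h1
    refine hfree D' (hD'.trans hDT) ?_ hcard'
    intro e he f hf hne
    have h2 := hinc e (hD' he) f (hD' hf) hne
    have h3 := hbox e (hD' he)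
    have h4 := hbox f (hD' hf)
    unfold Crosses
    omega
  have hmid : ∀ x, k ≤ x → x + k < n → fromBelow n k X x n = x := by
    intro x
    induction x using Nat.strong_induction_on with
    | _ x ih =>
    intro hkx hxn
    have h1 := hle x hkx hxn
    by_contra hne
    rw [fromBelow_top hX (by omega)] at h1 hne
    set z := (polygonNetwork n k).state X (n * n) (n - 1 - x) with hz
    by_cases hzk : z < k
    · have h2 := houter (n * n) (Or.inl hzk)
      have h3 := ((polygonNetwork n k).state X (n * n)).injective (h2.trans hz)
      omega
    · have h2 := ih z (by omega) (by omega) (by omega)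
      rw [fromBelow_top hX (by omega)] at h2
      have h3 := ((polygonNetwork n k).state X (n * n)).injective (h2.trans hz)
      omega
  ext p
  rw [kernelPerm_apply]
  split_ifs with h
  · have h1 := hmid (n - 1 - p) (by omega) (by omega)
    rw [fromBelow_top hX (by omega)] at h1
    rw [← h1]
    congr 1
    omega
  · exact houter _ (by omega)

/-- A greedy arrangement for the contacts of a set of edges. -/
theorem exists_greedy_edges (n k : ℕ) (T : Finset (ℕ × ℕ)) :
    ∃ X ⊆ (polygonNetwork n k).active, (polygonNetwork n k).IsReduced X ∧
      (∀ x y, x < y → y < n → x * n + y ∈ X → (x, y) ∉ T) ∧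
      ∀ x y, x < y → y < n → x * n + y ∉ X → (x, y) ∉ T →
        fromLeft n k X x y < fromBelow n k X x y := by
  obtain ⟨X, hX, hred, h1, h2⟩ := exists_greedy (polygonNetwork n k) {t | (t / n, t % n) ∈ T}
  refine ⟨X, hX, hred, ?_, ?_⟩
  · intro x y hxy hy hm
    have := h1 _ hm
    simpa [time_div hy, time_mod hy] using this
  · intro x y hxy hy hm hxyT
    have := h2 _ (time_mem_active hxy hy) hm (by simpa [time_div hy, time_mod hy] using hxyT)
    rwa [state_time_lower hy, state_time_upper hxy hy] at this

theorem IsKTriangulation.mem_of_not_isRelevant (hT : IsKTriangulation n k T) {e : ℕ × ℕ}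
    (he : e ∈ edges n) (hrel : ¬ IsRelevant n k e) : e ∈ T := by
  have h1 := hT.2 (y := insert e T) ⟨Finset.insert_subset he hT.1.1,
    crossingFree_insert hT.1.1 hT.1.2 he hrel⟩ (Finset.subset_insert e T)
  exact h1 (Finset.mem_insert_self e T)

/-- The non-edges of a `k`-triangulation are the crossings of a pseudoline arrangement. -/
theorem IsKTriangulation.isArrangement (hk : 1 ≤ k) (hT : IsKTriangulation n k T) :
    (polygonNetwork n k).IsArrangement (crossingTimes n k T) := by
  obtain ⟨X, hX, hred, hTX, hc⟩ := exists_greedy_edges n k T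
  have harr := isArrangement_of_greedy hk hX hred hTX hc hT.1.2
    (fun e he => hT.mem_of_not_isRelevant he)
  have hsub : T ⊆ contactEdges n X := by
    rintro ⟨x, y⟩ h
    obtain ⟨hxy, hy⟩ := mem_edges.1 (hT.1.1 h)
    exact mem_contactEdges.2 ⟨⟨hxy, hy⟩, fun hm => hTX x y hxy hy hm h⟩
  have heq : T = contactEdges n X :=
    Finset.Subset.antisymm hsub (hT.2 ⟨Finset.filter_subset _ _, crossingFree_contactEdges harr⟩ hsub)
  rw [heq, crossingTimes_contactEdges hX]
  exact harr

/-- The contacts of an arrangement form a `k`-triangulation, since all arrangements have the same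
number of crossings. -/
theorem isKTriangulation_contactEdges (hk : 1 ≤ k) (hX : (polygonNetwork n k).IsArrangement X) :
    IsKTriangulation n k (contactEdges n X) := by
  classical
  refine ⟨⟨Finset.filter_subset _ _, crossingFree_contactEdges hX⟩, ?_⟩
  intro S hS hle
  -- Extend `S` to a maximal set; it has as many non-edges as `X`.
  obtain ⟨S', hSS', hS'⟩ : ∃ S', S ≤ S' ∧
      Maximal (fun S => S ⊆ edges n ∧ CrossingFree (k + 1) S) S' := by
    have hfin : {S | S ⊆ edges n ∧ CrossingFree (k + 1) S}.Finite :=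
      (Finset.finite_toSet (edges n).powerset).subset fun S hS => by simpa using hS.1
    exact hfin.exists_le_maximal hS
  have h1 := IsKTriangulation.isArrangement hk hS'
  have h2 : crossingTimes n k S' ⊆ X := by
    intro t ht
    obtain ⟨x, y, hxy, hy, rfl⟩ := exists_of_mem_active (crossingTimes_subset ht)
    rw [time_mem_crossingTimes hxy hy] at ht
    by_contra h
    exact ht (hSS' (hle (mem_contactEdges.2 ⟨⟨hxy, hy⟩, h⟩)))
  have h3 : crossingTimes n k S' = X := Finset.eq_of_subset_of_card_le h2 (by
    rw [h1.card_eq, hX.card_eq])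
  have h4 : S' = contactEdges n X := by
    rw [← h3, contactEdges_crossingTimes hS'.1.1]
  rw [← h4]
  exact hSS'

end Multitriangulation

namespace Multitriangulation

open SortingNetwork

variable {n k : ℕ} {X : Finset ℕ}

/-! ### The course of a beam -/

theorem isRelevant_of_time_mem (hk : 1 ≤ k) (hX : (polygonNetwork n k).IsArrangement X) {x y : ℕ}
    (hxy : x < y) (hy : y < n) (h : x * n + y ∈ X) : IsRelevant n k (x, y) := by
  by_contra hrel
  have := (isKTriangulation_contactEdges hk hX).mem_of_not_isRelevant (mem_edges.2 ⟨hxy, hy⟩) hrel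
  exact (mem_contactEdges.1 this).2 h

/-- The beams with a label `p < k` or `n - k ≤ p` never cross another beam, and keep the position
`p`. -/
theorem state_eq_self (hk : 1 ≤ k) (hX : (polygonNetwork n k).IsArrangement X) (t : ℕ) {p : ℕ}
    (hp : p < k ∨ n ≤ p + k) : (polygonNetwork n k).state X t p = p :=
  state_outer hX.subset (fun _ _ hxy hy hm => isRelevant_of_time_mem hk hX hxy hy hm) t hp

/-- The beams of the stars have positions from `k` to `n - k - 1` only. -/
theorem le_of_state_eq (hk : 1 ≤ k) (hX : (polygonNetwork n k).IsArrangement X) {t p c : ℕ}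
    (h : (polygonNetwork n k).state X t p = c) (hkc : k ≤ c) (hcn : c + k < n) :
    k ≤ p ∧ p + k < n := by
  by_contra hcon
  have := state_eq_self hk hX t (p := p) (by omega)
  omega

/-- No mirror met before the height `y` in the column `x` affects the beam that arrives from the
left at this height. -/
theorem fromLeft_eq_state (hX : X ⊆ (polygonNetwork n k).active) {x y : ℕ} (hxy : x ≤ y)
    (hy : y < n) : fromLeft n k X x y = (polygonNetwork n k).state X (x * n) (y - x) := by
  unfold fromLeft
  refine state_apply_eq_of_forall_level_ne (by omega) fun s h1 h2 hs => ?_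
  obtain ⟨u, v, huv, hv, rfl⟩ := exists_of_mem_active (hX hs)
  rw [level_time hv]
  have hu : u = x ∧ v < y := by
    rcases lt_trichotomy u x with h | rfl | h
    · have := time_lt h hv; omega
    · omega
    · have := time_lt h hy; omega
  omega

theorem fromBelow_top_eq_iff (hX : (polygonNetwork n k).IsArrangement X) {c x : ℕ} (hkc : k ≤ c)
    (hcn : c + k < n) (hx : x < n) : fromBelow n k X x n = c ↔ x = c := by
  rw [fromBelow_top_eq hX hx, kernelPerm_apply]
  split_ifs <;> omega

/-- After its exit through the column `c`, the beam `c` has a constant position. -/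
theorem pos_of_lt (hX : (polygonNetwork n k).IsArrangement X) {c x : ℕ} (hkc : k ≤ c)
    (hcn : c + k < n) (hcx : c < x) : (polygonNetwork n k).pos X (x * n) c = n - 1 - c := by
  rw [pos_eq_iff, ← fromBelow_top_of_le hX.subset (by omega) (Nat.mul_le_mul_right n hcx)]
  exact (fromBelow_top_eq_iff hX hkc hcn (by omega)).2 rfl

/-- Between its start and its exit, a beam arrives at the column `x` at a single height. -/
theorem fromLeft_eq_iff (hk : 1 ≤ k) (hX : (polygonNetwork n k).IsArrangement X) {c x y : ℕ}
    (hkc : k ≤ c) (hcn : c + k < n) (hy : y < n) : fromLeft n k X x y = c ↔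
      x ≤ c ∧ x < y ∧ (polygonNetwork n k).pos X (x * n) c = y - x := by
  constructor
  · intro h
    have h1 := (le_of_state_eq hk hX h hkc hcn).1
    rw [fromLeft_eq_state hX.subset (by omega) hy, ← pos_eq_iff] at h
    refine ⟨?_, by omega, h⟩
    by_contra hcx
    rw [pos_of_lt hX hkc hcn (by omega)] at h
    omega
  · rintro ⟨-, h1, h2⟩
    rw [fromLeft_eq_state hX.subset h1.le hy, ← pos_eq_iff, h2]

/-- The part of the course of the beam `c` in the column `x`: going upwards from the height `z`, it
is reflected by the next mirror, if there is one. -/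
theorem fromBelow_cases (hX : (polygonNetwork n k).IsArrangement X) {c x z : ℕ} (hxc : x ≤ c)
    (hcz : c ≤ z) (hxz : x < z) (hz : z ≤ n) (h : fromBelow n k X x z = c) :
    (∃ y, z ≤ y ∧ (x, y) ∈ contactEdges n X ∧ (∀ v, z ≤ v → v < y → (x, v) ∉ contactEdges n X) ∧
      fromBelow n k X x y = c ∧ fromLeft n k X (x + 1) y = c ∧
      upCount n k X c (x + 1) y = upCount n k X c x z + 1) ∨
    ((∀ v, z ≤ v → (x, v) ∉ contactEdges n X) ∧ fromBelow n k X x n = c ∧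
      upCount n k X c x n = upCount n k X c x z) := by
  induction hd : n - z generalizing z with
  | zero =>
    obtain rfl : z = n := by omega
    exact Or.inr ⟨fun v hv h => by have := (mem_contactEdges.1 h).1; omega, h, rfl⟩
  | succ d ih =>
    replace hz : z < n := by omega
    by_cases hm : x * n + z ∈ X
    · obtain ⟨h1, h2⟩ := fromBelow_succ_of_mem hX.subset hxz hz hm
      have hlt := fromBelow_lt_fromLeft hX.reduced hxz hz hm
      have hup := upCount_succ_right hX.subset hxc hcz hz
      rw [if_neg (by omega), add_zero] at hup
      have hnot : (x, z) ∉ contactEdges n X := fun h3 => (mem_contactEdges.1 h3).2 hm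
      rcases ih (by omega) (by omega) (by omega) (h1.trans h) (by omega) with ⟨y, h3, h4, h5, h6⟩ | ⟨h3, h4, h5⟩
      · refine Or.inl ⟨y, by omega, h4, fun v hv1 hv2 => ?_, by rwa [hup] at h6⟩
        rcases eq_or_lt_of_le hv1 with rfl | hv1
        · exact hnot
        · exact h5 v hv1 hv2
      · refine Or.inr ⟨fun v hv => ?_, h4, by rw [h5, hup]⟩
        rcases eq_or_lt_of_le hv with rfl | hv
        · exact hnot
        · exact h3 v hv
    · obtain ⟨h1, h2⟩ := fromBelow_succ_of_notMem hX.subset hxz hz hm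
      refine Or.inl ⟨z, le_rfl, mem_contactEdges.2 ⟨⟨hxz, hz⟩, hm⟩, by omega, h, h2.trans h, ?_⟩
      rw [upCount_succ_left, if_pos h.ge]

/-- The course of the beam `c` in the column `x`, at which it arrives from the left. -/
theorem fromLeft_cases (hk : 1 ≤ k) (hX : (polygonNetwork n k).IsArrangement X) {c x y : ℕ}
    (hkc : k ≤ c) (hcn : c + k < n) (hy : y < n) (h : fromLeft n k X x y = c) :
    ((x, y) ∉ contactEdges n X ∧ fromLeft n k X (x + 1) y = c ∧
      upCount n k X c (x + 1) y = upCount n k X c x y) ∨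
    ((x, y) ∈ contactEdges n X ∧ ∃ y', y < y' ∧ (x, y') ∈ contactEdges n X ∧
      (∀ v, y < v → v < y' → (x, v) ∉ contactEdges n X) ∧
      fromBelow n k X x y' = c ∧ fromLeft n k X (x + 1) y' = c ∧
      upCount n k X c (x + 1) y' = upCount n k X c x y + 1) ∨
    ((x, y) ∈ contactEdges n X ∧ (∀ v, y < v → (x, v) ∉ contactEdges n X) ∧ x = c ∧
      upCount n k X c x y = k) := by
  obtain ⟨hxc, hxy, -⟩ := (fromLeft_eq_iff hk hX hkc hcn hy).1 h
  have hcy : c ≤ y := h ▸ (fromLeft_le hX.subset hxy.le hy).1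
  by_cases hm : x * n + y ∈ X
  · left
    have hlt := fromBelow_lt_fromLeft hX.reduced hxy hy hm
    refine ⟨fun h3 => (mem_contactEdges.1 h3).2 hm,
      (fromBelow_succ_of_mem hX.subset hxy hy hm).2.trans h, ?_⟩
    rw [upCount_succ_left, if_neg (by omega), add_zero]
  · right
    have hmem : (x, y) ∈ contactEdges n X := mem_contactEdges.2 ⟨⟨hxy, hy⟩, hm⟩
    have hup := upCount_succ_right hX.subset hxc hcy hy
    rw [if_neg (by omega), add_zero] at hup
    rcases fromBelow_cases hX hxc (by omega) (by omega) hy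
      ((fromBelow_succ_of_notMem hX.subset hxy hy hm).1.trans h) with
      ⟨y', h3, h4, h5, h6, h7, h8⟩ | ⟨h3, h4, h5⟩
    · exact Or.inl ⟨hmem, y', h3, h4, h5, h6, h7, by rw [h8, hup]⟩
    · have hx := (fromBelow_top_eq_iff hX hkc hcn (by omega)).1 h4
      refine Or.inr ⟨hmem, h3, hx, ?_⟩
      rw [← hup, ← h5, hx, upCount_top hX hkc (by omega)]

/-- The description of the heights of the beams by the network. -/
theorem beamHeight_cases (hk : 1 ≤ k) (hX : (polygonNetwork n k).IsArrangement X) {c : ℕ}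
    (hkc : k ≤ c) (hcn : c + k < n) (x : ℕ) :
    (c < x ∧ beamHeight (contactEdges n X) c x = ⊤) ∨
      ∃ y < n, beamHeight (contactEdges n X) c x = (y : WithTop ℕ) ∧ fromLeft n k X x y = c := by
  induction x with
  | zero => exact Or.inr ⟨c, by omega, rfl, fromLeft_zero hX.subset (by omega)⟩
  | succ x ih =>
    rcases ih with ⟨h1, h2⟩ | ⟨y, hy, h1, h2⟩
    · exact Or.inl ⟨by omega, by rw [beamHeight, h2]; rfl⟩
    · rw [beamHeight, h1]
      change (_ ∧ (if (x, y) ∈ contactEdges n X then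
        (((contactEdges n X).filter fun e => e.1 = x ∧ y < e.2).image Prod.snd).min
        else (y : WithTop ℕ)) = _) ∨ ∃ z < n, (if (x, y) ∈ contactEdges n X then
        (((contactEdges n X).filter fun e => e.1 = x ∧ y < e.2).image Prod.snd).min
        else (y : WithTop ℕ)) = _ ∧ _
      rcases fromLeft_cases hk hX hkc hcn hy h2 with
        ⟨h3, h4, -⟩ | ⟨h3, y', h4, h5, h6, -, h7, -⟩ | ⟨h3, h4, h5, -⟩
      · exact Or.inr ⟨y, hy, if_neg h3, h4⟩
      · refine Or.inr ⟨y', (mem_contactEdges.1 h5).1.2, ?_, h7⟩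
        rw [if_pos h3]
        apply le_antisymm
        · exact Finset.min_le (Finset.mem_image.2 ⟨(x, y'), by simp [h5, h4], rfl⟩)
        · refine Finset.le_min fun v hv => ?_
          obtain ⟨⟨u, v'⟩, hu, rfl⟩ := Finset.mem_image.1 hv
          obtain ⟨hu1, rfl, hu2⟩ := Finset.mem_filter.1 hu
          by_contra hcon
          exact h6 v' hu2 (by simpa using hcon) hu1
      · refine Or.inl ⟨by omega, ?_⟩
        rw [if_pos h3, Finset.min_eq_top, Finset.image_eq_empty]
        refine Finset.filter_false_of_mem ?_
        rintro ⟨u, v⟩ hu ⟨rfl, hv⟩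
        exact h4 v hv hu

theorem beamHeight_eq_iff (hk : 1 ≤ k) (hX : (polygonNetwork n k).IsArrangement X) {c : ℕ}
    (hkc : k ≤ c) (hcn : c + k < n) {x y : ℕ} (hy : y < n) :
    beamHeight (contactEdges n X) c x = (y : WithTop ℕ) ↔ fromLeft n k X x y = c := by
  rcases beamHeight_cases hk hX hkc hcn x with ⟨h1, h2⟩ | ⟨z, hz, h1, h2⟩
  · rw [h2, fromLeft_eq_iff hk hX hkc hcn hy]
    exact ⟨fun h => absurd h (WithTop.top_ne_coe), fun h => by omega⟩
  · rw [h1]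
    constructor
    · intro h
      have : z = y := by exact_mod_cast h
      rwa [← this]
    · intro h
      have h3 := (fromLeft_eq_iff hk hX hkc hcn hy).1 h
      have h4 := (fromLeft_eq_iff hk hX hkc hcn hz).1 h2
      have : z = y := by omega
      rw [this]

theorem beamHeight_le_succ (T : Finset (ℕ × ℕ)) (c x : ℕ) :
    beamHeight T c x ≤ beamHeight T c (x + 1) := by
  rw [beamHeight]
  generalize beamHeight T c x = z
  induction z using WithTop.recTopCoe with
  | top => exact le_rfl
  | coe z =>
    change (z : WithTop ℕ) ≤ if (x, z) ∈ T then
      ((T.filter fun e => e.1 = x ∧ z < e.2).image Prod.snd).min else (z : WithTop ℕ)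
    split_ifs
    · refine Finset.le_min fun v hv => ?_
      obtain ⟨e, he, rfl⟩ := Finset.mem_image.1 hv
      exact WithTop.coe_le_coe.2 (Finset.mem_filter.1 he).2.2.le
    · exact le_rfl

/-- The beam `c` is reflected upwards at the mirrors at which it arrives from the left. -/
theorem liesAbove_iff (hk : 1 ≤ k) (hX : (polygonNetwork n k).IsArrangement X) {c : ℕ}
    (hkc : k ≤ c) (hcn : c + k < n) {x y : ℕ} (h : (x, y) ∈ contactEdges n X) :
    LiesAbove (contactEdges n X) c (x, y) ↔ fromLeft n k X x y = c := by
  rw [← beamHeight_eq_iff hk hX hkc hcn (mem_contactEdges.1 h).1.2]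
  exact ⟨fun h1 => h1.2, fun h1 => ⟨h, h1⟩⟩

theorem fromLeft_ne_fromBelow {x y : ℕ} (hxy : x < y) : fromLeft n k X x y ≠ fromBelow n k X x y := by
  intro h
  have := ((polygonNetwork n k).state X (x * n + y)).injective h
  omega

/-- The beam `c` is reflected to the right at the mirrors at which it arrives from below. -/
theorem liesBelow_iff (hk : 1 ≤ k) (hX : (polygonNetwork n k).IsArrangement X) {c : ℕ}
    (hkc : k ≤ c) (hcn : c + k < n) {x y : ℕ} (h : (x, y) ∈ contactEdges n X) :
    LiesBelow (contactEdges n X) c (x, y) ↔ fromBelow n k X x y = c := by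
  obtain ⟨⟨hxy, hy⟩, hm⟩ := mem_contactEdges.1 h
  rw [← (fromBelow_succ_of_notMem hX.subset hxy hy hm).2,
    ← beamHeight_eq_iff hk hX hkc hcn hy]
  refine ⟨fun h1 => h1.2.2, fun h1 => ⟨h, lt_of_le_of_ne (h1 ▸ beamHeight_le_succ _ _ _) ?_, h1⟩⟩
  intro h2
  rw [beamHeight_eq_iff hk hX hkc hcn hy, (fromBelow_succ_of_notMem hX.subset hxy hy hm).2] at h1
  rw [beamHeight_eq_iff hk hX hkc hcn hy] at h2
  exact fromLeft_ne_fromBelow hxy (h2.trans h1.symm)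

end Multitriangulation

namespace Multitriangulation

open SortingNetwork

variable {n k : ℕ} {X : Finset ℕ}

/-! ### The stars -/

/-- The corners of the beam `c` in the columns to the left of `x`, where it arrives at the height
`y`: it goes up from `(xs a, ys a)` to `(xs a, ys (a + 1))`, for `a < r`, and no other mirror reflects it there. -/
structure IsCourse (T : Finset (ℕ × ℕ)) (n k : ℕ) (X : Finset ℕ) (c x y r : ℕ)
    (xs ys : ℕ → ℕ) : Prop where
  start : ys 0 = c
  last : ys r = y
  xs_lt : ∀ a < r, xs a < x
  xs_mono : ∀ a b, a < b → b < r → xs a < xs b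
  ys_mono : ∀ a b, a < b → b ≤ r → ys a < ys b
  lower_mem : ∀ a < r, (xs a, ys a) ∈ T
  upper_mem : ∀ a < r, (xs a, ys (a + 1)) ∈ T
  eq_lower : ∀ u v, u < x → (u, v) ∈ T → fromLeft n k X u v = c → ∃ a < r, u = xs a ∧ v = ys a
  eq_upper : ∀ u v, u < x → (u, v) ∈ T → fromBelow n k X u v = c →
    ∃ a < r, u = xs a ∧ v = ys (a + 1)

/-- The number of the corners before the column `x` is the number of the columns to the left of `x`
in which a beam with a label at least `c` arrives at the height `y` from below: it increases by one
whenever the beam `c` is reflected to the right, and does not change at its crossings. -/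
theorem exists_isCourse (hk : 1 ≤ k) (hX : (polygonNetwork n k).IsArrangement X) {c : ℕ}
    (hkc : k ≤ c) (hcn : c + k < n) {x : ℕ} (hxc : x ≤ c) :
    ∃ y < n, fromLeft n k X x y = c ∧
      ∃ xs ys, IsCourse (contactEdges n X) n k X c x y (upCount n k X c x y) xs ys := by
  have hinj : ∀ {u v w}, v < n → w < n → fromLeft n k X u v = c → fromLeft n k X u w = c →
      v = w := by
    intro u v w hv hw h1 h2
    have h3 := (fromLeft_eq_iff hk hX hkc hcn hv).1 h1
    have h4 := (fromLeft_eq_iff hk hX hkc hcn hw).1 h2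
    omega
  induction x with
  | zero =>
    refine ⟨c, by omega, fromLeft_zero hX.subset (by omega), fun _ => 0, fun _ => c, ?_⟩
    rw [show upCount n k X c 0 c = 0 by simp [upCount]]
    constructor <;> simp
    omega
  | succ x ih =>
    obtain ⟨y, hy, h1, xs, ys, hcr⟩ := ih (by omega)
    have hout : ∀ {v}, (x, v) ∈ contactEdges n X → fromBelow n k X x v = c →
        fromLeft n k X (x + 1) v = c := by
      intro v hv h
      obtain ⟨⟨hxv, hvn⟩, hm⟩ := mem_contactEdges.1 hv
      exact (fromBelow_succ_of_notMem hX.subset hxv hvn hm).2.trans h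
    rcases fromLeft_cases hk hX hkc hcn hy h1 with
      ⟨h3, h4, hup⟩ | ⟨h3, y', h4, h5, h6, -, h7, hup⟩ | ⟨-, -, h5, -⟩
    · refine ⟨y, hy, h4, xs, ys, ?_⟩
      rw [hup]
      refine ⟨hcr.start, hcr.last, fun a ha => (hcr.xs_lt a ha).trans (by omega), hcr.xs_mono,
        hcr.ys_mono, hcr.lower_mem, hcr.upper_mem, fun u v hu huv h => ?_, fun u v hu huv h => ?_⟩
      · rcases Nat.lt_succ_iff_lt_or_eq.1 hu with hu | rfl
        · exact hcr.eq_lower u v hu huv h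
        · rw [hinj hy (mem_contactEdges.1 huv).1.2 h1 h] at h3
          exact absurd huv h3
      · rcases Nat.lt_succ_iff_lt_or_eq.1 hu with hu | rfl
        · exact hcr.eq_upper u v hu huv h
        · rw [hinj hy (mem_contactEdges.1 huv).1.2 h4 (hout huv h)] at h3
          exact absurd huv h3
    · have hy'n := (mem_contactEdges.1 h5).1.2
      set r := upCount n k X c x y with hr
      refine ⟨y', hy'n, h7, Function.update xs r x, Function.update ys (r + 1) y', ?_⟩
      rw [hup]
      have hxs : ∀ a < r, Function.update xs r x a = xs a := fun a ha =>
        Function.update_of_ne (by omega) _ _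
      have hys : ∀ a ≤ r, Function.update ys (r + 1) y' a = ys a := fun a ha =>
        Function.update_of_ne (by omega) _ _
      have hxr : Function.update xs r x r = x := Function.update_self ..
      have hyr : Function.update ys (r + 1) y' (r + 1) = y' := Function.update_self ..
      have hlt : ∀ a < r + 1, a < r ∨ a = r := fun a ha => by omega
      constructor
      · rw [hys 0 (by omega), hcr.start]
      · exact hyr
      · intro a ha
        rcases hlt a ha with ha | rfl
        · rw [hxs a ha]; have := hcr.xs_lt a ha; omega
        · rw [hxr]; omega
      · intro a b hab hb
        rw [hxs a (by omega)]
        rcases hlt b hb with hb | rfl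
        · rw [hxs b hb]; exact hcr.xs_mono a b hab hb
        · rw [hxr]; exact hcr.xs_lt a hab
      · intro a b hab hb
        rw [hys a (by omega)]
        rcases Nat.le_succ_iff.1 hb with hb | rfl
        · rw [hys b hb]; exact hcr.ys_mono a b hab hb
        · rw [hyr]
          rcases hlt a hab with ha | ha
          · have := hcr.ys_mono a r ha le_rfl
            rw [hcr.last] at this
            omega
          · rw [ha, hcr.last]; exact h4
      · intro a ha
        rcases hlt a ha with ha | rfl
        · rw [hxs a ha, hys a ha.le]; exact hcr.lower_mem a ha
        · rw [hxr, hys _ le_rfl, hcr.last]; exact h3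
      · intro a ha
        rcases hlt a ha with ha | rfl
        · rw [hxs a ha, hys (a + 1) ha]; exact hcr.upper_mem a ha
        · rw [hxr, hyr]; exact h5
      · intro u v hu huv h
        rcases Nat.lt_succ_iff_lt_or_eq.1 hu with hu | rfl
        · obtain ⟨a, ha, h8, h9⟩ := hcr.eq_lower u v hu huv h
          exact ⟨a, by omega, by rwa [hxs a ha], by rwa [hys a ha.le]⟩
        · refine ⟨r, by omega, hxr.symm, ?_⟩
          rw [hys r le_rfl, hcr.last]
          exact hinj (mem_contactEdges.1 huv).1.2 hy h h1
      · intro u v hu huv h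
        rcases Nat.lt_succ_iff_lt_or_eq.1 hu with hu | rfl
        · obtain ⟨a, ha, h8, h9⟩ := hcr.eq_upper u v hu huv h
          exact ⟨a, by omega, by rwa [hxs a ha], by rwa [hys (a + 1) ha]⟩
        · refine ⟨r, by omega, hxr.symm, ?_⟩
          rw [hyr]
          exact hinj (mem_contactEdges.1 huv).1.2 hy'n (hout huv h) h7
    · omega

/-- All mirrors that reflect the beam of a star are edges of this star. The columns of the corners of the beam
before its exit are the `k` first vertices of the star, its heights are the `k + 1` last ones. -/
theorem isEdgeOfStar (hk : 1 ≤ k) (hX : (polygonNetwork n k).IsArrangement X) {i : ℕ}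
    (hi : i < n - 2 * k) {x y : ℕ} (hxy : (x, y) ∈ contactEdges n X)
    (h : fromLeft n k X x y = k + i ∨ fromBelow n k X x y = k + i) :
    IsEdgeOfStar k (contactEdges n X) i (x, y) := by
  have hkc : k ≤ k + i := by omega
  have hcn : k + i + k < n := by omega
  obtain ⟨z, hz, h1, xs, ys, hcr⟩ := exists_isCourse hk hX hkc hcn le_rfl
  obtain ⟨hzT, hzk⟩ : (k + i, z) ∈ contactEdges n X ∧ upCount n k X (k + i) (k + i) z = k := by
    rcases fromLeft_cases hk hX hkc hcn hz h1 with ⟨-, h4, -⟩ | ⟨-, y', -, h5, -, -, h4, -⟩ |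
      ⟨h3, -, -, h4⟩
    · have := (fromLeft_eq_iff hk hX hkc hcn hz).1 h4; omega
    · have := (fromLeft_eq_iff hk hX hkc hcn (mem_contactEdges.1 h5).1.2).1 h4; omega
    · exact ⟨h3, h4⟩
  rw [hzk] at hcr
  set s : Fin (2 * k + 1) → ℕ := fun a => if a.1 < k then xs a.1 else ys (a.1 - k) with hs
  have hsx : ∀ (a : ℕ) (h : a < 2 * k + 1), a < k → s ⟨a, h⟩ = xs a := fun a _ h => if_pos h
  have hsy : ∀ (a b : ℕ) (h : a < 2 * k + 1), a = k + b → s ⟨a, h⟩ = ys b := by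
    rintro a b h rfl
    simp [hs]
  have hedge : ∀ e, IsStarEdge k s e ↔ (∃ a < k, e = (xs a, ys a)) ∨ (∃ a < k, e = (xs a, ys (a + 1)))
      ∨ e = (k + i, z) := by
    intro e
    constructor
    · rintro ⟨⟨a, ha⟩, ⟨b, hb⟩, hab | hab, rfl⟩
      · simp only at hab
        by_cases hak : a < k
        · exact Or.inl ⟨a, hak, by rw [hsx a ha hak, hsy b a hb (by omega)]⟩
        · refine Or.inr (Or.inr ?_)
          rw [hsy a 0 ha (by omega), hsy b k hb (by omega), hcr.start, hcr.last]
      · simp only at hab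
        exact Or.inr (Or.inl ⟨a, by omega, by
          rw [hsx a ha (by omega), hsy b (a + 1) hb (by omega)]⟩)
    · rintro (⟨a, ha, rfl⟩ | ⟨a, ha, rfl⟩ | rfl)
      · exact ⟨⟨a, by omega⟩, ⟨a + k, by omega⟩, Or.inl rfl, by
          rw [hsx a _ ha, hsy (a + k) a _ (by omega)]⟩
      · exact ⟨⟨a, by omega⟩, ⟨a + k + 1, by omega⟩, Or.inr rfl, by
          rw [hsx a _ ha, hsy (a + k + 1) (a + 1) _ (by omega)]⟩
      · exact ⟨⟨k, by omega⟩, ⟨k + k, by omega⟩, Or.inl rfl, by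
          rw [hsy k 0 _ (by omega), hsy (k + k) k _ (by omega), hcr.start, hcr.last]⟩
  refine ⟨s, ⟨?_, ?_⟩, ?_, ?_⟩
  · rintro ⟨a, ha⟩ ⟨b, hb⟩ hab
    have hab : a < b := hab
    by_cases hbk : b < k
    · rw [hsx a ha (by omega), hsx b hb hbk]
      exact hcr.xs_mono a b hab hbk
    · rw [hsy b (b - k) hb (by omega)]
      by_cases hak : a < k
      · rw [hsx a ha hak]
        have h2 := hcr.xs_lt a hak
        have h3 : ys 0 ≤ ys (b - k) := by
          rcases Nat.eq_zero_or_pos (b - k) with h | h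
          · rw [h]
          · exact (hcr.ys_mono 0 _ h (by omega)).le
        rw [hcr.start] at h3
        omega
      · rw [hsy a (a - k) ha (by omega)]
        exact hcr.ys_mono _ _ (by omega) (by omega)
  · intro e he
    rcases (hedge e).1 he with ⟨a, ha, rfl⟩ | ⟨a, ha, rfl⟩ | rfl
    · exact hcr.lower_mem a ha
    · exact hcr.upper_mem a ha
    · exact hzT
  · rw [hsy k 0 _ (by omega), hcr.start]
  · rw [hedge]
    have hyn := (mem_contactEdges.1 hxy).1
    rcases h with h | h
    · have hx := (fromLeft_eq_iff hk hX hkc hcn hyn.2).1 h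
      rcases eq_or_lt_of_le hx.1 with rfl | hxc
      · have h3 := (fromLeft_eq_iff hk hX hkc hcn hz).1 h1
        have : y = z := by omega
        exact Or.inr (Or.inr (by rw [this]))
      · obtain ⟨a, ha, rfl, rfl⟩ := hcr.eq_lower x y hxc hxy h
        exact Or.inl ⟨a, ha, rfl⟩
    · have h2 := (fromBelow_succ_of_notMem hX.subset hyn.1 hyn.2 (mem_contactEdges.1 hxy).2).2
      have hx := (fromLeft_eq_iff hk hX hkc hcn hyn.2).1 (h2.trans h)
      obtain ⟨a, ha, rfl, rfl⟩ := hcr.eq_upper x y (by omega) hxy h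
      exact Or.inr (Or.inl ⟨a, ha, rfl⟩)

/-- The arcs of the oriented dual multigraph are the contacts of two beams. -/
theorem dualMultigraph_adj_iff (hk : 1 ≤ k) (hX : (polygonNetwork n k).IsArrangement X)
    (i j : Fin (n - 2 * k)) : (dualMultigraph n k (contactEdges n X)).Adj i j ↔
      ∃ t, (polygonNetwork n k).IsContact X t (k + i) (k + j) := by
  have hi := i.2
  have hj := j.2
  constructor
  · rintro ⟨⟨x, y⟩, -, -, -, h1, h2⟩
    obtain ⟨⟨hxy, hy⟩, hm⟩ := mem_contactEdges.1 h1.1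
    rw [liesBelow_iff hk hX (by omega) (by omega) h1.1] at h1
    rw [liesAbove_iff hk hX (by omega) (by omega) h2.1] at h2
    exact ⟨x * n + y, time_mem_active hxy hy, hm, by rw [state_time_lower hy, h1],
      by rw [state_time_upper hxy hy, h2]⟩
  · rintro ⟨t, ht, hm, h1, h2⟩
    obtain ⟨x, y, hxy, hy, rfl⟩ := exists_of_mem_active ht
    rw [state_time_lower hy] at h1
    rw [state_time_upper hxy hy] at h2
    have h3 := le_of_state_eq hk hX h1 (by omega) (by omega)
    have h4 := le_of_state_eq hk hX h2 (by omega) (by omega)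
    have hmem : (x, y) ∈ contactEdges n X := mem_contactEdges.2 ⟨⟨hxy, hy⟩, hm⟩
    refine ⟨(x, y), ⟨?_, ?_⟩, isEdgeOfStar hk hX hi hmem (Or.inr h1),
      isEdgeOfStar hk hX hj hmem (Or.inl h2), (liesBelow_iff hk hX (by omega) (by omega) hmem).2 h1,
      (liesAbove_iff hk hX (by omega) (by omega) hmem).2 h2⟩
    · simp only; omega
    · simp only; omega

/-! ### The beam vector -/

/-- The times between the columns of the grid. -/
def columnTimes (n : ℕ) : Finset ℕ := (Finset.range n).image fun x => (x + 1) * n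

theorem separates_columnTimes (n k : ℕ) : (polygonNetwork n k).Separates (columnTimes n) := by
  intro X hX t₁ h₁ t₂ h₂ hlt heq
  obtain ⟨x₁, y₁, hxy₁, hy₁, rfl⟩ := exists_of_mem_active h₁
  obtain ⟨x₂, y₂, hxy₂, hy₂, rfl⟩ := exists_of_mem_active h₂
  by_cases hx : x₁ < x₂
  · refine ⟨(x₁ + 1) * n, Finset.mem_image_of_mem _ (Finset.mem_range.2 (by omega)),
      time_lt (Nat.lt_succ_self _) hy₁, ?_⟩
    have := Nat.mul_le_mul_right n (Nat.succ_le_of_lt hx)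
    rw [Nat.succ_eq_add_one] at this
    omega
  · exfalso
    obtain rfl : x₁ = x₂ := by
      by_contra hne
      have := time_lt (y := y₂) (show x₂ < x₁ by omega) hy₂
      omega
    rw [level_time hy₁, level_time hy₂] at heq
    set σ := (polygonNetwork n k).state X (x₁ * n + y₁) with hσ
    set ρ := (polygonNetwork n k).state X (x₁ * n + y₂) with hρ
    -- The lower one of the two beams leaving the first meeting is not met again in this column.
    obtain ⟨e, he, heσ⟩ : ∃ e, ρ (y₁ - x₁ - 1) = e ∧ (e = σ (y₁ - x₁ - 1) ∨ e = σ (y₁ - x₁ - 1 + 1)) := by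
      refine ⟨_, rfl, ?_⟩
      rw [hρ, state_apply_eq_of_forall_level_ne (t₁ := x₁ * n + y₁ + 1) (by omega)]
      · by_cases hm : x₁ * n + y₁ ∈ X
        · rw [state_succ_of_mem hm, level_time hy₁, Equiv.Perm.mul_apply, Equiv.swap_apply_left]
          exact Or.inr rfl
        · rw [state_succ_of_notMem hm]
          exact Or.inl rfl
      · intro s hs1 hs2 hs
        obtain ⟨u, v, huv, hv, rfl⟩ := exists_of_mem_active (hX hs)
        rw [level_time hv]
        have hu : u = x₁ ∧ y₁ < v := by
          rcases lt_trichotomy u x₁ with h | rfl | h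
          · have := time_lt h hv; omega
          · omega
          · have := time_lt h hy₂; omega
        omega
    have hne : Equiv.swap (σ (y₁ - x₁ - 1)) (σ (y₁ - x₁ - 1 + 1)) e ≠ e := by
      rcases heσ with rfl | rfl
      · rw [Equiv.swap_apply_left]
        intro h
        have := σ.injective h
        omega
      · rw [Equiv.swap_apply_right]
        intro h
        have := σ.injective h
        omega
    rw [heq] at hne
    refine hne (Equiv.swap_apply_of_ne_of_ne ?_ ?_) <;> rw [← he] <;> intro h <;>
      have := ρ.injective h <;> omega

theorem posSum_columnTimes (X : Finset ℕ) (hn : 0 < n) (c : ℕ) :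
    (polygonNetwork n k).posSum (columnTimes n) X c =
      ∑ x ∈ Finset.range n, ((polygonNetwork n k).pos X ((x + 1) * n) c : ℝ) := by
  unfold posSum columnTimes
  rw [Finset.sum_image]
  intro a _ b _ h
  have := Nat.eq_of_mul_eq_mul_right hn h
  omega

/-- The number of unit squares below the beam `c` in the column `x`. -/
theorem card_filter_le_beamHeight (hk : 1 ≤ k) (hX : (polygonNetwork n k).IsArrangement X) {c x : ℕ}
    (hkc : k ≤ c) (hcn : c + k < n) (hxc : x < c) :
    (((Finset.Ico c (n - 1)).filter fun y => ((y + 1 : ℕ) : WithTop ℕ) ≤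
      beamHeight (contactEdges n X) c (x + 1)).card : ℝ) =
      (polygonNetwork n k).pos X ((x + 1) * n) c + (x + 1 - c) := by
  rcases beamHeight_cases hk hX hkc hcn (x + 1) with ⟨h1, -⟩ | ⟨z, hz, h1, h2⟩
  · omega
  · obtain ⟨h3, h4, h5⟩ := (fromLeft_eq_iff hk hX hkc hcn hz).1 h2
    have hcz : c ≤ z := h2 ▸ (fromLeft_le hX.subset h4.le hz).1
    rw [h1, h5]
    have : (Finset.Ico c (n - 1)).filter (fun y => ((y + 1 : ℕ) : WithTop ℕ) ≤ (z : WithTop ℕ)) =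
        Finset.Ico c z := by
      ext y
      have : ((y + 1 : ℕ) : WithTop ℕ) ≤ (z : WithTop ℕ) ↔ y + 1 ≤ z := WithTop.coe_le_coe
      rw [Finset.mem_filter, this]
      simp only [Finset.mem_Ico]
      omega
    rw [this, Nat.card_Ico, Nat.cast_sub hcz, Nat.cast_sub h4.le]
    push_cast
    ring

/-- Up to a constant, the area below a beam is the sum of its positions. -/
theorem beamArea_eq (hk : 1 ≤ k) (hX : (polygonNetwork n k).IsArrangement X) {c : ℕ}
    (hkc : k ≤ c) (hcn : c + k < n) : (beamArea n (contactEdges n X) c : ℝ) =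
      (polygonNetwork n k).posSum (columnTimes n) X c +
        (∑ x ∈ Finset.range c, ((x : ℝ) + 1 - c) - ∑ _x ∈ Finset.Ico c n, ((n - 1 - c : ℕ) : ℝ)) := by
  have h1 : (beamArea n (contactEdges n X) c : ℝ) = ∑ x ∈ Finset.range c,
      ((polygonNetwork n k).pos X ((x + 1) * n) c + ((x : ℝ) + 1 - c)) := by
    unfold beamArea
    rw [← Finset.sum_congr rfl fun x hx =>
      card_filter_le_beamHeight hk hX hkc hcn (Finset.mem_range.1 hx)]
    rw [Finset.card_filter, Finset.sum_product]
    push_cast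
    refine Finset.sum_congr rfl fun x _ => ?_
    rw [Finset.card_filter]
    push_cast
    rfl
  have h2 := Finset.sum_range_add_sum_Ico
    (fun x => ((polygonNetwork n k).pos X ((x + 1) * n) c : ℝ)) (show c ≤ n by omega)
  rw [h1, posSum_columnTimes X (by omega), ← h2, Finset.sum_add_distrib]
  have h3 : ∑ x ∈ Finset.Ico c n, ((polygonNetwork n k).pos X ((x + 1) * n) c : ℝ) =
      ∑ _x ∈ Finset.Ico c n, ((n - 1 - c : ℕ) : ℝ) := Finset.sum_congr rfl fun x hx => by
    rw [pos_of_lt hX hkc hcn (by have := Finset.mem_Ico.1 hx; omega)]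
  rw [h3]
  ring

theorem beamVector_sub (hk : 1 ≤ k) {X' : Finset ℕ} (hX : (polygonNetwork n k).IsArrangement X)
    (hX' : (polygonNetwork n k).IsArrangement X') (i : Fin (n - 2 * k)) :
    (beamVector n k (contactEdges n X') - beamVector n k (contactEdges n X)) i =
      (polygonNetwork n k).posSum (columnTimes n) X' (k + i) -
        (polygonNetwork n k).posSum (columnTimes n) X (k + i) := by
  have hi := i.2
  simp only [Pi.sub_apply, beamVector]
  rw [beamArea_eq hk hX (by omega) (by omega), beamArea_eq hk hX' (by omega) (by omega)]
  ring

end Multitriangulation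

namespace Multitriangulation

open SortingNetwork

variable {n k : ℕ} {X X' : Finset ℕ}

/-! ### The cone of the beam polytope -/

/-- Exactly the beams of the stars cross, any two of them. -/
theorem crosses_polygonNetwork_iff {i j : ℕ} : (polygonNetwork n k).Crosses i j ↔
    i ≠ j ∧ (k ≤ i ∧ i + k < n) ∧ (k ≤ j ∧ j + k < n) := by
  unfold SortingNetwork.Crosses
  rw [show (polygonNetwork n k).target = kernelPerm n k from rfl, kernelPerm_inv,
    kernelPerm_apply, kernelPerm_apply]
  split_ifs <;> omega

/-- A function of the labels of the stars, extended to all labels: it is larger on the labels which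
are too small, and smaller on those which are too large. -/
def extend (n k : ℕ) (g : Fin (n - 2 * k) → ℝ) (c : ℕ) : ℝ :=
  if c < k then ∑ i, |g i| else if h : c - k < n - 2 * k then g ⟨c - k, h⟩ else -∑ i, |g i|

theorem extend_add (g : Fin (n - 2 * k) → ℝ) (i : Fin (n - 2 * k)) :
    extend n k g (k + i) = g i := by
  have hi := i.2
  unfold extend
  rw [if_neg (by omega), dif_pos (by omega)]
  congr 1
  ext
  simp

theorem isCompatible_extend (g : Fin (n - 2 * k) → ℝ) :
    (polygonNetwork n k).IsCompatible (extend n k g) := by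
  have habs : ∀ i, |g i| ≤ ∑ i, |g i| := fun i =>
    Finset.single_le_sum (f := fun i => |g i|) (fun _ _ => abs_nonneg _) (Finset.mem_univ i)
  have h0 : 0 ≤ ∑ i, |g i| := Finset.sum_nonneg fun _ _ => abs_nonneg _
  intro i j hij hj hcr
  rw [crosses_polygonNetwork_iff] at hcr
  unfold extend
  split_ifs with h1 h2 h3 h4 h5 h6 h7
  · exact le_rfl
  · omega
  · omega
  · exact (le_abs_self _).trans (habs _)
  · omega
  · omega
  · linarith
  · exact neg_le_of_abs_le (habs _)
  · exact le_rfl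

theorem sum_range_eq_sum_fin (hn : 2 * k ≤ n) {F : ℕ → ℝ} (hF : ∀ c, c < k ∨ n ≤ c + k → F c = 0) :
    ∑ c ∈ Finset.range n, F c = ∑ i : Fin (n - 2 * k), F (k + i) := by
  rw [Fin.sum_univ_eq_sum_range (fun i => F (k + i)), show n - 2 * k = n - k - k by omega,
    ← Finset.sum_Ico_eq_sum_range]
  symm
  refine Finset.sum_subset (fun c hc => ?_) fun c hc1 hc2 => hF c ?_
  · have := Finset.mem_Ico.1 hc
    exact Finset.mem_range.2 (by omega)
  · have := Finset.mem_range.1 hc1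
    rw [Finset.mem_Ico] at hc2
    omega

/-- A function that does not increase along the arcs of the dual multigraph of `T` is minimized over
all beam vectors by that of `T`. -/
theorem beamVector_sub_dotProduct_nonneg (hk : 1 ≤ k) (hn : 2 * k ≤ n)
    (hX : (polygonNetwork n k).IsArrangement X) (hX' : (polygonNetwork n k).IsArrangement X')
    {g : Fin (n - 2 * k) → ℝ}
    (hg : ∀ i j, (dualMultigraph n k (contactEdges n X)).Adj i j → g j ≤ g i) :
    0 ≤ (beamVector n k (contactEdges n X') - beamVector n k (contactEdges n X)) ⬝ᵥ g := by
  have h1 := hX.sum_mul_posSum_le (separates_columnTimes n k) hX' (isCompatible_extend g) ?_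
  · rw [← sub_nonneg, ← Finset.sum_sub_distrib] at h1
    change 0 ≤ ∑ c ∈ Finset.range n, _ at h1
    rw [sum_range_eq_sum_fin hn] at h1
    · refine h1.trans_eq (Finset.sum_congr rfl fun i _ => ?_)
      rw [beamVector_sub hk hX hX', extend_add]
      ring
    · intro c hc
      have : ∀ {Y}, (polygonNetwork n k).IsArrangement Y →
          (polygonNetwork n k).posSum (columnTimes n) Y c = ∑ s ∈ columnTimes n, (c : ℝ) :=
        fun hY => Finset.sum_congr rfl fun s _ => by rw [pos_eq_iff.2 (state_eq_self hk hY s hc)]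
      rw [this hX, this hX', sub_self]
  · intro t i j hc
    by_cases hcr : (polygonNetwork n k).Crosses i j
    · obtain ⟨-, hi, hj⟩ := crosses_polygonNetwork_iff.1 hcr
      obtain ⟨i, rfl⟩ := Nat.exists_eq_add_of_le hi.1
      obtain ⟨j, rfl⟩ := Nat.exists_eq_add_of_le hj.1
      have hi' : i < n - 2 * k := by omega
      have hj' : j < n - 2 * k := by omega
      have h1 := extend_add g ⟨i, hi'⟩
      have h2 := extend_add g ⟨j, hj'⟩
      simp only at h1 h2
      rw [h1, h2]
      exact hg _ _ ((dualMultigraph_adj_iff hk hX _ _).2 ⟨t, hc⟩)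
    · exact isCompatible_extend g i j (hX.contact_lt hc hcr) (hc.lt_size hX.subset).2 hcr

/-- A flip of a relevant edge moves the beam vector in the direction of the arc of this edge. -/
theorem exists_beamVector_sub_eq (hk : 1 ≤ k) (hX : (polygonNetwork n k).IsArrangement X)
    {i j : Fin (n - 2 * k)} (h : (dualMultigraph n k (contactEdges n X)).Adj i j) :
    ∃ X', (polygonNetwork n k).IsArrangement X' ∧ ∃ A : ℝ, 0 < A ∧
      beamVector n k (contactEdges n X') - beamVector n k (contactEdges n X) =
        A • (Pi.single i 1 - Pi.single j 1) := by
  obtain ⟨t, ht⟩ := (dualMultigraph_adj_iff hk hX i j).1 h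
  have hi := i.2
  have hj := j.2
  obtain ⟨X', hX', ⟨A, hA, hsum⟩, -⟩ := ht.exists_flip (separates_columnTimes n k) hX
    (crosses_polygonNetwork_iff.2 ⟨ht.ne, by omega, by omega⟩)
  refine ⟨X', hX', A, hA, funext fun l => ?_⟩
  rw [beamVector_sub hk hX hX', hsum, add_sub_cancel_left]
  have h1 : ∀ m : Fin (n - 2 * k), (k + (l : ℕ) = k + m) = (l = m) := fun m => by
    rw [Nat.add_left_cancel_iff, Fin.ext_iff]
  simp only [h1, Pi.smul_apply, Pi.sub_apply, Pi.single_apply, smul_eq_mul]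

/-- The `k`-triangulations are the contact sets of the arrangements of the polygon network. -/
theorem isKTriangulation_iff (hk : 1 ≤ k) {T : Finset (ℕ × ℕ)} : IsKTriangulation n k T ↔
    ∃ X, (polygonNetwork n k).IsArrangement X ∧ T = contactEdges n X := by
  constructor
  · intro hT
    exact ⟨_, hT.isArrangement hk, (contactEdges_crossingTimes hT.1.1).symm⟩
  · rintro ⟨X, hX, rfl⟩
    exact isKTriangulation_contactEdges hk hX

theorem beamVector_mem (hk : 1 ≤ k) (hX : (polygonNetwork n k).IsArrangement X) :
    beamVector n k (contactEdges n X) ∈ beamPolytope n k :=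
  subset_convexHull ℝ _ ⟨_, isKTriangulation_contactEdges hk hX, rfl⟩

theorem coneAt_beamPolytope (hk : 1 ≤ k) (hn : 2 * k ≤ n)
    (hX : (polygonNetwork n k).IsArrangement X) :
    ConvexPolytope.coneAt (beamPolytope n k) (beamVector n k (contactEdges n X)) =
      (dualMultigraph n k (contactEdges n X)).incidenceCone := by
  set G := dualMultigraph n k (contactEdges n X) with hG
  set p := beamVector n k (contactEdges n X) with hp
  apply le_antisymm
  · refine Submodule.span_le.2 ?_
    rintro _ ⟨x, hx, rfl⟩
    have hconv : Convex ℝ {x : Fin (n - 2 * k) → ℝ | x - p ∈ G.incidenceCone} := by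
      intro x hx y hy a b ha hb hab
      have h1 : a • x + b • y - p = a • (x - p) + b • (y - p) := by
        rw [smul_sub, smul_sub, ← add_sub_add_comm, ← add_smul, hab, one_smul]
      change a • x + b • y - p ∈ G.incidenceCone
      rw [h1]
      exact G.incidenceCone.add_mem (G.incidenceCone.smul_mem ha hx)
        (G.incidenceCone.smul_mem hb hy)
    refine convexHull_min ?_ hconv hx
    rintro _ ⟨T', hT', rfl⟩
    obtain ⟨X', hX', rfl⟩ := (isKTriangulation_iff hk).1 hT'
    exact G.mem_incidenceCone_iff.2 fun g hg =>
      beamVector_sub_dotProduct_nonneg hk hn hX hX' hg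
  · refine Submodule.span_le.2 ?_
    rintro _ ⟨i, j, hij, rfl⟩
    obtain ⟨X', hX', A, hA, h1⟩ := exists_beamVector_sub_eq hk hX hij
    have h2 : (Pi.single i 1 - Pi.single j 1 : Fin (n - 2 * k) → ℝ) =
        A⁻¹ • (beamVector n k (contactEdges n X') - p) := by
      rw [h1, smul_smul, inv_mul_cancel₀ hA.ne', one_smul]
    rw [h2]
    exact (ConvexPolytope.coneAt (beamPolytope n k) p).smul_mem (inv_nonneg.2 hA.le)
      (ConvexPolytope.sub_mem_coneAt (beamVector_mem hk hX'))

/-! ### Connectivity of the dual multigraph -/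

/-- There is a `k`-triangulation whose dual multigraph contains a path through all nodes: the greedy
one, where the beams cross as soon as they meet. -/
theorem exists_forall_adj (hk : 1 ≤ k) (hn : 2 * k + 1 ≤ n) :
    ∃ X, (polygonNetwork n k).IsArrangement X ∧ ∀ i j : Fin (n - 2 * k), (i : ℕ) = j + 1 →
      (dualMultigraph n k (contactEdges n X)).Adj i j := by
  classical
  set T := (edges n).filter fun e => ¬ IsRelevant n k e with hT
  obtain ⟨X, hX, hred, hTX, hc⟩ := exists_greedy_edges n k T
  have hfree : CrossingFree (k + 1) (∅ : Finset (ℕ × ℕ)) := by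
    intro D hD _
    rw [Finset.subset_empty.1 hD, Finset.card_empty]
    omega
  have hfreeT : ∀ S : Finset (ℕ × ℕ), S ⊆ T → CrossingFree (k + 1) S := by
    intro S
    induction S using Finset.induction_on with
    | empty => exact fun _ => hfree
    | insert e S _ ih =>
      intro hS
      rw [Finset.insert_subset_iff] at hS
      obtain ⟨h1, h2⟩ := Finset.mem_filter.1 hS.1
      exact crossingFree_insert (hS.2.trans (Finset.filter_subset _ _)) (ih hS.2) h1 h2
  have harr := isArrangement_of_greedy hk hX hred hTX hc (hfreeT T subset_rfl)
    fun e he hrel => Finset.mem_filter.2 ⟨he, hrel⟩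
  have hirr : ∀ x y, x < y → y < n → (y ≤ x + k ∨ n ≤ y - x + k) → x * n + y ∉ X := by
    intro x y hxy hy h hm
    refine hTX x y hxy hy hm (Finset.mem_filter.2 ⟨mem_edges.2 ⟨hxy, hy⟩, ?_⟩)
    unfold IsRelevant
    simp only
    omega
  have hrel : ∀ x y, x + k < y → y < n → y - x + k < n → fromBelow n k X x y < fromLeft n k X x y →
      x * n + y ∈ X := by
    intro x y hxy hy h hlt
    by_contra hm
    have := hc x y (by omega) hy hm fun h1 => (Finset.mem_filter.1 h1).2
      ⟨by simp only; omega, by simp only; omega⟩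
    omega
  -- In the column `x`, the beam `x + k` goes up to the height `n - k`, across all others.
  have hcol : ∀ x, x + k < n - k → (∀ y, x + k ≤ y → y < n - k → fromLeft n k X x y = y) →
      ∀ y, x + k + 1 ≤ y → y ≤ n - k → fromBelow n k X x y = x + k := by
    intro x hx hleft y hy
    induction y, hy using Nat.le_induction with
    | base =>
      intro _
      rw [(fromBelow_succ_of_notMem hX (by omega) (by omega)
        (hirr x (x + k) (by omega) (by omega) (by omega))).1]
      exact hleft _ le_rfl hx
    | succ y hy ih =>
      intro hyn
      have h1 := ih (by omega)
      have h2 := hleft y (by omega) (by omega)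
      rw [(fromBelow_succ_of_mem hX (by omega) (by omega)
        (hrel x y (by omega) (by omega) (by omega) (by omega))).1, h1]
  have hmain : ∀ x, x + k < n - k → (∀ y, x + k ≤ y → y < n - k → fromLeft n k X x y = y) ∧
      (1 ≤ x → fromLeft n k X x (n - k) = x + k - 1) := by
    intro x
    induction x with
    | zero => exact fun _ => ⟨fun y _ hy => fromLeft_zero hX (by omega), by omega⟩
    | succ x ih =>
      intro hx
      obtain ⟨h1, h2⟩ := ih (by omega)
      have h3 := hcol x (by omega) h1
      constructor
      · intro y hxy hy
        have h4 := h3 y (by omega) (by omega)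
        have h5 := h1 y (by omega) hy
        rw [(fromBelow_succ_of_mem hX (by omega) (by omega)
          (hrel x y (by omega) (by omega) (by omega) (by omega))).2, h5]
      · intro _
        have h4 := h3 (n - k) (by omega) le_rfl
        have hm : x * n + (n - k) ∉ X := by
          rcases Nat.eq_zero_or_pos x with rfl | hx0
          · exact hirr 0 (n - k) (by omega) (by omega) (by omega)
          · intro hm
            have := fromBelow_lt_fromLeft hred (by omega) (by omega) hm
            rw [h4, h2 hx0] at this
            omega
        rw [(fromBelow_succ_of_notMem hX (by omega) (by omega) hm).2, h4]
        omega
  refine ⟨X, harr, fun i j hij => (dualMultigraph_adj_iff hk harr i j).2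
    ⟨i * n + (n - k), time_mem_active (by omega) (by omega), fun hm => ?_, ?_, ?_⟩⟩
  all_goals
    have hi := i.2
    obtain ⟨h1, h2⟩ := hmain i (by omega)
    have h3 := hcol i (by omega) h1 (n - k) (by omega) le_rfl
    have h4 := h2 (by omega)
  · have := fromBelow_lt_fromLeft hred (by omega) (by omega) hm
    omega
  · rw [state_time_lower (by omega), h3]
    omega
  · rw [state_time_upper (by omega) (by omega), h4]
    omega

/-- A function that is constant along the arcs of the dual multigraph of `T` takes the same value on
all beam vectors, so it is also constant along the arcs of every other dual multigraph. -/
theorem isConnected_dualMultigraph (hk : 1 ≤ k) (hn : 2 * k + 1 ≤ n)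
    (hX : (polygonNetwork n k).IsArrangement X) :
    (dualMultigraph n k (contactEdges n X)).IsConnected := by
  intro g hg
  have hconst : ∀ {X'}, (polygonNetwork n k).IsArrangement X' →
      beamVector n k (contactEdges n X') ⬝ᵥ g = beamVector n k (contactEdges n X) ⬝ᵥ g := by
    intro X' hX'
    have h1 := beamVector_sub_dotProduct_nonneg hk (by omega) hX hX' (g := g)
      fun i j h => (hg i j h).ge
    have h2 := beamVector_sub_dotProduct_nonneg hk (by omega) hX hX' (g := -g)
      fun i j h => by simp [hg i j h]
    rw [dotProduct_neg] at h2
    rw [sub_dotProduct] at h1 h2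
    linarith
  obtain ⟨X₀, hX₀, hadj⟩ := exists_forall_adj hk hn
  have hstep : ∀ i j : Fin (n - 2 * k), (i : ℕ) = j + 1 → g i = g j := by
    intro i j hij
    obtain ⟨X', hX', A, hA, h1⟩ := exists_beamVector_sub_eq hk hX₀ (hadj i j hij)
    have h2 := congrArg (· ⬝ᵥ g) h1
    simp only [sub_dotProduct, hconst hX', hconst hX₀, sub_self, smul_dotProduct,
      single_dotProduct, one_mul, smul_eq_mul] at h2
    rcases mul_eq_zero.1 h2.symm with h | h
    · exact absurd h hA.ne'
    · linarith
  have hzero : ∀ m (hm : m < n - 2 * k), g ⟨m, hm⟩ = g ⟨0, by omega⟩ := by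
    intro m
    induction m with
    | zero => exact fun _ => rfl
    | succ m ih => exact fun hm => (hstep ⟨m + 1, hm⟩ ⟨m, by omega⟩ rfl).trans (ih (by omega))
  exact fun i j => (hzero i i.2).trans (hzero j j.2).symm

theorem not_adj_self (hk : 1 ≤ k) (hX : (polygonNetwork n k).IsArrangement X)
    (i : Fin (n - 2 * k)) : ¬ (dualMultigraph n k (contactEdges n X)).Adj i i := by
  rw [dualMultigraph_adj_iff hk hX]
  rintro ⟨t, ht⟩
  exact ht.ne rfl

end Multitriangulation

theorem mainTheorem3 (n k : ℕ) (hk : 1 ≤ k) (hn : 2 * k + 1 ≤ n) (T : Finset (ℕ × ℕ))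
    (hT : Multitriangulation.IsKTriangulation n k T) :
    ConvexPolytope.coneAt (Multitriangulation.beamPolytope n k)
        (Multitriangulation.beamVector n k T) =
      (Multitriangulation.dualMultigraph n k T).incidenceCone ∧
    (Multitriangulation.beamVector n k T ∈
        (Multitriangulation.beamPolytope n k).extremePoints ℝ ↔
      (Multitriangulation.dualMultigraph n k T).Acyclic) ∧
    ∀ h : (Multitriangulation.dualMultigraph n k T).Acyclic,
      (ConvexPolytope.IsSimpleVertex (Multitriangulation.beamPolytope n k)
          (Multitriangulation.beamVector n k T) ↔
        ((Multitriangulation.dualMultigraph n k T).hasseDiagram h).IsTree) := by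
  obtain ⟨X, hX, rfl⟩ := (Multitriangulation.isKTriangulation_iff hk).1 hT
  have hC := Multitriangulation.coneAt_beamPolytope hk (by omega) hX
  have hP : Convex ℝ (Multitriangulation.beamPolytope n k) := convex_convexHull ℝ _
  have hp := Multitriangulation.beamVector_mem hk hX
  have : Nonempty (Fin (n - 2 * k)) := ⟨⟨0, by omega⟩⟩
  exact ⟨hC, DirectedMultigraph.mem_extremePoints_iff_acyclic _ hP hp hC
    (Multitriangulation.not_adj_self hk hX), fun h =>
      DirectedMultigraph.isSimpleVertex_iff_isTree h
        (Multitriangulation.isConnected_dualMultigraph hk hn hX) hP hp hC⟩
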